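/- Let $\mathcal X$ be a finite nonempty set of alternatives, $\mathbb K$ a finite set of parameters (the large pool), $f(x;\theta)$ a known real function such that distinct $\theta\in\mathbb K$ give distinct functions $f(\cdot\,;\theta)$ on $\mathcal X$, and $\theta^*\in\mathbb K$ the unknown true parameter. Measuring $x^n$ yields $\hat y^{n+1}=f(x^n;\theta^*)+W^{n+1}$ with $W^1,W^2,\dots$ i.i.d. $\mathcal N(0,\sigma^2)$, $\sigma>0$. Write $\phi(y,x,\theta)=\exp\!\big(-\tfrac{(y-f(x;\theta))^2}{2\sigma^2}\big)$, $\mathcal L^n(\theta)=\prod_{j=1}^{n}\phi(\hat y^{j},x^{j-1},\theta)$ and $MSE^n(\theta)=\frac1n\sum_{j=1}^n(\hat y^j-f(x^{j-1};\theta))^2$. **Algorithm.** Let the integers $L,R,k,n^{resamp}$ and the threshold $\epsilon$ satisfy $1\le k<L\le R\le|\mathbb K|$, $n^{resamp}\ge1$, $0<\epsilon<1/L$. At time $n$ there is a list of candidates $\theta^n_1,\dots,\theta^n_L\in\mathbb K$ (repetitions allowed, $\theta^*$ need not occur) with probabilities $p^n_1,\dots,p^n_L$. The initial list is arbitrary and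 $p^0_i=1/L$. The alternative $x^n$ is a maximizer over $\mathcal X$ of the score of the policy. With $p^{n+1}_i(x,y)=\phi(y,x,\theta^n_i)p^n_i/\sum_l\phi(y,x,\theta^n_l)p^n_l$, with $\bar f^n(x)=\sum_i f(x;\theta_i^n)p_i^n$, and with $\mathbb E^n$ the expectation over $y=f(x;\theta^n_j)+w$, where $j$ has law $p^n$ and $w\sim\mathcal N(0,\sigma^2)$ is independent of it, the scores are $$\nu^{KGDP\text{-}f,n}(x)=\mathbb E^n\Big[\max_{x'}\sum_i f(x';\theta_i^n)p_i^{n+1}(x,y)\Big]-\max_{x'}\bar f^n(x'),$$ $$\nu^{KGDP\text{-}H,n}(x)=\mathbb E^n\Big[\sum_i p_i^{n+1}(x,y)\log p_i^{n+1}(x,y)\Big]-\sum_i p_i^n\log p_i^n.$$ Several maximizers are resolved by a tie rule depending only on the set of maximizers, possibly randomized; for KGDP-$H$ it is arbitrary (for instance deterministic), for KGDP-$f$ every maximizer is chosen with positive probability (for instance uniformly at random). After $\hat y^{n+1}$ is observed, set $p_i=p^{n+1}_i(x^n,\hat y^{n+1})$. Resampling takes place if the current candidate list has been used for $n^{resamp}$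 iterations, or if more than $L/2$ candidates have $p_i<\epsilon$. One round of resampling removes all candidates with $p_i\le\epsilon$ (if there are none, the $k$ least probable ones), replaces them by a weighted sample without replacement from the small pool (those $\theta\in\mathbb K$ whose $MSE^{n+1}(\theta)$ is at most the $R$-th smallest value), the weights being the likelihoods $\mathcal L^{n+1}(\theta)$, and resets $p_i=\mathcal L^{n+1}(\theta_i)/\sum_l\mathcal L^{n+1}(\theta_l)$ for the new list; rounds are repeated as long as more than $L/2$ candidates have $p_i<\epsilon$. The outcome gives $\theta^{n+1}_i,p^{n+1}_i$. The noise lives on a probability space $(\Omega,\mathbb P)$; all random choices of the algorithm (resampling draws and ties) are driven by i.i.d. uniform variables on a second one $(\Omega_\theta,\mathbb P_\theta)$. **Theorem.** Under KGDP-$f$ and under KGDP-$H$, the following holds with probability $1$ on the product space $(\Omega,\mathbb P)\times(\Omega_\theta,\mathbb P_\theta)$. There is a finite (random) time after which $\theta^*$ is always in the candidate list. The total probability $p^n(\theta^*)=\sum_{i:\theta_i^n=\theta^*}p_i^n$ tends to $1$, and $\bar f^n(x)\to f(x;\theta^*)$ for every $x\in\mathcal X$. Hence the algorithm finds the optimal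 alternative and the correct parameter: for all sufficiently large $n$, every maximizer of $\bar f^n$ maximizes $f(\cdot\,;\theta^*)$ over $\mathcal X$, and $\theta^*$ is the unique minimizer of $MSE^n$ over $\mathbb K$. -/

import Mathlib

open MeasureTheory ProbabilityTheory Filter Topology

noncomputable section

namespace KGDP

/-- The two measurement policies: KGDP-`f` (value oriented) and KGDP-`H` (entropy oriented). -/
inductive Policy where
  | KGf : Policy
  | KGH : Policy

/-- The data of a problem instance and the tuning parameters of the resampling algorithm. -/
structure Config (X Θ : Type*) where
  /-- the known parametric model `f x θ` -/
  f : X → Θ → ℝ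
  /-- standard deviation of the measurement noise -/
  σ : ℝ
  /-- the large pool of parameters -/
  pool : Finset Θ
  /-- number of candidates -/
  L : ℕ
  /-- size of the small pool -/
  R : ℕ
  /-- number of candidates dropped when every candidate has probability above `ε` -/
  drop : ℕ
  /-- number of iterations after which a candidate set is resampled in any case -/
  nResamp : ℕ
  /-- probability threshold -/
  ε : ℝ
  /-- the policy in use -/
  policy : Policy
  /-- `tie A x` is the weight with which `x` is selected when `A` is the set of all maximizers
  of the score; a deterministic rule puts all its weight on one element of `A` -/
  tie : Finset X → X → ℝ

/-- The independent uniform variables that drive the algorithm: `tie n` selects among the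
maximizers of the score at time `n`, and `draw n r i` fills slot `i` of the candidate set in round
`r` of the resampling that follows the measurement made at time `n`. -/
inductive Seed (L : ℕ) where
  | tie (n : ℕ) : Seed L
  | draw (n r : ℕ) (i : Fin L) : Seed L

/-- The state of the algorithm between two measurements. -/
structure State (X Θ : Type*) (L : ℕ) where
  /-- the measurements `(x, y)` made so far, the latest one first -/
  hist : List (X × ℝ)
  /-- the candidates; repetitions are allowed -/
  cand : Fin L → Θ
  /-- the probabilities of the candidates -/
  prob : Fin L → ℝ
  /-- the number of iterations for which the present candidate set has been used -/
  age : ℕ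

section Sampling

variable {α : Type*}

/-- Auxiliary recursion for `roulette`. -/
def rouletteList (w : α → ℝ) (d : α) : List α → ℝ → α
  | [], _ => d
  | a :: l, t => if t ≤ w a then a else rouletteList w d l (t - w a)

/-- Inverse transform sampling: if `u` is uniform on `[0, 1]` and the weights are nonnegative with
a positive sum over `A`, then the result is `a ∈ A` with probability `w a / ∑ b ∈ A, w b`.
The default value `d` is irrelevant in that case. -/
def roulette (w : α → ℝ) (d : α) (A : Finset α) (u : ℝ) : α :=
  rouletteList w d A.toList (u * ∑ a ∈ A, w a)

open Classical in
/-- Sequential weighted sampling without replacement: the slots in the list are refilled one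
after the other, each with an element of the remaining set `A`, chosen with probability
proportional to its weight and then deleted from `A`. -/
def refill {L : ℕ} (w : α → ℝ) (u : Fin L → ℝ) :
    List (Fin L) → Finset α → (Fin L → α) → (Fin L → α)
  | [], _, c => c
  | i :: l, A, c =>
      refill w u l (A.erase (roulette w (c i) A (u i)))
        (Function.update c i (roulette w (c i) A (u i)))

/-- The set of maximizers of a function on a finite type. -/
def argmaxSet [Fintype α] (g : α → ℝ) : Finset α :=
  open Classical in Finset.univ.filter fun x => ∀ y, g y ≤ g x

end Sampling

namespace Config

variable {X Θ : Type*} (C : Config X Θ)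

/-- Likelihood of the value `y` measured at `x` under `θ`, without the constant factor. -/
def gauss (x : X) (y : ℝ) (θ : Θ) : ℝ :=
  Real.exp (-(y - C.f x θ) ^ 2 / (2 * C.σ ^ 2))

/-- Likelihood of `θ` given the whole history. -/
def likelihood (h : List (X × ℝ)) (θ : Θ) : ℝ :=
  (h.map fun z => C.gauss z.1 z.2 θ).prod

/-- Mean square error of `θ` given the whole history. -/
def mse (h : List (X × ℝ)) (θ : Θ) : ℝ :=
  (1 / (h.length : ℝ)) * (h.map fun z => (z.2 - C.f z.1 θ) ^ 2).sum

/-- The small pool: the parameters of the large pool whose mean square error is at most the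
`R`-th smallest one, that is, fewer than `R` parameters have a strictly smaller error. -/
def smallPool (h : List (X × ℝ)) : Finset Θ :=
  open Classical in C.pool.filter fun θ =>
    (C.pool.filter fun θ' => C.mse h θ' < C.mse h θ).card < C.R

/-- Bayes' rule: probabilities of the candidates `c` after `y` has been measured at `x`. -/
def posterior (c : Fin C.L → Θ) (p : Fin C.L → ℝ) (x : X) (y : ℝ) (i : Fin C.L) : ℝ :=
  C.gauss x y (c i) * p i / ∑ l, C.gauss x y (c l) * p l

/-- Probabilities of the candidates `c` computed from the whole history, with equal prior
probabilities. -/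
def probFromHist (h : List (X × ℝ)) (c : Fin C.L → Θ) (i : Fin C.L) : ℝ :=
  C.likelihood h (c i) / ∑ l, C.likelihood h (c l)

/-- The estimate `∑ i, f x (c i) * p i` of the true function. -/
def fbar (c : Fin C.L → Θ) (p : Fin C.L → ℝ) (x : X) : ℝ :=
  ∑ i, C.f x (c i) * p i

/-- The law of the measurement noise. -/
def noiseLaw : Measure ℝ := gaussianReal 0 (Real.toNNReal (C.σ ^ 2))

/-- KGDP-`f` score: expected increase of the maximal estimated value if `x` is measured next,
under the current belief. -/
def scoreF (c : Fin C.L → Θ) (p : Fin C.L → ℝ) (x : X) : ℝ :=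
  (∑ j, (∫ w, (⨆ x' : X, C.fbar c (C.posterior c p x (C.f x (c j) + w)) x') ∂C.noiseLaw) * p j)
    - ⨆ x' : X, C.fbar c p x'

/-- KGDP-`H` score: expected decrease of the entropy if `x` is measured next, under the
current belief. -/
def scoreH (c : Fin C.L → Θ) (p : Fin C.L → ℝ) (x : X) : ℝ :=
  (∑ j, (∫ w, (∑ i, C.posterior c p x (C.f x (c j) + w) i *
      Real.log (C.posterior c p x (C.f x (c j) + w) i)) ∂C.noiseLaw) * p j)
    - ∑ i, p i * Real.log (p i)

/-- The score used by the policy. -/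
def score (c : Fin C.L → Θ) (p : Fin C.L → ℝ) : X → ℝ :=
  match C.policy with
  | Policy.KGf => C.scoreF c p
  | Policy.KGH => C.scoreH c p

/-- The alternative measured next: a maximizer of the score, chosen among all maximizers by the
tie rule and the uniform variable `u`. -/
def nextAlt [Fintype X] [Nonempty X] (s : State X Θ C.L) (u : ℝ) : X :=
  roulette (C.tie (argmaxSet (C.score s.cand s.prob))) (Classical.arbitrary X)
    (argmaxSet (C.score s.cand s.prob)) u

/-- More than half of the candidates have probability lower than `ε`. -/
def TooManyLow (p : Fin C.L → ℝ) : Prop :=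
  open Classical in C.L < 2 * (Finset.univ.filter fun i => p i < C.ε).card

/-- The slots to be refilled: those of probability at most `ε`; if there are none, then the
`drop` least probable ones (equal probabilities being ordered by slot number). -/
def removed (p : Fin C.L → ℝ) : Finset (Fin C.L) :=
  open Classical in
  if ∃ i, p i ≤ C.ε then Finset.univ.filter fun i => p i ≤ C.ε
  else Finset.univ.filter fun i =>
    (Finset.univ.filter fun j => p j < p i ∨ (p j = p i ∧ j < i)).card < C.drop

/-- The candidate set and its probabilities after `r` rounds of resampling. In each round the
improbable candidates are replaced by a weighted sample without replacement from the small pool,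
with the likelihoods as weights, and the probabilities are recomputed from the whole history. -/
def rounds (h : List (X × ℝ)) (u : ℕ → Fin C.L → ℝ)
    (c : Fin C.L → Θ) (p : Fin C.L → ℝ) : ℕ → (Fin C.L → Θ) × (Fin C.L → ℝ)
  | 0 => (c, p)
  | r + 1 =>
      let q := rounds h u c p r
      let c' := refill (C.likelihood h) (u r) ((C.removed q.2).sort (· ≤ ·)) (C.smallPool h) q.1
      (c', C.probFromHist h c')

/-- The full resampling: at least one round, repeated until at most half of the
candidates have probability lower than `ε`. -/
def resample (h : List (X × ℝ)) (u : ℕ → Fin C.L → ℝ)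
    (c : Fin C.L → Θ) (p : Fin C.L → ℝ) : (Fin C.L → Θ) × (Fin C.L → ℝ) :=
  C.rounds h u c p (sInf {r | 1 ≤ r ∧ ¬ C.TooManyLow (C.rounds h u c p r).2})

/-- One iteration, in which `y` is measured at `x`: Bayes' rule, followed by resampling
if the candidate set has been used for `nResamp` iterations or if too many candidates have low
probability. -/
def update (s : State X Θ C.L) (x : X) (y : ℝ) (u : ℕ → Fin C.L → ℝ) : State X Θ C.L :=
  open Classical in
  let h := (x, y) :: s.hist
  let p := C.posterior s.cand s.prob x y
  if C.nResamp ≤ s.age + 1 ∨ C.TooManyLow p then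
    let q := C.resample h u s.cand p
    { hist := h, cand := q.1, prob := q.2, age := 0 }
  else
    { hist := h, cand := s.cand, prob := p, age := s.age + 1 }

/-- The state after `n` measurements, as a function of the initial candidates `c₀`, the true
parameter `θs`, the noise sequence `W` (`W n` is the noise of measurement number `n + 1`) and the
uniform variables `U`. -/
def state [Fintype X] [Nonempty X] (c₀ : Fin C.L → Θ) (θs : Θ) (W : ℕ → ℝ)
    (U : Seed C.L → ℝ) : ℕ → State X Θ C.L
  | 0 => { hist := [], cand := c₀, prob := fun _ => 1 / (C.L : ℝ), age := 0 }
  | n + 1 =>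
      let s := state c₀ θs W U n
      let x := C.nextAlt s (U (Seed.tie n))
      C.update s x (C.f x θs + W n) fun r i => U (Seed.draw n r i)

/-- The probability that the state assigns to the parameter `θ`: the total probability of the
slots that contain `θ`. -/
def probOf (s : State X Θ C.L) (θ : Θ) : ℝ :=
  open Classical in ∑ i, if s.cand i = θ then s.prob i else 0

end Config

end KGDP

end

/-! The probabilities in use are always the normalised likelihoods of the whole history
(`Admissible.run_prob`), because Bayes' rule and the reset after a resampling agree on this. The
theorem is therefore a statement about which likelihoods survive.

Given the past, the square root of the likelihood ratio of θ against the truth is multiplied on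
average by exp(-d²/(8σ²)), where d is the gap between the two models at the measured alternative. It
is a nonnegative supermartingale with a uniform loss whenever the alternative separates θ from the
truth. The losses are summable, so the ratio tends to 0 if separating alternatives are measured
infinitely often (`ae_tendsto_sqrtRatio`, `eventually_likelihood_lt`); otherwise it freezes at a
positive constant (`exists_eventually_likelihood_eq`). Let E be the random set of parameters of the
second kind; it contains θ*.

The heart is E = {θ*} (`Typical.indistinguishable_eq`). Suppose that E has a second element. Let M
and T be the two most likely elements of E. Eventually their likelihood ratio is constant and
everything outside E is negligible. Each resampling then has a probability bounded below of leading
towards a "mixed" list, with all candidates in E and not all equal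
(`Admissible.exists_box_resample`). A conditional Borel-Cantelli lemma (`ae_frequently_of_subst`)
gives infinitely many mixed lists. At a late mixed list all candidates agree at the measured
alternative, so the maximal score is 0. Under KGDP-H this is impossible: an alternative separating
two candidates has positive score, by strict convexity of t log t (`scoreH_pos`). Under KGDP-f all
scores are nonnegative by Jensen (`scoreF_nonneg`), so every alternative is a maximizer; the random
tie rule then measures each of them infinitely often, including one that separates an element of E
from θ*, against the definition of E.

Once E = {θ*}, all other likelihoods are negligible. Some resampling brings θ* into the list, no
later one removes it (`eventually_exists_cand_eq`), and the limits follow.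

Instead of conditional expectations, the proof works on the product space of all noise variables and
seeds and replaces a block of coordinates by an independent copy (`lintegral_subst`). -/

namespace KGDP

/-! ### Inverse transform sampling and boxes of seeds that force the draws. -/

section Roulette

variable {α : Type*}

theorem rouletteList_mem_or_eq (w : α → ℝ) (d : α) (l : List α) (t : ℝ) :
    rouletteList w d l t ∈ l ∨ rouletteList w d l t = d := by
  induction l generalizing t with
  | nil => exact Or.inr rfl
  | cons a l ih =>
    unfold rouletteList
    split_ifs with h
    · simp
    · rcases ih (t - w a) with h | h
      · exact Or.inl (List.mem_cons_of_mem _ h)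
      · exact Or.inr h

theorem rouletteList_mem (w : α → ℝ) (d : α) (l : List α) (hl : l ≠ []) (t : ℝ)
    (ht : t ≤ (l.map w).sum) : rouletteList w d l t ∈ l := by
  induction l generalizing t with
  | nil => exact absurd rfl hl
  | cons a l ih =>
    unfold rouletteList
    split_ifs with h
    · simp
    · rw [List.map_cons, List.sum_cons] at ht
      refine List.mem_cons_of_mem _ (ih ?_ _ (by linarith))
      rintro rfl
      simp at ht
      exact h ht

theorem rouletteList_append_cons (w : α → ℝ) (d a : α) (l₁ l₂ : List α)
    (hw : ∀ b ∈ l₁, 0 ≤ w b) (t : ℝ) (h1 : (l₁.map w).sum < t)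
    (h2 : t ≤ (l₁.map w).sum + w a) : rouletteList w d (l₁ ++ a :: l₂) t = a := by
  induction l₁ generalizing t with
  | nil =>
    simp only [List.map_nil, List.sum_nil, zero_add] at h2
    simp [rouletteList, h2]
  | cons b l ih =>
    simp only [List.map_cons, List.sum_cons] at h1 h2
    have hnn : 0 ≤ (l.map w).sum := List.sum_nonneg (by
      intro x hx
      obtain ⟨c, hc, rfl⟩ := List.mem_map.1 hx
      exact hw c (List.mem_cons_of_mem _ hc))
    rw [List.cons_append, rouletteList, if_neg (by linarith)]
    exact ih (fun c hc => hw c (List.mem_cons_of_mem _ hc)) _ (by linarith) (by linarith)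

theorem roulette_mem_or_eq (w : α → ℝ) (d : α) (A : Finset α) (u : ℝ) :
    roulette w d A u ∈ A ∨ roulette w d A u = d := by
  simpa [roulette] using rouletteList_mem_or_eq w d A.toList (u * ∑ a ∈ A, w a)

theorem roulette_mem (w : α → ℝ) (d : α) (A : Finset α) (hA : A.Nonempty)
    (hw : ∀ a ∈ A, 0 ≤ w a) (u : ℝ) (hu : u ≤ 1) : roulette w d A u ∈ A := by
  have h := rouletteList_mem w d A.toList (by simpa using hA.ne_empty) (u * ∑ a ∈ A, w a) (by
    rw [Finset.sum_map_toList]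
    exact mul_le_of_le_one_left (Finset.sum_nonneg hw) hu)
  simpa [roulette] using h

/-- The uniform distribution on the unit interval. -/
noncomputable abbrev unif : Measure ℝ := volume.restrict (Set.Icc (0 : ℝ) 1)

instance : IsProbabilityMeasure unif :=
  ⟨by simp [unif]⟩

/-- The seeds that select `a` contain an interval of length `w a / ∑ b ∈ A, w b`, starting at the
normalised weight of the elements listed before `a`. -/
theorem exists_roulette_eq (w : α → ℝ) (d : α) (A : Finset α) (hw : ∀ a ∈ A, 0 ≤ w a)
    (hpos : 0 < ∑ a ∈ A, w a) (a : α) (ha : a ∈ A) (δ : ℝ) (hδ : δ * ∑ b ∈ A, w b ≤ w a) :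
    ∃ I : Set ℝ, MeasurableSet I ∧ ENNReal.ofReal δ ≤ unif I ∧
      ∀ u ∈ I, roulette w d A u = a := by
  obtain ⟨l₁, l₂, hl⟩ := List.append_of_mem (Finset.mem_toList.2 ha)
  set S := ∑ b ∈ A, w b with hS
  have hsum : S = (l₁.map w).sum + (w a + (l₂.map w).sum) := by
    rw [hS, ← Finset.sum_map_toList, hl]; simp
  have hnn : ∀ l : List α, (∀ b ∈ l, b ∈ A) → 0 ≤ (l.map w).sum := fun l hl' =>
    List.sum_nonneg (by
      intro x hx
      obtain ⟨c, hc, rfl⟩ := List.mem_map.1 hx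
      exact hw c (hl' c hc))
  have hm1 : ∀ b ∈ l₁, b ∈ A := fun b hb => Finset.mem_toList.1 (by rw [hl]; simp [hb])
  have hm2 : ∀ b ∈ l₂, b ∈ A := fun b hb => Finset.mem_toList.1 (by rw [hl]; simp [hb])
  have h1 := hnn l₁ hm1
  have h2 := hnn l₂ hm2
  refine ⟨Set.Ioc ((l₁.map w).sum / S) (((l₁.map w).sum + w a) / S), measurableSet_Ioc, ?_, ?_⟩
  · have hsub : Set.Ioc ((l₁.map w).sum / S) (((l₁.map w).sum + w a) / S) ⊆ Set.Icc 0 1 := by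
      intro u hu
      refine ⟨(div_nonneg h1 hpos.le).trans hu.1.le, hu.2.trans ?_⟩
      rw [div_le_one hpos]; linarith
    rw [Measure.restrict_apply measurableSet_Ioc, Set.inter_eq_left.2 hsub, Real.volume_Ioc]
    apply ENNReal.ofReal_le_ofReal
    rw [← sub_div, add_sub_cancel_left, le_div_iff₀ hpos]
    exact hδ
  · intro u hu
    unfold roulette
    rw [hl]
    refine rouletteList_append_cons w d a l₁ l₂ (fun b hb => hw b (hm1 b hb)) _ ?_ ?_
    · exact (div_lt_iff₀ hpos).1 hu.1
    · exact (le_div_iff₀ hpos).1 hu.2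

theorem refill_of_notMem {L : ℕ} (w : α → ℝ) (u : Fin L → ℝ) (l : List (Fin L)) (A : Finset α)
    (c : Fin L → α) (i : Fin L) (hi : i ∉ l) : refill w u l A c i = c i := by
  induction l generalizing A c with
  | nil => rfl
  | cons j l ih =>
    rw [List.mem_cons, not_or] at hi
    rw [refill, ih _ _ hi.2, Function.update_of_ne hi.1]

theorem refill_mem {L : ℕ} (w : α → ℝ) (u : Fin L → ℝ) (l : List (Fin L)) (A B : Finset α)
    (hAB : A ⊆ B) (c : Fin L → α) (hc : ∀ i, c i ∈ B) (i : Fin L) : refill w u l A c i ∈ B := by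
  induction l generalizing A c with
  | nil => exact hc i
  | cons j l ih =>
    classical
    rw [refill]
    refine ih _ ((Finset.erase_subset _ _).trans hAB) _ fun k => ?_
    rcases eq_or_ne k j with rfl | hk
    · rw [Function.update_self]
      rcases roulette_mem_or_eq w (c k) A (u k) with h | h
      · exact hAB h
      · rw [h]; exact hc k
    · rw [Function.update_of_ne hk]; exact hc k

/-- Always draw the heaviest remaining element: its share is at least `1 / K`, whatever the weights
are. A product of seed intervals thus makes the whole refill deterministic, with a probability
bounded below uniformly in the weights. -/
theorem exists_refill_eq {L K : ℕ} (w : α → ℝ) (hw : ∀ a, 0 < w a) (δ : ℝ) (hδ1 : δ ≤ 1)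
    (hδK : δ * K ≤ 1) (l : List (Fin L)) (hl : l.Nodup) (A : Finset α)
    (hlA : l.length ≤ A.card) (hAK : A.card ≤ K) (c : Fin L → α) :
    ∃ (c' : Fin L → α) (I : Fin L → Set ℝ),
      (∀ i, MeasurableSet (I i) ∧ ENNReal.ofReal δ ≤ unif (I i)) ∧
      (∀ u : Fin L → ℝ, (∀ i ∈ l, u i ∈ I i) → refill w u l A c = c') ∧
      (∀ i ∉ l, c' i = c i) ∧ ∀ i ∈ l, c' i ∈ A := by
  classical
  induction l generalizing A c with
  | nil =>
    refine ⟨c, fun _ => Set.univ, fun i => ⟨MeasurableSet.univ, ?_⟩, fun _ _ => rfl, fun _ _ => rfl, by simp⟩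
    rw [measure_univ, ENNReal.ofReal_le_one]; exact hδ1
  | cons i l ih =>
    rw [List.length_cons] at hlA
    have hA : A.Nonempty := Finset.card_pos.1 (by omega)
    obtain ⟨a, ha, hmax⟩ := A.exists_max_image w hA
    have hle : δ * ∑ b ∈ A, w b ≤ w a := by
      have h1 : ∑ b ∈ A, w b ≤ A.card * w a := by
        rw [← nsmul_eq_mul]; exact Finset.sum_le_card_nsmul _ _ _ hmax
      have h2 : (A.card : ℝ) ≤ K := by exact_mod_cast hAK
      have h3 := hw a
      have h4 : 0 ≤ ∑ b ∈ A, w b := Finset.sum_nonneg fun b _ => (hw b).le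
      rcases le_or_gt δ 0 with h | h
      · nlinarith
      · calc δ * ∑ b ∈ A, w b ≤ δ * (K * w a) := by gcongr; exact h1.trans (by gcongr)
          _ = (δ * K) * w a := by ring
          _ ≤ w a := mul_le_of_le_one_left h3.le hδK
    obtain ⟨J, hJm, hJ, hJr⟩ := exists_roulette_eq w (c i) A (fun b _ => (hw b).le)
      (Finset.sum_pos (fun b _ => hw b) hA) a ha δ hle
    rw [List.nodup_cons] at hl
    obtain ⟨c', I, hI, hI', hn', hc'⟩ := ih hl.2 (A.erase a)
      (by rw [Finset.card_erase_of_mem ha]; omega)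
      ((Finset.card_le_card (Finset.erase_subset _ _)).trans hAK) (Function.update c i a)
    refine ⟨c', Function.update I i J, fun j => ?_, fun u hu => ?_,
      fun j hj => ?_, fun j hj => ?_⟩
    · rcases eq_or_ne j i with rfl | hj
      · rw [Function.update_self]; exact ⟨hJm, hJ⟩
      · rw [Function.update_of_ne hj]; exact hI j
    · have hi := hu i (by simp)
      rw [Function.update_self] at hi
      rw [refill, hJr _ hi]
      convert hI' u fun j hj => ?_
      have := hu j (List.mem_cons_of_mem _ hj)
      rwa [Function.update_of_ne (by rintro rfl; exact hl.1 hj)] at this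
    · rw [List.mem_cons, not_or] at hj
      rw [hn' j hj.2, Function.update_of_ne hj.1]
    · rcases List.mem_cons.1 hj with rfl | hj
      · rw [hn' _ hl.1, Function.update_self]; exact ha
      · exact Finset.mem_of_mem_erase (hc' j hj)

/-- Only the first draw is prescribed; the others follow the heaviest element. Since `a` is erased
after its draw, it cannot occur in a later slot of the same round. -/
theorem exists_refill_cons_eq {L K : ℕ} (w : α → ℝ) (hw : ∀ a, 0 < w a) (δ : ℝ) (hδ1 : δ ≤ 1)
    (hδK : δ * K ≤ 1) (i : Fin L) (l : List (Fin L)) (hl : (i :: l).Nodup) (A : Finset α)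
    (hlA : (i :: l).length ≤ A.card) (hAK : A.card ≤ K) (c : Fin L → α) (a : α) (ha : a ∈ A)
    (hδ : δ * ∑ b ∈ A, w b ≤ w a) :
    ∃ (c' : Fin L → α) (I : Fin L → Set ℝ),
      (∀ i, MeasurableSet (I i) ∧ ENNReal.ofReal δ ≤ unif (I i)) ∧
      (∀ u : Fin L → ℝ, (∀ i, u i ∈ I i) → refill w u (i :: l) A c = c') ∧
      (∀ j ∉ i :: l, c' j = c j) ∧ c' i = a ∧ ∀ j ∈ l, c' j ∈ A ∧ c' j ≠ a := by
  classical
  rw [List.length_cons] at hlA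
  rw [List.nodup_cons] at hl
  obtain ⟨J, hJm, hJ, hJr⟩ := exists_roulette_eq w (c i) A (fun b _ => (hw b).le)
    (Finset.sum_pos (fun b _ => hw b) ⟨a, ha⟩) a ha δ hδ
  obtain ⟨c', I, hI, hI', hn', hc'⟩ := exists_refill_eq w hw δ hδ1 hδK l hl.2 (A.erase a)
    (by rw [Finset.card_erase_of_mem ha]; omega)
    ((Finset.card_le_card (Finset.erase_subset _ _)).trans hAK) (Function.update c i a)
  refine ⟨c', Function.update I i J, fun j => ?_, fun u hu => ?_,
      fun j hj => ?_, ?_, fun j hj => ?_⟩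
  · rcases eq_or_ne j i with rfl | hj
    · rw [Function.update_self]; exact ⟨hJm, hJ⟩
    · rw [Function.update_of_ne hj]; exact hI j
  · have hi := hu i
    rw [Function.update_self] at hi
    rw [refill, hJr _ hi]
    convert hI' u fun j hj => ?_
    have := hu j
    rwa [Function.update_of_ne (by rintro rfl; exact hl.1 hj)] at this
  · rw [List.mem_cons, not_or] at hj
    rw [hn' j hj.2, Function.update_of_ne hj.1]
  · rw [hn' _ hl.1, Function.update_self]
  · exact ⟨Finset.mem_of_mem_erase (hc' j hj), Finset.ne_of_mem_erase (hc' j hj)⟩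

end Roulette

end KGDP

/-! ### Likelihoods, the small pool, and the slots removed in a round. -/

namespace KGDP

namespace Config

variable {X Θ : Type*}

/-- The standing assumptions on the tuning parameters. -/
structure Admissible (C : Config X Θ) : Prop where
  σ_pos : 0 < C.σ
  L_le : C.L ≤ C.R
  R_le : C.R ≤ C.pool.card
  drop_pos : 1 ≤ C.drop
  drop_lt : C.drop < C.L
  res_pos : 1 ≤ C.nResamp
  ε_pos : 0 < C.ε
  ε_lt : C.ε < 1 / (C.L : ℝ)

variable {C : Config X Θ}

theorem Admissible.two_le (hC : C.Admissible) : 2 ≤ C.L := by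
  have := hC.drop_pos; have := hC.drop_lt; omega

theorem Admissible.L_pos (hC : C.Admissible) : (0 : ℝ) < C.L := by
  have := hC.two_le
  exact_mod_cast (by omega : 0 < C.L)

theorem gauss_pos (C : Config X Θ) (x : X) (y : ℝ) (θ : Θ) : 0 < C.gauss x y θ :=
  Real.exp_pos _

theorem likelihood_cons (C : Config X Θ) (x : X) (y : ℝ) (h : List (X × ℝ)) (θ : Θ) :
    C.likelihood ((x, y) :: h) θ = C.gauss x y θ * C.likelihood h θ := by
  simp [likelihood]

theorem likelihood_pos (C : Config X Θ) (h : List (X × ℝ)) (θ : Θ) : 0 < C.likelihood h θ := by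
  induction h with
  | nil => simp [likelihood]
  | cons z h ih => rw [likelihood_cons]; exact mul_pos (C.gauss_pos _ _ _) ih

theorem likelihood_eq_exp (C : Config X Θ) (h : List (X × ℝ)) (θ : Θ) :
    C.likelihood h θ =
      Real.exp (-(h.map fun z => (z.2 - C.f z.1 θ) ^ 2).sum / (2 * C.σ ^ 2)) := by
  induction h with
  | nil => simp [likelihood]
  | cons z h ih =>
    rw [likelihood_cons, ih, gauss, ← Real.exp_add, List.map_cons, List.sum_cons]
    congr 1; ring

theorem Admissible.likelihood_lt_of_mse_lt (hC : C.Admissible) {h : List (X × ℝ)} {θ θ' : Θ}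
    (hlt : C.mse h θ' < C.mse h θ) : C.likelihood h θ < C.likelihood h θ' := by
  have hσ := hC.σ_pos
  rw [likelihood_eq_exp, likelihood_eq_exp, Real.exp_lt_exp]
  have := lt_of_mul_lt_mul_left hlt (by positivity)
  gcongr

theorem Admissible.mse_lt_of_likelihood_lt (hC : C.Admissible) {h : List (X × ℝ)} {θ θ' : Θ}
    (hlt : C.likelihood h θ < C.likelihood h θ') : C.mse h θ' < C.mse h θ := by
  have hσ := hC.σ_pos
  -- For an empty history `mse` is 0 by the convention `1 / 0 = 0`, but then all likelihoods equal
  -- 1.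
  have hne : h ≠ [] := by rintro rfl; simp [likelihood] at hlt
  have hlen : (0 : ℝ) < h.length := by exact_mod_cast List.length_pos_iff.2 hne
  rw [likelihood_eq_exp, likelihood_eq_exp, Real.exp_lt_exp,
    div_lt_div_iff_of_pos_right (by positivity), neg_lt_neg_iff] at hlt
  unfold mse
  gcongr

theorem smallPool_subset (C : Config X Θ) (h : List (X × ℝ)) : C.smallPool h ⊆ C.pool := by
  classical
  exact Finset.filter_subset _ _

/-- If the small pool had fewer than `R` elements, take the best parameter outside it. All strictly
better ones lie inside, so they number fewer than `R`, and the parameter would belong to the small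
pool. -/
theorem Admissible.card_smallPool (hC : C.Admissible) (h : List (X × ℝ)) :
    C.R ≤ (C.smallPool h).card := by
  classical
  by_contra! hlt
  have hne : (C.pool \ C.smallPool h).Nonempty := by
    rw [← Finset.card_pos, Finset.card_sdiff_of_subset (C.smallPool_subset h)]
    have := hC.R_le
    omega
  obtain ⟨θ, hθ, hmin⟩ := Finset.exists_min_image _ (C.mse h) hne
  rw [Finset.mem_sdiff] at hθ
  apply hθ.2
  unfold smallPool
  rw [Finset.mem_filter]
  refine ⟨hθ.1, lt_of_le_of_lt (Finset.card_le_card fun θ' hθ' => ?_) hlt⟩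
  rw [Finset.mem_filter] at hθ'
  by_contra hn
  exact absurd (hmin θ' (Finset.mem_sdiff.2 ⟨hθ'.1, hn⟩)) (not_le.2 hθ'.2)

/-- At most `M` has a smaller error than `T`, and `R ≥ L ≥ 2`. Hence both the best and the second
best parameter can be drawn. -/
theorem Admissible.mem_smallPool (hC : C.Admissible) {h : List (X × ℝ)} {M T : Θ}
    (hT : T ∈ C.pool)
    (hle : ∀ θ ∈ C.pool, θ ≠ M → C.likelihood h θ ≤ C.likelihood h T) : T ∈ C.smallPool h := by
  classical
  unfold smallPool
  rw [Finset.mem_filter]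
  refine ⟨hT, lt_of_le_of_lt (Finset.card_le_card (t := {M}) fun θ hθ => ?_) ?_⟩
  · rw [Finset.mem_filter] at hθ
    rw [Finset.mem_singleton]
    by_contra hne
    exact absurd (hle θ hθ.1 hne) (not_le.2 (hC.likelihood_lt_of_mse_lt hθ.2))
  · have := hC.two_le; have := hC.L_le
    rw [Finset.card_singleton]; omega

section Probabilities

variable (C) in
theorem sum_likelihood_pos (hL : 0 < C.L) (h : List (X × ℝ)) (c : Fin C.L → Θ) :
    0 < ∑ l, C.likelihood h (c l) :=
  Finset.sum_pos (fun _ _ => C.likelihood_pos _ _) ⟨⟨0, hL⟩, Finset.mem_univ _⟩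

theorem Admissible.sum_probFromHist (hC : C.Admissible) (h : List (X × ℝ)) (c : Fin C.L → Θ) :
    ∑ i, C.probFromHist h c i = 1 := by
  have := C.sum_likelihood_pos (by have := hC.two_le; omega) h c
  unfold probFromHist
  rw [← Finset.sum_div, div_self this.ne']

theorem Admissible.probFromHist_pos (hC : C.Admissible) (h : List (X × ℝ)) (c : Fin C.L → Θ)
    (i : Fin C.L) : 0 < C.probFromHist h c i :=
  div_pos (C.likelihood_pos _ _) (C.sum_likelihood_pos (by have := hC.two_le; omega) h c)

/-- The largest of `L` probabilities is at least `1 / L`, which exceeds `ε`. -/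
theorem Admissible.ε_lt_probFromHist (hC : C.Admissible) (h : List (X × ℝ)) (c : Fin C.L → Θ)
    (i : Fin C.L) (hmax : ∀ j, C.likelihood h (c j) ≤ C.likelihood h (c i)) :
    C.ε < C.probFromHist h c i := by
  refine hC.ε_lt.trans_le ?_
  have hpos := C.sum_likelihood_pos (by have := hC.two_le; omega) h c
  unfold probFromHist
  rw [div_le_div_iff₀ hC.L_pos hpos, one_mul]
  calc ∑ l, C.likelihood h (c l) ≤ ∑ _l : Fin C.L, C.likelihood h (c i) :=
        Finset.sum_le_sum fun j _ => hmax j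
    _ = C.likelihood h (c i) * C.L := by simp [mul_comm]

theorem Admissible.probFromHist_lt (hC : C.Admissible) (h : List (X × ℝ)) (c : Fin C.L → Θ)
    (i j : Fin C.L) {e : ℝ} (he : 0 < e)
    (hlt : C.likelihood h (c i) < e * C.likelihood h (c j)) : C.probFromHist h c i < e := by
  have hpos := C.sum_likelihood_pos (by have := hC.two_le; omega) h c
  unfold probFromHist
  rw [div_lt_iff₀ hpos]
  refine hlt.trans_le ?_
  gcongr
  exact Finset.single_le_sum (f := fun l => C.likelihood h (c l))
    (fun _ _ => (C.likelihood_pos _ _).le) (Finset.mem_univ j)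

/-- The old normalising constant cancels. Bayes' rule therefore preserves the form that a reset
produces. -/
theorem posterior_probFromHist (hC : C.Admissible) (h : List (X × ℝ)) (c : Fin C.L → Θ)
    (x : X) (y : ℝ) :
    C.posterior c (C.probFromHist h c) x y = C.probFromHist ((x, y) :: h) c := by
  have hpos := C.sum_likelihood_pos (by have := hC.two_le; omega) h c
  funext i
  unfold posterior probFromHist
  simp_rw [likelihood_cons, mul_div_assoc']
  rw [← Finset.sum_div, div_div_div_cancel_right₀ hpos.ne']

end Probabilities

section Removed

theorem mem_removed_of_exists {p : Fin C.L → ℝ} (h : ∃ i, p i ≤ C.ε) (i : Fin C.L) :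
    i ∈ C.removed p ↔ p i ≤ C.ε := by
  classical
  unfold removed
  rw [if_pos h]
  simp

theorem mem_removed_of_not_exists {p : Fin C.L → ℝ} (h : ¬ ∃ i, p i ≤ C.ε) (i : Fin C.L) :
    open Classical in i ∈ C.removed p ↔
      (Finset.univ.filter fun j => p j < p i ∨ (p j = p i ∧ j < i)).card < C.drop := by
  classical
  unfold removed
  rw [if_neg h, Finset.mem_filter]
  simp only [Finset.mem_univ, true_and]

theorem Admissible.removed_nonempty (hC : C.Admissible) (p : Fin C.L → ℝ) :
    (C.removed p).Nonempty := by
  classical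
  by_cases h : ∃ i, p i ≤ C.ε
  · obtain ⟨i, hi⟩ := h
    exact ⟨i, (mem_removed_of_exists ⟨i, hi⟩ i).2 hi⟩
  · have hne : (Finset.univ : Finset (Fin C.L)).Nonempty :=
      ⟨⟨0, by have := hC.two_le; omega⟩, Finset.mem_univ _⟩
    -- The lexicographic minimum has rank 0 in the order by probability with ties broken by slot
    -- number, and `drop ≥ 1`.
    obtain ⟨i, -, hi⟩ := Finset.exists_min_image Finset.univ (fun i => toLex (p i, i)) hne
    refine ⟨i, (mem_removed_of_not_exists h i).2 ?_⟩
    rw [Finset.filter_false_of_mem, Finset.card_empty]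
    · exact hC.drop_pos
    · intro j hj hlt
      have := hi j hj
      rw [Prod.Lex.toLex_le_toLex] at this
      rcases this with h1 | ⟨h1, h2⟩ <;> rcases hlt with h3 | ⟨h3, h4⟩
      · exact lt_asymm h1 h3
      · exact h1.ne h3.symm
      · exact h3.ne h1.symm
      · exact absurd h4 (not_lt.2 h2)

/-- If the threshold decides, the most likely candidate survives; otherwise the lexicographically
greatest slot has rank `L - 1 ≥ drop` and is kept. -/
theorem Admissible.exists_notMem_removed (hC : C.Admissible) (h : List (X × ℝ))
    (c : Fin C.L → Θ) : ∃ i, i ∉ C.removed (C.probFromHist h c) := by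
  classical
  have hne : (Finset.univ : Finset (Fin C.L)).Nonempty :=
      ⟨⟨0, by have := hC.two_le; omega⟩, Finset.mem_univ _⟩
  by_cases hex : ∃ i, C.probFromHist h c i ≤ C.ε
  · obtain ⟨i, -, hi⟩ := Finset.exists_max_image Finset.univ (fun i => C.likelihood h (c i)) hne
    refine ⟨i, fun hm => ?_⟩
    rw [mem_removed_of_exists hex] at hm
    exact absurd (hC.ε_lt_probFromHist h c i fun j => hi j (Finset.mem_univ _)) (not_lt.2 hm)
  · set p := C.probFromHist h c
    obtain ⟨i, -, hi⟩ := Finset.exists_max_image Finset.univ (fun i => toLex (p i, i)) hne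
    refine ⟨i, fun hm => ?_⟩
    rw [mem_removed_of_not_exists hex] at hm
    have hsub : Finset.univ.erase i ⊆
        Finset.univ.filter fun j => p j < p i ∨ (p j = p i ∧ j < i) := fun j hj => by
      have h1 := hi j (Finset.mem_univ _)
      rw [Prod.Lex.toLex_le_toLex] at h1
      rw [Finset.mem_filter]
      refine ⟨Finset.mem_univ _, h1.imp id fun h2 => ⟨h2.1, ?_⟩⟩
      exact lt_of_le_of_ne h2.2 (Finset.ne_of_mem_erase hj)
    have := Finset.card_le_card hsub
    rw [Finset.card_erase_of_mem (Finset.mem_univ _), Finset.card_univ, Fintype.card_fin] at this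
    have := hC.drop_lt
    omega

/-- More than half of `L ≥ 2` slots means at least two. So a repeated round refills at least two
slots and, drawing without replacement, cannot fill the list with a single parameter. -/
theorem Admissible.tooManyLow_imp (hC : C.Admissible) {p : Fin C.L → ℝ} (h : C.TooManyLow p) :
    (∃ i, p i ≤ C.ε) ∧ 2 ≤ (C.removed p).card := by
  classical
  unfold TooManyLow at h
  have h2 := hC.two_le
  have hcard : 2 ≤ (Finset.univ.filter fun i => p i < C.ε).card := by
    by_contra hlt
    have : (Finset.univ.filter fun i => p i < C.ε).card ≤ 1 := by omega
    have h' : C.L < 2 * (Finset.univ.filter fun i => p i < C.ε).card := by convert h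
    omega
  have hex : ∃ i, p i ≤ C.ε := by
    obtain ⟨i, hi⟩ := Finset.card_pos.1 (by omega :
      0 < (Finset.univ.filter fun i => p i < C.ε).card)
    exact ⟨i, (Finset.mem_filter.1 hi).2.le⟩
  refine ⟨hex, hcard.trans (Finset.card_le_card fun i hi => ?_)⟩
  rw [mem_removed_of_exists hex]
  exact (Finset.mem_filter.1 hi).2.le

end Removed

end Config

end KGDP

/-! ### Progress of one resampling towards a mixed list, for seeds in a suitable box. -/

namespace KGDP

namespace Config

variable {X Θ : Type*} {C : Config X Θ}

/-- The candidate list `c'` arises from `c` by refilling the slots in `A` with elements of `B`,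
where the element `t` is used exactly once. -/
structure IsRefill (B : Finset Θ) (A : Finset (Fin C.L)) (c c' : Fin C.L → Θ) (t : Θ) : Prop where
  eq_of_notMem : ∀ i ∉ A, c' i = c i
  mem : ∀ i ∈ A, c' i ∈ B
  exists_unique : ∃ i ∈ A, c' i = t ∧ ∀ j ∈ A, j ≠ i → c' j ≠ t

theorem Admissible.exists_box_round (hC : C.Admissible) (h : List (X × ℝ)) (c : Fin C.L → Θ)
    (A : Finset (Fin C.L)) (hA : A.Nonempty) (t : Θ) (ht : t ∈ C.smallPool h)
    (δ : ℝ) (hδ1 : δ ≤ 1) (hδK : δ * C.pool.card ≤ 1)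
    (hδ : δ * ∑ θ ∈ C.smallPool h, C.likelihood h θ ≤ C.likelihood h t) :
    ∃ (c' : Fin C.L → Θ) (I : Fin C.L → Set ℝ),
      (∀ i, MeasurableSet (I i) ∧ ENNReal.ofReal δ ≤ unif (I i)) ∧
      (∀ u : Fin C.L → ℝ, (∀ i, u i ∈ I i) →
        refill (C.likelihood h) u (A.sort (· ≤ ·)) (C.smallPool h) c = c') ∧
      IsRefill C.pool A c c' t := by
  have hmem : ∀ i, i ∈ A.sort (· ≤ ·) ↔ i ∈ A := fun i => Finset.mem_sort _
  have hnd : (A.sort (· ≤ ·)).Nodup := Finset.sort_nodup _ _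
  have hlen : (A.sort (· ≤ ·)).length ≤ (C.smallPool h).card := by
    rw [Finset.length_sort]
    have h1 := A.card_le_univ
    rw [Fintype.card_fin] at h1
    exact (h1.trans hC.L_le).trans (hC.card_smallPool h)
  generalize A.sort (· ≤ ·) = l at *
  match l with
  | [] =>
    obtain ⟨i, hi⟩ := hA
    simpa using (hmem i).2 hi
  | i :: l =>
    obtain ⟨c', I, hI, hu, hn, hi, hl⟩ := exists_refill_cons_eq (C.likelihood h)
      (C.likelihood_pos h) δ hδ1 hδK i l hnd (C.smallPool h) hlen
      (Finset.card_le_card (C.smallPool_subset h)) c t ht hδ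
    have hsub := C.smallPool_subset h
    refine ⟨c', I, hI, hu, fun j hj => hn j (by rwa [hmem]), fun j hj => ?_,
      i, (hmem i).1 (by simp), hi, fun j hj hji => ?_⟩
    · rw [← hmem, List.mem_cons] at hj
      rcases hj with rfl | hj
      · rw [hi]; exact hsub ht
      · exact hsub (hl j hj).1
    · rw [← hmem, List.mem_cons] at hj
      exact (hl j (hj.resolve_left hji)).2

/-- The strategy `t` prescribes the first draw of each round as a function of the current list.
Following it yields a deterministic sequence `q` of lists; agreement with `q` up to round `N`
constrains only the seeds of the first `N` rounds, so finitely many intervals suffice. -/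
theorem Admissible.exists_box_rounds (hC : C.Admissible) (h : List (X × ℝ)) (c : Fin C.L → Θ)
    (p : Fin C.L → ℝ) (δ : ℝ) (hδ1 : δ ≤ 1) (hδK : δ * C.pool.card ≤ 1)
    (t : (Fin C.L → Θ) × (Fin C.L → ℝ) → Θ)
    (ht : ∀ q, t q ∈ C.smallPool h ∧
      δ * ∑ θ ∈ C.smallPool h, C.likelihood h θ ≤ C.likelihood h (t q)) :
    ∃ (q : ℕ → (Fin C.L → Θ) × (Fin C.L → ℝ)) (I : ℕ → Fin C.L → Set ℝ),
      q 0 = (c, p) ∧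
      (∀ r, (q (r + 1)).2 = C.probFromHist h (q (r + 1)).1 ∧
        IsRefill C.pool (C.removed (q r).2) (q r).1 (q (r + 1)).1 (t (q r))) ∧
      (∀ r i, MeasurableSet (I r i) ∧ ENNReal.ofReal δ ≤ unif (I r i)) ∧
      ∀ (N : ℕ) (u : ℕ → Fin C.L → ℝ), (∀ r < N, ∀ i, u r i ∈ I r i) →
        ∀ r ≤ N, C.rounds h u c p r = q r := by
  have key := fun q : (Fin C.L → Θ) × (Fin C.L → ℝ) =>
    hC.exists_box_round h q.1 (C.removed q.2) (hC.removed_nonempty q.2) (t q) (ht q).1 δ hδ1 hδK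
      (ht q).2
  choose g J hJ hg hs using key
  let q : ℕ → (Fin C.L → Θ) × (Fin C.L → ℝ) := fun r =>
    Nat.rec (c, p) (fun _ q => (g q, C.probFromHist h (g q))) r
  refine ⟨q, fun r => J (q r), rfl, fun r => ⟨rfl, hs (q r)⟩, fun r => hJ (q r), ?_⟩
  intro N u hu r
  induction r with
  | zero => intro _; rfl
  | succ r ih =>
    intro hr
    have e := ih (by omega)
    have e2 := hg (q r) (u r) (hu r (by omega))
    simp only [rounds, e, e2]
    rfl

section Count

open Classical in
/-- The number of slots of the list `c` that contain `M`. -/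
noncomputable def slotCount {L : ℕ} (M : Θ) (c : Fin L → Θ) : ℕ :=
  (Finset.univ.filter fun i => c i = M).card

theorem slotCount_le {L : ℕ} (M : Θ) (c : Fin L → Θ) : slotCount M c ≤ L := by
  classical
  have := Finset.card_le_univ (Finset.univ.filter fun i => c i = M)
  rw [Fintype.card_fin] at this
  unfold slotCount
  convert this

theorem slotCount_eq_iff {L : ℕ} (M : Θ) (c : Fin L → Θ) :
    slotCount M c = L ↔ ∀ i, c i = M := by
  classical
  unfold slotCount
  have := Finset.card_filter_eq_iff (s := Finset.univ) (p := fun i => c i = M)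
  rw [Finset.card_univ, Fintype.card_fin] at this
  simpa using this

theorem slotCount_pos_iff {L : ℕ} (M : Θ) (c : Fin L → Θ) :
    0 < slotCount M c ↔ ∃ i, c i = M := by
  classical
  unfold slotCount
  rw [Finset.card_pos]
  simp [Finset.Nonempty]

theorem IsRefill.slotCount_eq {B : Finset Θ} {A : Finset (Fin C.L)} {c c' : Fin C.L → Θ} {M : Θ}
    (hr : IsRefill B A c c' M) (hA : ∀ i, c i = M → i ∉ A) :
    slotCount M c' = slotCount M c + 1 := by
  classical
  obtain ⟨i, hi, hiM, huniq⟩ := hr.exists_unique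
  unfold slotCount
  have : (Finset.univ.filter fun j => c' j = M) =
      insert i (Finset.univ.filter fun j => c j = M) := by
    ext j
    simp only [Finset.mem_filter, Finset.mem_univ, true_and, Finset.mem_insert]
    by_cases hj : j ∈ A
    · constructor
      · intro h
        by_contra hn
        rw [not_or] at hn
        exact huniq j hj hn.1 h
      · rintro (rfl | h)
        · exact hiM
        · exact absurd hj (hA j h)
    · rw [hr.eq_of_notMem j hj]
      constructor
      · exact Or.inr
      · rintro (rfl | h)
        · exact absurd hi hj
        · exact h
  rw [this, Finset.card_insert_of_notMem]
  simp only [Finset.mem_filter, Finset.mem_univ, true_and]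
  exact fun h => hA i h hi

/-- Drawn without replacement, `M` fills only one of the refilled slots. -/
theorem IsRefill.slotCount_ne {B : Finset Θ} {A : Finset (Fin C.L)} {c c' : Fin C.L → Θ} {M : Θ}
    (hr : IsRefill B A c c' M) (hA : 2 ≤ A.card) : slotCount M c' ≠ C.L := by
  rw [Ne, slotCount_eq_iff]
  intro hall
  obtain ⟨i, hi, -, huniq⟩ := hr.exists_unique
  obtain ⟨j, hj, hji⟩ := Finset.exists_mem_ne (s := A) (by omega) i
  exact huniq j hj hji (hall j)

/-- The number of slots that contain `M`, or `0` if all slots contain `M`. -/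
noncomputable def level {L : ℕ} (M : Θ) (c : Fin L → Θ) : ℕ :=
  if slotCount M c = L then 0 else slotCount M c

/-- All candidates belong to `E`, and they are not all equal. -/
def IsMixed {L : ℕ} (E : Finset Θ) (c : Fin L → Θ) : Prop :=
  (∀ i, c i ∈ E) ∧ ∃ i j, c i ≠ c j

end Count

/-- `M` has the largest likelihood in the pool, `T` has the largest likelihood among the other
parameters, not much smaller than that of `M`, and all parameters outside of `E` have a low
likelihood. -/
structure Regime (C : Config X Θ) (h : List (X × ℝ)) (E : Finset Θ) (M T : Θ) (κ : ℝ) : Prop where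
  le_max : ∀ θ ∈ C.pool, C.likelihood h θ ≤ C.likelihood h M
  le_second : ∀ θ ∈ C.pool, θ ≠ M → C.likelihood h θ ≤ C.likelihood h T
  mul_le : κ * C.likelihood h M ≤ C.likelihood h T
  low : ∀ θ ∈ C.pool, θ ∉ E → C.likelihood h θ < C.ε * C.likelihood h M

section Rounds

variable {h : List (X × ℝ)} {E : Finset Θ} {M T : Θ} {κ : ℝ}

theorem Admissible.notMem_removed_of_eq_max (hC : C.Admissible) (hR : C.Regime h E M T κ)
    {c : Fin C.L → Θ} (hc : ∀ i, c i ∈ C.pool) (hex : ∃ i, C.probFromHist h c i ≤ C.ε)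
    (i : Fin C.L) (hi : c i = M) : i ∉ C.removed (C.probFromHist h c) := by
  rw [mem_removed_of_exists hex, not_le]
  exact hC.ε_lt_probFromHist h c i fun j => by rw [hi]; exact hR.le_max _ (hc j)

/-- Beside `M`, a candidate outside `E` has probability below `ε`. -/
theorem Admissible.mem_of_ε_lt (hC : C.Admissible) (hR : C.Regime h E M T κ)
    {c : Fin C.L → Θ} (hc : ∀ i, c i ∈ C.pool) (hM : ∃ j, c j = M) (i : Fin C.L)
    (hi : C.ε < C.probFromHist h c i) : c i ∈ E := by
  by_contra hn
  obtain ⟨j, hj⟩ := hM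
  exact absurd (hC.probFromHist_lt h c i j hC.ε_pos (by rw [hj]; exact hR.low _ (hc i) hn)) (not_lt.2 hi.le)

open Classical in
/-- The element drawn first in a round: `T` if `M` is already present and only one slot has to be
refilled, and `M` otherwise. -/
noncomputable def firstDraw (C : Config X Θ) (M T : Θ)
    (q : (Fin C.L → Θ) × (Fin C.L → ℝ)) : Θ :=
  if (∃ i, q.1 i = M) ∧ (C.removed q.2).card = 1 then T else M

/-- The strategy is to collect copies of `M` until a single slot remains to be refilled, and to put
`T` there. A list consisting of `M` only is not mixed and must be broken up again, which is why
`level` counts it as 0: with this convention every round from an unmixed list either produces a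
mixed one or raises the level. The weaker bound by `slotCount` is what the repeated rounds build on.
-/
theorem Admissible.first_round (hC : C.Admissible) (hR : C.Regime h E M T κ)
    {c c' : Fin C.L → Θ} (hc : ∀ i, c i ∈ C.pool) (hTM : (T ∈ E ∧ M ∈ E ∧ T ≠ M) ∨ ∀ i, c i ≠ M)
    (hmix : ¬ IsMixed E c)
    (hr : IsRefill C.pool (C.removed (C.probFromHist h c)) c c'
      (C.firstDraw M T (c, C.probFromHist h c))) :
    (∃ i, c' i = M) ∧ level M c ≤ slotCount M c' ∧
      (IsMixed E c' ∨ level M c + 1 ≤ level M c') := by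
  classical
  set A := C.removed (C.probFromHist h c) with hA
  have hcardpos : 0 < A.card := Finset.card_pos.2 (hC.removed_nonempty _)
  have h2 := hC.two_le
  by_cases hM : ∃ i, c i = M
  · obtain ⟨hTE, hME, hne⟩ := hTM.resolve_right (by push Not; exact hM)
    by_cases hall : slotCount M c = C.L
    · have hl : level M c = 0 := if_pos hall
      rw [slotCount_eq_iff] at hall
      obtain ⟨i₀, hi₀⟩ := hC.exists_notMem_removed h c
      have hi₀' : c' i₀ = M := by rw [hr.eq_of_notMem i₀ hi₀, hall]
      rw [hl]
      refine ⟨⟨i₀, hi₀'⟩, Nat.zero_le _, ?_⟩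
      -- All slots hold `M`. Refilling one slot with `T` gives a mixed list. Refilling at least two
      -- leaves a slot that is not `M` and keeps the surviving copy, so the level leaves 0.
      by_cases h1 : A.card = 1
      · left
        rw [firstDraw, if_pos ⟨hM, h1⟩] at hr
        obtain ⟨i, hi, hiT, -⟩ := hr.exists_unique
        obtain ⟨a, ha⟩ := Finset.card_eq_one.1 h1
        refine ⟨fun j => ?_, i, i₀, by rw [hiT, hi₀']; exact hne⟩
        by_cases hj : j ∈ A
        · rw [ha, Finset.mem_singleton] at hj hi
          rw [hj, ← hi, hiT]; exact hTE
        · rw [hr.eq_of_notMem j hj, hall]; exact hME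
      · right
        rw [firstDraw, if_neg (fun h => h1 h.2)] at hr
        rw [level, if_neg (hr.slotCount_ne (by omega))]
        have := (slotCount_pos_iff M c').2 ⟨i₀, hi₀'⟩
        omega
    · have hl : level M c = slotCount M c := if_neg hall
      -- Otherwise all candidates would lie in `E`, and since some but not all of them are `M`, the
      -- list would be mixed. Hence the removed slots are exactly those of probability at most `ε`,
      -- and no copy of `M` is among them.
      have hex : ∃ i, C.probFromHist h c i ≤ C.ε := by
        by_contra hn
        push Not at hn
        refine hmix ⟨fun i => hC.mem_of_ε_lt hR hc hM i (hn i), ?_⟩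
        rw [slotCount_eq_iff] at hall
        push Not at hall
        obtain ⟨i, hi⟩ := hall
        obtain ⟨j, hj⟩ := hM
        exact ⟨i, j, by rwa [hj]⟩
      have hkeep := hC.notMem_removed_of_eq_max hR hc hex
      obtain ⟨i₀, hi₀⟩ := id hM
      have hi₀' : c' i₀ = M := by rw [hr.eq_of_notMem i₀ (hkeep i₀ hi₀), hi₀]
      rw [hl]
      -- If one slot is removed, all the others exceed `ε` and lie in `E`, so inserting `T` makes
      -- the list mixed. If at least two are removed, `M` gains one slot without filling the list.
      by_cases h1 : A.card = 1
      · rw [firstDraw, if_pos ⟨hM, h1⟩] at hr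
        refine ⟨⟨i₀, hi₀'⟩, Finset.card_le_card fun j hj => ?_, Or.inl ?_⟩
        · rw [Finset.mem_filter] at hj ⊢
          exact ⟨hj.1, by rw [hr.eq_of_notMem j (hkeep j hj.2), hj.2]⟩
        · obtain ⟨i, hi, hiT, -⟩ := hr.exists_unique
          obtain ⟨a, ha⟩ := Finset.card_eq_one.1 h1
          refine ⟨fun j => ?_, i, i₀, by rw [hiT, hi₀']; exact hne⟩
          by_cases hj : j ∈ A
          · rw [ha, Finset.mem_singleton] at hj hi
            rw [hj, ← hi, hiT]; exact hTE
          · rw [hr.eq_of_notMem j hj]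
            rw [hA, mem_removed_of_exists hex, not_le] at hj
            exact hC.mem_of_ε_lt hR hc hM j hj
      · rw [firstDraw, if_neg (fun h => h1 h.2)] at hr
        have hcnt := hr.slotCount_eq hkeep
        rw [level, if_neg (hr.slotCount_ne (by omega))]
        exact ⟨⟨i₀, hi₀'⟩, by omega, Or.inr (by omega)⟩
  -- Here `M` is absent and is drawn into exactly one slot; this is not the whole list because `L ≥
  -- 2`.
  · have hc0 : slotCount M c = 0 := by
      by_contra hn
      exact hM ((slotCount_pos_iff M c).1 (by omega))
    rw [firstDraw, if_neg (fun h => hM h.1)] at hr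
    have hcnt := hr.slotCount_eq fun i hi => absurd ⟨i, hi⟩ hM
    have hl : level M c = 0 := by
      unfold level; split_ifs <;> omega
    rw [hl, level, if_neg (by omega)]
    exact ⟨(slotCount_pos_iff M c').1 (by omega), by omega, Or.inr (by omega)⟩

/-- A repeated round removes at least two slots, so the strategy draws `M`; the old copies stay,
since their probability exceeds `ε`. Each repetition thus adds one copy, which bounds the number of
rounds. -/
theorem Admissible.later_round (hC : C.Admissible) (hR : C.Regime h E M T κ)
    {c c' : Fin C.L → Θ} (hc : ∀ i, c i ∈ C.pool) (hlow : C.TooManyLow (C.probFromHist h c))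
    (hr : IsRefill C.pool (C.removed (C.probFromHist h c)) c c'
      (C.firstDraw M T (c, C.probFromHist h c))) :
    slotCount M c' = slotCount M c + 1 ∧ level M c' = slotCount M c + 1 := by
  obtain ⟨hex, hcard⟩ := hC.tooManyLow_imp hlow
  rw [firstDraw, if_neg (fun h => by have := h.2; simp only at this; omega)] at hr
  have hcnt := hr.slotCount_eq (hC.notMem_removed_of_eq_max hR hc hex)
  rw [level, if_neg (hr.slotCount_ne hcard)]
  exact ⟨hcnt, hcnt⟩

/-- With seeds from a suitable box, the resampling makes progress towards a mixed list. -/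
theorem Admissible.exists_box_resample (hC : C.Admissible) (hR : C.Regime h E M T κ)
    (hM : M ∈ C.pool) (hT : T ∈ C.pool) (hκ0 : 0 ≤ κ) (hκ1 : κ ≤ 1)
    {c : Fin C.L → Θ} (hc : ∀ i, c i ∈ C.pool) (hTM : (T ∈ E ∧ M ∈ E ∧ T ≠ M) ∨ ∀ i, c i ≠ M)
    (hmix : ¬ IsMixed E c) :
    ∃ I : ℕ → Fin C.L → Set ℝ,
      (∀ r i, MeasurableSet (I r i) ∧ ENNReal.ofReal (κ / C.pool.card) ≤ unif (I r i)) ∧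
      ∀ u : ℕ → Fin C.L → ℝ, (∀ r < C.L + 2, ∀ i, u r i ∈ I r i) →
        IsMixed E (C.resample h u c (C.probFromHist h c)).1 ∨
          level M c + 1 ≤ level M (C.resample h u c (C.probFromHist h c)).1 := by
  classical
  have hKpos : 0 < (C.pool.card : ℝ) := by exact_mod_cast Finset.card_pos.2 ⟨M, hM⟩
  have hK1 : (1 : ℝ) ≤ C.pool.card := by exact_mod_cast Finset.card_pos.2 ⟨M, hM⟩
  -- The total weight is at most `C.pool.card` times the largest likelihood, and both `M` and `T`
  -- have at least `κ` times the largest one. Each prescribed draw thus has probability at least `κ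
  -- / C.pool.card`.
  have hsum : κ / C.pool.card * ∑ θ ∈ C.smallPool h, C.likelihood h θ ≤
      κ * C.likelihood h M := by
    have h1 : ∑ θ ∈ C.smallPool h, C.likelihood h θ ≤ C.pool.card * C.likelihood h M :=
      calc ∑ θ ∈ C.smallPool h, C.likelihood h θ ≤ ∑ θ ∈ C.pool, C.likelihood h θ :=
            Finset.sum_le_sum_of_subset_of_nonneg (C.smallPool_subset h)
              fun _ _ _ => (C.likelihood_pos _ _).le
        _ ≤ C.pool.card * C.likelihood h M := by
            rw [← nsmul_eq_mul]; exact Finset.sum_le_card_nsmul _ _ _ hR.le_max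
    calc κ / C.pool.card * ∑ θ ∈ C.smallPool h, C.likelihood h θ
        ≤ κ / C.pool.card * (C.pool.card * C.likelihood h M) := by gcongr
      _ = κ * C.likelihood h M := by field_simp
  have ht : ∀ q, C.firstDraw M T q ∈ C.smallPool h ∧
      κ / C.pool.card * ∑ θ ∈ C.smallPool h, C.likelihood h θ ≤
        C.likelihood h (C.firstDraw M T q) := by
    intro q
    unfold firstDraw
    split_ifs
    · exact ⟨hC.mem_smallPool hT hR.le_second, hsum.trans hR.mul_le⟩
    · exact ⟨hC.mem_smallPool (M := M) hM fun θ hθ _ => hR.le_max θ hθ,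
        hsum.trans (mul_le_of_le_one_left (C.likelihood_pos _ _).le hκ1)⟩
  obtain ⟨q, I, hq0, hq, hI, hu⟩ := hC.exists_box_rounds h c (C.probFromHist h c)
    (κ / C.pool.card) ((div_le_one hKpos).2 (hκ1.trans hK1))
    (by rw [div_mul_cancel₀ _ hKpos.ne']; exact hκ1) (C.firstDraw M T) ht
  refine ⟨I, hI, fun u hbox => ?_⟩
  have hrounds := hu _ u hbox
  have hprob : ∀ r, (q r).2 = C.probFromHist h (q r).1 := by
    rintro (_ | r)
    · rw [hq0]
    · exact (hq r).1
  have hstep : ∀ r, IsRefill C.pool (C.removed (C.probFromHist h (q r).1)) (q r).1 (q (r + 1)).1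
      (C.firstDraw M T ((q r).1, C.probFromHist h (q r).1)) := fun r => by
    have := (hq r).2
    rw [← hprob]
    exact this
  have hpool : ∀ r i, (q r).1 i ∈ C.pool := by
    intro r
    induction r with
    | zero => rw [hq0]; exact hc
    | succ r ih =>
      intro i
      by_cases hi : i ∈ C.removed (C.probFromHist h (q r).1)
      · exact (hstep r).mem i hi
      · rw [(hstep r).eq_of_notMem i hi]; exact ih i
  have hfirst := hC.first_round hR (c := (q 0).1) (c' := (q 1).1) (by rw [hq0]; exact hc)
    (by rw [hq0]; exact hTM) (by rw [hq0]; exact hmix) (hstep 0)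
  rw [hq0] at hfirst
  have hlater : ∀ r, (∀ s, 1 ≤ s → s ≤ r → C.TooManyLow (q s).2) →
      level M c + r ≤ slotCount M (q (r + 1)).1 ∧
        (IsMixed E (q (r + 1)).1 ∨ level M c + 1 ≤ level M (q (r + 1)).1) := by
    intro r
    induction r with
    | zero => intro _; exact hfirst.2
    | succ r ih =>
      intro hs
      have h1 := (ih fun s hs1 hs2 => hs s hs1 (by omega)).1
      have h2 := hs (r + 1) (by omega) le_rfl
      rw [hprob] at h2
      obtain ⟨h3, h4⟩ := hC.later_round hR (hpool (r + 1)) h2 (hstep (r + 1))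
      exact ⟨by omega, Or.inr (by omega)⟩
  set S := {r | 1 ≤ r ∧ ¬ C.TooManyLow (C.rounds h u c (C.probFromHist h c) r).2} with hS
  -- If rounds 1 to `L + 1` all asked for repetition, `M` would occupy more than `L` slots after
  -- round `L + 2`. So the loop stops while the seeds are still controlled, and `sInf` is not taken
  -- over the empty set.
  obtain ⟨r₀, hr₀, hr₀'⟩ : ∃ r ∈ S, r ≤ C.L + 2 := by
    by_contra! hn
    have := (hlater (C.L + 1) fun s hs1 hs2 => by
      by_contra hlow
      refine absurd (hn s ⟨hs1, ?_⟩) (by omega)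
      rwa [hrounds s (by omega)]).1
    have := slotCount_le M (q (C.L + 1 + 1)).1
    omega
  have hmem : sInf S ∈ S := Nat.sInf_mem ⟨r₀, hr₀⟩
  have hle : sInf S ≤ C.L + 2 := (Nat.sInf_le hr₀).trans hr₀'
  have hres : C.resample h u c (C.probFromHist h c) = q (sInf S) := hrounds _ hle
  obtain ⟨r, hr⟩ : ∃ r, sInf S = r + 1 := ⟨sInf S - 1, by have := hmem.1; omega⟩
  rw [hres, hr]
  refine (hlater r fun s hs1 hs2 => ?_).2
  by_contra hlow
  refine Nat.notMem_of_lt_sInf (s := S) (m := s) (by omega) ⟨hs1, ?_⟩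
  rwa [hrounds s (by omega)]

/-- If only `M` is likely, then `M` is not lost in a round of resampling. -/
theorem Admissible.exists_eq_rounds (hC : C.Admissible) (hR : C.Regime h {M} M T κ)
    (u : ℕ → Fin C.L → ℝ) {c : Fin C.L → Θ} (hc : ∀ i, c i ∈ C.pool) (hM : ∃ i, c i = M)
    (r : ℕ) :
    let q := C.rounds h u c (C.probFromHist h c) r
    (∀ i, q.1 i ∈ C.pool) ∧ q.2 = C.probFromHist h q.1 ∧ ∃ i, q.1 i = M := by
  classical
  induction r with
  | zero => exact ⟨hc, rfl, hM⟩
  | succ r ih =>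
    obtain ⟨h1, h2, h3⟩ := ih
    set q := C.rounds h u c (C.probFromHist h c) r with hq
    refine ⟨fun i => refill_mem _ _ _ _ _ (C.smallPool_subset h) _ h1 i, rfl, ?_⟩
    simp only [rounds]
    rw [← hq, h2]
    -- If some probability is at most `ε`, the copies of `M` are kept. If none is, every candidate
    -- equals `M`, and any surviving slot will do.
    obtain ⟨i, hi, hiM⟩ : ∃ i, i ∉ C.removed (C.probFromHist h q.1) ∧ q.1 i = M := by
      by_cases hex : ∃ i, C.probFromHist h q.1 i ≤ C.ε
      · obtain ⟨i, hi⟩ := h3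
        exact ⟨i, hC.notMem_removed_of_eq_max hR h1 hex i hi, hi⟩
      · obtain ⟨i, hi⟩ := hC.exists_notMem_removed h q.1
        push Not at hex
        exact ⟨i, hi, Finset.mem_singleton.1 (hC.mem_of_ε_lt hR h1 h3 i (hex i))⟩
    refine ⟨i, ?_⟩
    rw [refill_of_notMem, hiM]
    rwa [Finset.mem_sort]

end Rounds

end Config

end KGDP

/-! ### The scores: zero without information, nonnegative for KGDP-f, positive for KGDP-H. -/

namespace KGDP

namespace Config

variable {X Θ : Type*} {C : Config X Θ}

section Posterior

variable {c : Fin C.L → Θ} {p : Fin C.L → ℝ} {x : X}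

theorem evidence_pos (hL : 0 < C.L) (hp : ∀ i, 0 < p i) (y : ℝ) :
    0 < ∑ l, C.gauss x y (c l) * p l :=
  Finset.sum_pos (fun l _ => mul_pos (C.gauss_pos _ _ _) (hp l)) ⟨⟨0, hL⟩, Finset.mem_univ _⟩

theorem posterior_pos (hL : 0 < C.L) (hp : ∀ i, 0 < p i) (y : ℝ) (i : Fin C.L) :
    0 < C.posterior c p x y i :=
  div_pos (mul_pos (C.gauss_pos _ _ _) (hp i)) (evidence_pos hL hp y)

theorem sum_posterior (hL : 0 < C.L) (hp : ∀ i, 0 < p i) (y : ℝ) :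
    ∑ i, C.posterior c p x y i = 1 := by
  unfold posterior
  rw [← Finset.sum_div, div_self (evidence_pos hL hp y).ne']

theorem posterior_le_one (hL : 0 < C.L) (hp : ∀ i, 0 < p i) (y : ℝ) (i : Fin C.L) :
    C.posterior c p x y i ≤ 1 := by
  rw [← sum_posterior (c := c) (x := x) hL hp y]
  exact Finset.single_le_sum (f := fun i => C.posterior c p x y i)
    (fun j _ => (posterior_pos hL hp y j).le) (Finset.mem_univ i)

theorem continuous_posterior (hL : 0 < C.L) (hp : ∀ i, 0 < p i) (i : Fin C.L) :
    Continuous fun y => C.posterior c p x y i := by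
  unfold posterior
  refine Continuous.div ?_ ?_ fun y => (evidence_pos hL hp y).ne'
  · unfold gauss; fun_prop
  · unfold gauss; fun_prop

theorem posterior_of_const (hp1 : ∑ i, p i = 1) (hx : ∀ i j, C.f x (c i) = C.f x (c j)) (y : ℝ) :
    C.posterior c p x y = p := by
  funext i
  have : ∀ l, C.gauss x y (c l) = C.gauss x y (c i) := fun l => by
    unfold gauss; rw [hx l i]
  unfold posterior
  simp_rw [this]
  rw [← Finset.mul_sum, hp1, mul_one, mul_div_cancel_left₀ _ (C.gauss_pos _ _ _).ne']

end Posterior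

instance (C : Config X Θ) : IsProbabilityMeasure C.noiseLaw := by
  unfold noiseLaw; infer_instance

theorem scoreF_of_const {c : Fin C.L → Θ} {p : Fin C.L → ℝ} {x : X} (hp1 : ∑ i, p i = 1)
    (hx : ∀ i j, C.f x (c i) = C.f x (c j)) : C.scoreF c p x = 0 := by
  unfold scoreF
  simp_rw [posterior_of_const hp1 hx]
  simp [← Finset.mul_sum, hp1]

theorem scoreH_of_const {c : Fin C.L → Θ} {p : Fin C.L → ℝ} {x : X} (hp1 : ∑ i, p i = 1)
    (hx : ∀ i j, C.f x (c i) = C.f x (c j)) : C.scoreH c p x = 0 := by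
  unfold scoreH
  simp_rw [posterior_of_const hp1 hx]
  simp [← Finset.mul_sum, hp1]

/-- The predictive distribution of the value measured at `x`. -/
noncomputable def predictive (C : Config X Θ) (c : Fin C.L → Θ) (p : Fin C.L → ℝ) (x : X) :
    Measure ℝ :=
  ∑ j, ENNReal.ofReal (p j) • C.noiseLaw.map (C.f x (c j) + ·)

section Predictive

variable {c : Fin C.L → Θ} {p : Fin C.L → ℝ} {x : X}

theorem isProbabilityMeasure_predictive (hp : ∀ i, 0 < p i) (hp1 : ∑ i, p i = 1) :
    IsProbabilityMeasure (C.predictive c p x) := by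
  constructor
  unfold predictive
  rw [Measure.finsetSum_apply]
  have : ∀ j, (C.noiseLaw.map (C.f x (c j) + ·)) Set.univ = 1 := fun j =>
    (Measure.isProbabilityMeasure_map (by fun_prop)).measure_univ
  simp only [Measure.smul_apply, this, smul_eq_mul, mul_one]
  rw [← ENNReal.ofReal_sum_of_nonneg fun j _ => (hp j).le, hp1, ENNReal.ofReal_one]

theorem integral_predictive (hp : ∀ i, 0 < p i) {g : ℝ → ℝ} (hg : Measurable g) {B : ℝ}
    (hB : ∀ y, |g y| ≤ B) :
    ∫ y, g y ∂C.predictive c p x = ∑ j, (∫ w, g (C.f x (c j) + w) ∂C.noiseLaw) * p j := by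
  unfold predictive
  rw [integral_finsetSum_measure]
  · refine Finset.sum_congr rfl fun j _ => ?_
    rw [integral_smul_measure, integral_map (by fun_prop) hg.aestronglyMeasurable,
      ENNReal.toReal_ofReal (hp j).le, smul_eq_mul, mul_comm]
  · intro j _
    refine Integrable.smul_measure ?_ ENNReal.ofReal_ne_top
    have : IsProbabilityMeasure (C.noiseLaw.map (C.f x (c j) + ·)) :=
      Measure.isProbabilityMeasure_map (by fun_prop)
    exact Integrable.of_bound hg.aestronglyMeasurable B (ae_of_all _ hB)

theorem integral_comp_add_noiseLaw (hσ : 0 < C.σ) (a : ℝ) (g : ℝ → ℝ) (hg : Measurable g) :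
    ∫ w, g (a + w) ∂C.noiseLaw =
      ∫ y, gaussianPDFReal a (Real.toNNReal (C.σ ^ 2)) y * g y := by
  have hv : Real.toNNReal (C.σ ^ 2) ≠ 0 := by
    rw [Ne, Real.toNNReal_eq_zero, not_le]; positivity
  have h := gaussianReal_map_const_add (μ := 0) (v := Real.toNNReal (C.σ ^ 2)) a
  rw [zero_add] at h
  unfold noiseLaw
  rw [← integral_map (φ := fun w => a + w) (f := g) (by fun_prop) hg.aestronglyMeasurable, h,
    integral_gaussianReal_eq_integral_smul hv]
  rfl

theorem gaussianPDFReal_eq (hσ : 0 < C.σ) (y : ℝ) (θ : Θ) :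
    gaussianPDFReal (C.f x θ) (Real.toNNReal (C.σ ^ 2)) y =
      (√(2 * Real.pi * C.σ ^ 2))⁻¹ * C.gauss x y θ := by
  unfold gaussianPDFReal gauss
  rw [Real.coe_toNNReal _ (by positivity)]

/-- The martingale property of Bayesian updating: the density of the predictive law is, up to the
Gaussian constant, the denominator in Bayes' rule. After it cancels, a Gaussian density of total
mass 1 remains. -/
theorem integral_posterior (hσ : 0 < C.σ) (hL : 0 < C.L) (hp : ∀ i, 0 < p i) (i : Fin C.L) :
    ∫ y, C.posterior c p x y i ∂C.predictive c p x = p i := by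
  have hm := (continuous_posterior (c := c) (x := x) hL hp i).measurable
  have hb : ∀ y, |C.posterior c p x y i| ≤ 1 := fun y => by
    rw [abs_of_pos (posterior_pos hL hp y i)]; exact posterior_le_one hL hp y i
  rw [integral_predictive hp hm hb]
  have h1 : ∀ j, (∫ w, C.posterior c p x (C.f x (c j) + w) i ∂C.noiseLaw) * p j =
      ∫ y, gaussianPDFReal (C.f x (c j)) (Real.toNNReal (C.σ ^ 2)) y *
        C.posterior c p x y i * p j := fun j => by
    rw [integral_comp_add_noiseLaw hσ _ (fun y => C.posterior c p x y i) hm, integral_mul_const]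
  simp_rw [h1]
  rw [← integral_finsetSum]
  · have h2 : ∀ y, ∑ j, gaussianPDFReal (C.f x (c j)) (Real.toNNReal (C.σ ^ 2)) y *
        C.posterior c p x y i * p j =
        gaussianPDFReal (C.f x (c i)) (Real.toNNReal (C.σ ^ 2)) y * p i := fun y => by
      have hD := (evidence_pos (c := c) (x := x) hL hp y).ne'
      simp_rw [gaussianPDFReal_eq hσ]
      calc ∑ j, (√(2 * Real.pi * C.σ ^ 2))⁻¹ * C.gauss x y (c j) * C.posterior c p x y i * p j
          = (√(2 * Real.pi * C.σ ^ 2))⁻¹ * C.posterior c p x y i *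
              ∑ j, C.gauss x y (c j) * p j := by
            rw [Finset.mul_sum]; exact Finset.sum_congr rfl fun j _ => by ring
        _ = _ := by
            unfold posterior
            rw [mul_assoc, div_mul_cancel₀ _ hD, ← mul_assoc]
    simp_rw [h2]
    have hv : Real.toNNReal (C.σ ^ 2) ≠ 0 := by
      rw [Ne, Real.toNNReal_eq_zero, not_le]; positivity
    rw [integral_mul_const, integral_gaussianPDFReal_eq_one _ hv, one_mul]
  · intro j _
    refine Integrable.mul_const ?_ _
    refine (integrable_gaussianPDFReal _ _).mul_bdd hm.aestronglyMeasurable (ae_of_all _ hb)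

theorem predictive_pos (hσ : 0 < C.σ) (hL : 0 < C.L) (hp : ∀ i, 0 < p i) {s : Set ℝ}
    (hs : IsOpen s) (hne : s.Nonempty) : 0 < C.predictive c p x s := by
  have hv : Real.toNNReal (C.σ ^ 2) ≠ 0 := by
    rw [Ne, Real.toNNReal_eq_zero, not_le]; positivity
  unfold predictive
  rw [Measure.finsetSum_apply, pos_iff_ne_zero, Ne, Finset.sum_eq_zero_iff]
  intro h
  have h0 := h ⟨0, hL⟩ (Finset.mem_univ _)
  have h := gaussianReal_map_const_add (μ := 0) (v := Real.toNNReal (C.σ ^ 2))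
    (C.f x (c ⟨0, hL⟩))
  unfold noiseLaw at h0
  rw [h, Measure.smul_apply, smul_eq_mul, mul_eq_zero, ENNReal.ofReal_eq_zero] at h0
  exact (hs.measure_pos volume hne).ne' (gaussianReal_absolutelyContinuous' _ hv
    (h0.resolve_left (not_le.2 (hp _))))

/-- Jensen's inequality for the maximum: the current estimate at each alternative is the mean of the
updated estimate there, which is bounded by the mean of the updated maximum. -/
theorem scoreF_nonneg [Fintype X] [Nonempty X] (hσ : 0 < C.σ) (hL : 0 < C.L)
    (hp : ∀ i, 0 < p i) (hp1 : ∑ i, p i = 1) : 0 ≤ C.scoreF c p x := by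
  have := isProbabilityMeasure_predictive (C := C) (c := c) (x := x) hp hp1
  have hq : ∀ i, Continuous fun y => C.posterior c p x y i := continuous_posterior hL hp
  have hqb : ∀ y i, |C.posterior c p x y i| ≤ 1 := fun y i => by
    rw [abs_of_pos (posterior_pos hL hp y i)]; exact posterior_le_one hL hp y i
  have hfc : ∀ x', Continuous fun y => C.fbar c (C.posterior c p x y) x' := fun x' => by
    unfold fbar; fun_prop
  have hfb : ∀ x' y, |C.fbar c (C.posterior c p x y) x'| ≤ ∑ x'', ∑ i, |C.f x'' (c i)| := by
    intro x' y
    calc |C.fbar c (C.posterior c p x y) x'| ≤ ∑ i, |C.f x' (c i) * C.posterior c p x y i| :=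
          Finset.abs_sum_le_sum_abs _ _
      _ ≤ ∑ i, |C.f x' (c i)| := Finset.sum_le_sum fun i _ => by
          rw [abs_mul]; exact mul_le_of_le_one_right (abs_nonneg _) (hqb y i)
      _ ≤ _ := Finset.single_le_sum (f := fun x'' => ∑ i, |C.f x'' (c i)|)
          (fun _ _ => Finset.sum_nonneg fun _ _ => abs_nonneg _) (Finset.mem_univ x')
  have hGm : Measurable fun y => ⨆ x', C.fbar c (C.posterior c p x y) x' :=
    Measurable.iSup fun x' => (hfc x').measurable
  have hGb : ∀ y, |⨆ x', C.fbar c (C.posterior c p x y) x'| ≤ ∑ x'', ∑ i, |C.f x'' (c i)| := by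
    intro y
    obtain ⟨x', hx'⟩ := exists_eq_ciSup_of_finite (f := fun x' => C.fbar c (C.posterior c p x y) x')
    rw [← hx']; exact hfb x' y
  unfold scoreF
  rw [← integral_predictive hp hGm hGb, sub_nonneg]
  refine ciSup_le fun x' => ?_
  have hint : ∀ i, Integrable (fun y => C.posterior c p x y i) (C.predictive c p x) := fun i =>
    Integrable.of_bound (hq i).measurable.aestronglyMeasurable 1 (ae_of_all _ fun y => hqb y i)
  calc C.fbar c p x' = ∫ y, C.fbar c (C.posterior c p x y) x' ∂C.predictive c p x := by
        unfold fbar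
        rw [integral_finsetSum _ fun i _ => (hint i).const_mul _]
        simp_rw [integral_const_mul, integral_posterior hσ hL hp]
    _ ≤ _ := by
        refine integral_mono ?_ ?_ fun y => ?_
        · exact Integrable.of_bound (hfc x').measurable.aestronglyMeasurable _
            (ae_of_all _ fun y => hfb x' y)
        · exact Integrable.of_bound hGm.aestronglyMeasurable _ (ae_of_all _ fun y => hGb y)
        · exact le_ciSup (f := fun x' => C.fbar c (C.posterior c p x y) x')
            (Set.finite_range _).bddAbove x'

/-- Strict convexity of t log t: its graph lies above the tangent at `r`. -/
theorem relEntropy_term_pos {q r : ℝ} (hq : 0 < q) (hr : 0 < r) (hne : q ≠ r) :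
    0 < q * Real.log q - r * Real.log r - (Real.log r + 1) * (q - r) := by
  have h1 : Real.log (r / q) < r / q - 1 :=
    Real.log_lt_sub_one_of_pos (div_pos hr hq) (by rw [Ne, div_eq_one_iff_eq hq.ne']; exact hne.symm)
  rw [Real.log_div hr.ne' hq.ne'] at h1
  have h2 := mul_lt_mul_of_pos_left h1 hq
  have h3 : q * (r / q - 1) = r - q := by field_simp
  nlinarith

/-- The score is the predictive mean of a continuous nonnegative function, the sum of the tangent
remainders of t log t. The predictive law charges every nonempty open set, so one observation at
which the posterior differs from the prior suffices. -/
theorem scoreH_pos (hσ : 0 < C.σ) (hL : 0 < C.L) (hp : ∀ i, 0 < p i) (hp1 : ∑ i, p i = 1)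
    {i₀ j₀ : Fin C.L} (hne : C.f x (c i₀) ≠ C.f x (c j₀)) : 0 < C.scoreH c p x := by
  have := isProbabilityMeasure_predictive (C := C) (c := c) (x := x) hp hp1
  have hq : ∀ i, Continuous fun y => C.posterior c p x y i := continuous_posterior hL hp
  have hq0 : ∀ y i, 0 < C.posterior c p x y i := posterior_pos hL hp
  have hqb : ∀ y i, |C.posterior c p x y i| ≤ 1 := fun y i => by
    rw [abs_of_pos (hq0 y i)]; exact posterior_le_one hL hp y i
  have hlc : ∀ i, Continuous fun y => C.posterior c p x y i * Real.log (C.posterior c p x y i) :=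
    fun i => Real.continuous_mul_log.comp (hq i)
  have hlb : ∀ y i, |C.posterior c p x y i * Real.log (C.posterior c p x y i)| ≤ 1 := fun y i => by
    rw [mul_comm]
    exact (Real.abs_log_mul_self_lt _ (hq0 y i) (posterior_le_one hL hp y i)).le
  have hint : ∀ i, Integrable (fun y => C.posterior c p x y i) (C.predictive c p x) := fun i =>
    Integrable.of_bound (hq i).measurable.aestronglyMeasurable 1 (ae_of_all _ fun y => hqb y i)
  have hlint : ∀ i, Integrable (fun y => C.posterior c p x y i *
      Real.log (C.posterior c p x y i)) (C.predictive c p x) := fun i =>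
    Integrable.of_bound (hlc i).measurable.aestronglyMeasurable 1 (ae_of_all _ fun y => hlb y i)
  -- The subtracted tangent term integrates to 0, because the posterior has mean `p i`.
  set ψ : Fin C.L → ℝ → ℝ := fun i y =>
    C.posterior c p x y i * Real.log (C.posterior c p x y i) - p i * Real.log (p i) -
      (Real.log (p i) + 1) * (C.posterior c p x y i - p i) with hψ
  have hψ0 : ∀ i y, 0 ≤ ψ i y := fun i y => by
    rcases eq_or_ne (C.posterior c p x y i) (p i) with h | h
    · simp [hψ, h]
    · exact (relEntropy_term_pos (hq0 y i) (hp i) h).le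
  have hψint : ∀ i, Integrable (ψ i) (C.predictive c p x) := fun i =>
    ((hlint i).sub (integrable_const _)).sub (((hint i).sub (integrable_const _)).const_mul _)
  have hscore : C.scoreH c p x = ∫ y, ∑ i, ψ i y ∂C.predictive c p x := by
    have hb : ∀ y, |∑ i, C.posterior c p x y i * Real.log (C.posterior c p x y i)| ≤ C.L := by
      intro y
      refine (Finset.abs_sum_le_sum_abs _ _).trans ?_
      refine (Finset.sum_le_sum fun i _ => hlb y i).trans ?_
      simp
    unfold scoreH
    rw [← integral_predictive (g := fun y => ∑ i, C.posterior c p x y i *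
      Real.log (C.posterior c p x y i)) hp (continuous_finsetSum _ fun i _ => hlc i).measurable hb,
      integral_finsetSum _ fun i _ => hlint i, integral_finsetSum _ fun i _ => hψint i,
      ← Finset.sum_sub_distrib]
    refine Finset.sum_congr rfl fun i _ => ?_
    have e1 : ∫ y, ψ i y ∂C.predictive c p x = _ :=
      integral_sub ((hlint i).sub (integrable_const (p i * Real.log (p i))))
        (((hint i).sub (integrable_const (p i))).const_mul (Real.log (p i) + 1))
    have e2 := integral_sub (hlint i) (integrable_const (p i * Real.log (p i)))
    have e3 := integral_sub (hint i) (integrable_const (p i))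
    have e4 : ∫ y, (Real.log (p i) + 1) * (C.posterior c p x y i - p i) ∂C.predictive c p x = _ :=
      integral_const_mul _ _
    rw [e1, e2, e4, e3, integral_posterior hσ hL hp]
    simp
  have hψc : Continuous fun y => ∑ i, ψ i y := by
    refine continuous_finsetSum _ fun i _ => ?_
    have := hlc i; have := hq i
    exact ((hlc i).sub continuous_const).sub (continuous_const.mul ((hq i).sub continuous_const))
  rw [hscore, integral_pos_iff_support_of_nonneg (fun y => Finset.sum_nonneg fun i _ => hψ0 i y)
    (integrable_finsetSum _ fun i _ => hψint i)]
  -- At this observation the likelihood of `c i₀` is 1 and that of `c j₀` is smaller; an unchanged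
  -- posterior would force all likelihoods to be equal.
  refine predictive_pos hσ hL hp hψc.isOpen_support ⟨C.f x (c i₀), ?_⟩
  rw [Function.mem_support]
  set y := C.f x (c i₀) with hy
  obtain ⟨i, hi⟩ : ∃ i, C.posterior c p x y i ≠ p i := by
    by_contra! hall
    have hg : ∀ i, C.gauss x y (c i) = ∑ l, C.gauss x y (c l) * p l := fun i => by
      have h := hall i
      unfold posterior at h
      rw [div_eq_iff (evidence_pos hL hp y).ne', mul_comm] at h
      exact mul_left_cancel₀ (hp i).ne' h
    have h := (hg i₀).trans (hg j₀).symm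
    unfold gauss at h
    rw [Real.exp_eq_exp, div_left_inj' (by positivity), neg_inj, hy, sub_self] at h
    have h0 := pow_eq_zero_iff (two_ne_zero) |>.1 (h.symm.trans (by norm_num))
    exact hne (sub_eq_zero.1 h0)
  refine (Finset.sum_pos' (fun i _ => hψ0 i y) ⟨i, Finset.mem_univ _, ?_⟩).ne'
  exact relEntropy_term_pos (hq0 y i) (hp i) hi

end Predictive

end Config

end KGDP

/-! ### Summable losses, substitution of coordinates, and a conditional Borel-Cantelli lemma. -/

namespace KGDP

open scoped ENNReal

section Telescoping

variable {Z : Type*} [MeasurableSpace Z] {μ : Measure Z}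

/-- Telescoping bounds the sum of all expected losses by the initial mean, so the series of the
terms on `N n` converges almost everywhere. It serves twice: for likelihood ratios and for
probabilities of repeated failure. -/
theorem ae_tendsto_indicator_of_supermartingale (Y : ℕ → Z → ℝ≥0∞) (N : ℕ → Set Z) (c : ℝ≥0∞)
    (hc : c ≠ 0) (hY : ∀ n, Measurable (Y n)) (hN : ∀ n, MeasurableSet (N n))
    (h0 : ∫⁻ z, Y 0 z ∂μ ≠ ∞)
    (hstep : ∀ n, ∫⁻ z, Y (n + 1) z ∂μ + c * ∫⁻ z, (N n).indicator (Y n) z ∂μ ≤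
      ∫⁻ z, Y n z ∂μ) :
    ∀ᵐ z ∂μ, Tendsto (fun n => (N n).indicator (Y n) z) atTop (𝓝 0) := by
  have hmeas : ∀ n, Measurable ((N n).indicator (Y n)) := fun n => (hY n).indicator (hN n)
  have hpart : ∀ n, ∫⁻ z, Y n z ∂μ + c * ∑ k ∈ Finset.range n,
      ∫⁻ z, (N k).indicator (Y k) z ∂μ ≤ ∫⁻ z, Y 0 z ∂μ := by
    intro n
    induction n with
    | zero => simp
    | succ n ih =>
      rw [Finset.sum_range_succ, mul_add, add_comm (c * _) (c * _), ← add_assoc]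
      exact (add_le_add_left (hstep n) _).trans ih
  have hsum : c * ∫⁻ z, ∑' n, (N n).indicator (Y n) z ∂μ ≤ ∫⁻ z, Y 0 z ∂μ := by
    rw [lintegral_tsum fun n => (hmeas n).aemeasurable, ENNReal.tsum_eq_iSup_nat,
      ENNReal.mul_iSup]
    exact iSup_le fun n => le_add_self.trans (hpart n)
  have hfin : ∫⁻ z, ∑' n, (N n).indicator (Y n) z ∂μ ≠ ∞ := by
    intro h
    rw [h, ENNReal.mul_top hc] at hsum
    exact h0 (top_le_iff.1 hsum)
  filter_upwards [ae_lt_top (Measurable.tsum hmeas) hfin] with z hz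
  exact ENNReal.tendsto_atTop_zero_of_tsum_ne_top hz.ne

end Telescoping

section Subst

variable {ι : Type*}

open Classical in
/-- Replace the coordinates of `z` in the block `B` by those of `z'`. -/
noncomputable def subst (B : Set ι) (z z' : ι → ℝ) : ι → ℝ :=
  fun i => if i ∈ B then z' i else z i

theorem subst_of_mem {B : Set ι} {i : ι} (hi : i ∈ B) (z z' : ι → ℝ) : subst B z z' i = z' i :=
  if_pos hi

theorem subst_of_notMem {B : Set ι} {i : ι} (hi : i ∉ B) (z z' : ι → ℝ) : subst B z z' i = z i :=
  if_neg hi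

theorem measurable_subst (B : Set ι) :
    Measurable fun p : (ι → ℝ) × (ι → ℝ) => subst B p.1 p.2 := by
  refine measurable_pi_lambda _ fun i => ?_
  unfold subst
  by_cases hi : i ∈ B
  · simp only [hi, if_true]; fun_prop
  · simp only [hi, if_false]; fun_prop

variable (ν : ι → Measure ℝ) [∀ i, IsProbabilityMeasure (ν i)]

/-- On a finite rectangle the preimage splits into a rectangle for the coordinates outside `B` and
one for those inside. Integrating over the substituted copy thus plays the role of conditioning on
the coordinates outside `B`. -/
theorem map_subst (B : Set ι) :
    ((Measure.infinitePi ν).prod (Measure.infinitePi ν)).map (fun p => subst B p.1 p.2) =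
      Measure.infinitePi ν := by
  classical
  refine Measure.eq_infinitePi ν fun s t ht => ?_
  rw [Measure.map_apply (measurable_subst B) (MeasurableSet.pi s.countable_toSet fun i _ => ht i)]
  have hpre : (fun p : (ι → ℝ) × (ι → ℝ) => subst B p.1 p.2) ⁻¹' (Set.pi s t) =
      (Set.pi (s.filter (· ∉ B) : Finset ι) t) ×ˢ (Set.pi (s.filter (· ∈ B) : Finset ι) t) := by
    ext p
    simp only [Set.mem_preimage, Set.mem_pi, Set.mem_prod, Finset.coe_filter, Set.mem_ofPred_eq,
      Finset.mem_coe]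
    constructor
    · intro h
      exact ⟨fun i hi => by simpa [subst_of_notMem hi.2] using h i hi.1,
        fun i hi => by simpa [subst_of_mem hi.2] using h i hi.1⟩
    · rintro ⟨h1, h2⟩ i hi
      by_cases hB : i ∈ B
      · simpa [subst_of_mem hB] using h2 i ⟨hi, hB⟩
      · simpa [subst_of_notMem hB] using h1 i ⟨hi, hB⟩
  rw [hpre, Measure.prod_prod, Measure.infinitePi_pi _ fun i _ => ht i,
    Measure.infinitePi_pi _ fun i _ => ht i, mul_comm,
    Finset.prod_filter_mul_prod_filter_not]

theorem lintegral_subst (B : Set ι) {g : (ι → ℝ) → ℝ≥0∞} (hg : Measurable g) :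
    ∫⁻ z, g z ∂Measure.infinitePi ν =
      ∫⁻ z, ∫⁻ z', g (subst B z z') ∂Measure.infinitePi ν ∂Measure.infinitePi ν := by
  conv_lhs => rw [← map_subst ν B]
  rw [lintegral_map hg (measurable_subst B)]
  exact lintegral_prod _ (hg.comp (measurable_subst B)).aemeasurable

/-- A conditional version of the second Borel-Cantelli lemma: if, given `D n`, the event `G n` has
at least the probability `δ` with respect to the block `B n` of coordinates, on which the previous
events do not depend, then `G n` happens infinitely often whenever `D n` does. -/
theorem ae_frequently_of_subst (B : ℕ → Set ι) (D G : ℕ → Set (ι → ℝ)) (δ : ℝ≥0∞) (hδ : δ ≠ 0)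
    (hD : ∀ n, MeasurableSet (D n)) (hG : ∀ n, MeasurableSet (G n))
    (hDi : ∀ n, ∀ k ≤ n, ∀ z z', subst (B n) z z' ∈ D k ↔ z ∈ D k)
    (hGi : ∀ n, ∀ k < n, ∀ z z', subst (B n) z z' ∈ G k ↔ z ∈ G k)
    (hDG : ∀ n, ∀ z ∈ D n, δ ≤ Measure.infinitePi ν {z' | subst (B n) z z' ∈ G n}) :
    ∀ᵐ z ∂Measure.infinitePi ν, (∃ᶠ n in atTop, z ∈ D n) → ∃ᶠ n in atTop, z ∈ D n ∩ G n := by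
  set μ := Measure.infinitePi ν with hμ
  -- No success has occurred between the times `m` and `n`. Neither this event nor `D n` depends on
  -- the block `B n`.
  let Q : ℕ → ℕ → Set (ι → ℝ) := fun m n => {z | ∀ k, m ≤ k → k < n → ¬ (z ∈ D k ∧ z ∈ G k)}
  have hQm : ∀ m n, MeasurableSet (Q m n) := by
    intro m n
    have : Q m n = ⋂ k, ⋂ (_ : m ≤ k), ⋂ (_ : k < n), (D k ∩ G k)ᶜ := by
      ext z; simp [Q]
    rw [this]
    exact MeasurableSet.iInter fun k => MeasurableSet.iInter fun _ => MeasurableSet.iInter fun _ =>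
      ((hD k).inter (hG k)).compl
  have hQi : ∀ m n z z', subst (B n) z z' ∈ Q m n ↔ z ∈ Q m n := by
    intro m n z z'
    refine forall_congr' fun k => forall_congr' fun _ => forall_congr' fun hk => ?_
    rw [hDi n k hk.le, hGi n k hk]
  have hstep : ∀ m n, δ * μ (Q m n ∩ D n) ≤ μ (Q m n ∩ D n ∩ G n) := by
    intro m n
    have hm : MeasurableSet (Q m n ∩ D n ∩ G n) := ((hQm m n).inter (hD n)).inter (hG n)
    rw [← lintegral_indicator_one hm, ← lintegral_indicator_one ((hQm m n).inter (hD n)),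
      lintegral_subst ν (B n) (measurable_one.indicator hm),
      ← lintegral_const_mul _ (measurable_one.indicator ((hQm m n).inter (hD n)))]
    refine lintegral_mono fun z => ?_
    by_cases hz : z ∈ Q m n ∩ D n
    · rw [Set.indicator_of_mem hz, Pi.one_apply, mul_one]
      refine (hDG n z hz.2).trans ?_
      have hm' : Measurable fun z' => subst (B n) z z' :=
        (measurable_subst (B n)).comp measurable_prodMk_left
      change μ ((fun z' => subst (B n) z z') ⁻¹' G n) ≤ _
      rw [← lintegral_indicator_one (hm' (hG n))]
      refine lintegral_mono fun z' => ?_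
      by_cases hz' : subst (B n) z z' ∈ G n
      · have h1 : subst (B n) z z' ∈ Q m n ∩ D n ∩ G n :=
          ⟨⟨(hQi m n z z').2 hz.1, (hDi n n le_rfl z z').2 hz.2⟩, hz'⟩
        rw [Set.indicator_of_mem h1]
        exact Set.indicator_le_self _ _ _
      · rw [Set.indicator_of_notMem (by exact hz')]
        exact bot_le
    · rw [Set.indicator_of_notMem hz, mul_zero]
      exact bot_le
  have key : ∀ m, ∀ᵐ z ∂μ, Tendsto (fun n => (D (m + n)).indicator
      ((Q m (m + n)).indicator (1 : (ι → ℝ) → ℝ≥0∞)) z) atTop (𝓝 0) := by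
    intro m
    -- The indicator of `Q m (m + n)` loses at least the fraction `δ` of its mass on `D (m + n)`.
    -- The limit 0 of the restricted indicators excludes infinitely many occasions without a success
    -- after `m`.
    refine ae_tendsto_indicator_of_supermartingale _ _ δ hδ
      (fun n => measurable_one.indicator (hQm m _)) (fun n => hD _) ?_ fun n => ?_
    · rw [lintegral_indicator_one (hQm m _)]; exact measure_ne_top _ _
    · rw [Set.indicator_indicator, Set.inter_comm, lintegral_indicator_one (hQm m _),
        lintegral_indicator_one (hQm m _), lintegral_indicator_one ((hQm m _).inter (hD _))]
      refine (add_le_add_right (hstep m (m + n)) _).trans ?_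
      rw [← measure_union _ (((hQm m _).inter (hD _)).inter (hG _))]
      · refine measure_mono ?_
        rintro z (hz | hz)
        · exact fun k h1 h2 => hz k h1 (by omega)
        · exact hz.1.1
      · rw [Set.disjoint_left]
        intro z hz hz'
        exact hz (m + n) (by omega) (by omega) ⟨hz'.1.2, hz'.2⟩
  filter_upwards [ae_all_iff.2 key] with z hz hfreq
  by_contra hn
  rw [not_frequently, eventually_atTop] at hn
  obtain ⟨m, hm⟩ := hn
  have hev := (hz m).eventually_lt_const (show (0 : ℝ≥0∞) < 1 by norm_num)
  rw [eventually_atTop] at hev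
  obtain ⟨n₀, hn₀⟩ := hev
  obtain ⟨n, hn, hzD⟩ := (frequently_atTop.1 hfreq) (m + n₀)
  obtain ⟨j, rfl⟩ : ∃ j, n = m + j := ⟨n - m, by omega⟩
  have h1 := hn₀ j (by omega)
  rw [Set.indicator_of_mem hzD, Set.indicator_of_mem] at h1
  · exact lt_irrefl _ h1
  · exact fun k h1 _ => hm k h1

theorem le_infinitePi_box (s : Finset ι) (t : ι → Set ℝ) (ht : ∀ i ∈ s, MeasurableSet (t i))
    (δ : ℝ≥0∞) (hδ : ∀ i ∈ s, δ ≤ ν i (t i)) :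
    δ ^ s.card ≤ Measure.infinitePi ν {z | ∀ i ∈ s, z i ∈ t i} := by
  have : {z : ι → ℝ | ∀ i ∈ s, z i ∈ t i} = Set.pi s t := rfl
  rw [this, Measure.infinitePi_pi ν ht]
  exact Finset.pow_card_le_prod _ _ _ hδ

end Subst

section Product

variable {ι κ Ω Ω' : Type*} [MeasurableSpace Ω] [MeasurableSpace Ω'] {P : Measure Ω}
  {P' : Measure Ω'} [IsProbabilityMeasure P']

/-- Two independent families, considered jointly on a product space. -/
theorem map_sumElim_prod (ν : ι ⊕ κ → Measure ℝ) [∀ i, IsProbabilityMeasure (ν i)]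
    (V : ι → Ω → ℝ) (hVm : ∀ i, Measurable (V i)) (hVi : iIndepFun V P)
    (hV : ∀ i, P.map (V i) = ν (Sum.inl i))
    (V' : κ → Ω' → ℝ) (hVm' : ∀ i, Measurable (V' i)) (hVi' : iIndepFun V' P')
    (hV' : ∀ i, P'.map (V' i) = ν (Sum.inr i)) :
    (P.prod P').map (fun ω => Sum.elim (fun i => V i ω.1) (fun i => V' i ω.2)) =
      Measure.infinitePi ν := by
  classical
  refine Measure.eq_infinitePi ν fun s t ht => ?_
  have hm : Measurable fun ω : Ω × Ω' =>
      (Sum.elim (fun i => V i ω.1) (fun i => V' i ω.2) : ι ⊕ κ → ℝ) := by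
    refine measurable_pi_lambda _ fun i => ?_
    rcases i with i | i
    · exact (hVm i).comp measurable_fst
    · exact (hVm' i).comp measurable_snd
  rw [Measure.map_apply hm (MeasurableSet.pi s.countable_toSet fun i _ => ht i)]
  have hpre : (fun ω : Ω × Ω' =>
      (Sum.elim (fun i => V i ω.1) (fun i => V' i ω.2) : ι ⊕ κ → ℝ)) ⁻¹' (Set.pi s t) =
      (⋂ i ∈ s.toLeft, V i ⁻¹' t (Sum.inl i)) ×ˢ (⋂ i ∈ s.toRight, V' i ⁻¹' t (Sum.inr i)) := by
    ext ω
    simp [Set.mem_pi]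
  rw [hpre, Measure.prod_prod, hVi.measure_inter_preimage_eq_mul _ fun i _ => ht _,
    hVi'.measure_inter_preimage_eq_mul _ fun i _ => ht _]
  have e1 : ∀ i, P (V i ⁻¹' t (Sum.inl i)) = ν (Sum.inl i) (t (Sum.inl i)) := fun i => by
    rw [← hV, Measure.map_apply (hVm i) (ht _)]
  have e2 : ∀ i, P' (V' i ⁻¹' t (Sum.inr i)) = ν (Sum.inr i) (t (Sum.inr i)) := fun i => by
    rw [← hV', Measure.map_apply (hVm' i) (ht _)]
  simp_rw [e1, e2]
  rw [← Finset.prod_disjSum (f := fun i => ν i (t i)), Finset.toLeft_disjSum_toRight]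

end Product

end KGDP

/-! ### Measurability of all components of the algorithm. -/

namespace KGDP

section Disc

variable {Z α β : Type*} [MeasurableSpace Z]

/-- A discrete random element: countably many values and measurable fibers. -/
structure Disc (g : Z → α) : Prop where
  countable_range : (Set.range g).Countable
  measurableSet_fiber : ∀ v, MeasurableSet {z | g z = v}

/-- Split according to the countably many values of `g`, which may then be frozen. Parameters,
alternatives and lists carry no σ-algebra, so this replaces composition of measurable maps
throughout. -/
theorem Disc.measurableSet_bind {g : Z → α} (hg : Disc g) {p : α → Z → Prop}
    (hp : ∀ v, MeasurableSet {z | p v z}) : MeasurableSet {z | p (g z) z} := by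
  have : {z | p (g z) z} = ⋃ v ∈ Set.range g, {z | g z = v} ∩ {z | p v z} := by
    ext z
    simp only [Set.mem_iUnion, Set.mem_inter_iff, Set.mem_ofPred_eq]
    exact ⟨fun h => ⟨g z, ⟨z, rfl⟩, rfl, h⟩, by rintro ⟨v, -, rfl, h⟩; exact h⟩
  rw [this]
  exact MeasurableSet.biUnion hg.countable_range fun v _ =>
    (hg.measurableSet_fiber v).inter (hp v)

theorem Disc.measurable_bind [MeasurableSpace β] {g : Z → α} (hg : Disc g) {F : α → Z → β}
    (hF : ∀ v, Measurable (F v)) : Measurable fun z => F (g z) z := fun s hs =>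
  hg.measurableSet_bind (p := fun v z => F v z ∈ s) fun v => hF v hs

theorem Disc.bind {g : Z → α} (hg : Disc g) {F : α → Z → β} (hF : ∀ v, Disc (F v)) :
    Disc fun z => F (g z) z := by
  refine ⟨?_, fun b => hg.measurableSet_bind (p := fun v z => F v z = b)
    fun v => (hF v).measurableSet_fiber b⟩
  refine (hg.countable_range.biUnion fun v _ => (hF v).countable_range).mono ?_
  rintro _ ⟨z, rfl⟩
  simp only [Set.mem_iUnion]
  exact ⟨g z, ⟨z, rfl⟩, z, rfl⟩

theorem Disc.const (a : α) : Disc fun _ : Z => a := by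
  refine ⟨(Set.countable_singleton a).mono ?_, fun v => MeasurableSet.const _⟩
  rintro _ ⟨z, rfl⟩
  rfl

theorem Disc.comp {g : Z → α} (hg : Disc g) (φ : α → β) : Disc fun z => φ (g z) :=
  hg.bind (F := fun v _ => φ v) fun v => Disc.const (φ v)

theorem Disc.measurableSet {g : Z → α} (hg : Disc g) (p : α → Prop) :
    MeasurableSet {z | p (g z)} :=
  hg.measurableSet_bind (p := fun v _ => p v) fun _ => MeasurableSet.const _

theorem Disc.of_countable [Countable α] {g : Z → α} (hg : ∀ v, MeasurableSet {z | g z = v}) :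
    Disc g :=
  ⟨Set.to_countable _, hg⟩

theorem Disc.of_measurableSet {p : Z → Prop} (hp : MeasurableSet {z | p z}) : Disc p := by
  refine Disc.of_countable fun v => ?_
  by_cases hv : v
  · simpa [hv] using hp
  · simp only [hv, eq_iff_iff, iff_false]; exact hp.compl

theorem Disc.ite {p : Z → Prop} [∀ z, Decidable (p z)] (hp : MeasurableSet {z | p z})
    {f g : Z → α} (hf : Disc f) (hg : Disc g) : Disc fun z => if p z then f z else g z := by
  classical
  have := (Disc.of_measurableSet hp).bind (F := fun q z => if q then f z else g z) fun q => by
    by_cases hq : q <;> simpa [hq]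
  convert this

theorem Disc.filter (A : Finset α) {p : α → Z → Prop} [∀ z, DecidablePred fun a => p a z]
    (hp : ∀ a, MeasurableSet {z | p a z}) : Disc fun z => A.filter fun a => p a z := by
  classical
  refine ⟨(A.powerset.countable_toSet).mono ?_, fun B => ?_⟩
  · rintro _ ⟨z, rfl⟩
    exact Finset.mem_coe.2 (Finset.mem_powerset.2 (Finset.filter_subset _ _))
  · have : {z | (A.filter fun a => p a z) = B} =
        {z | ∀ a ∈ A, (p a z ↔ a ∈ B)} ∩ {_z | B ⊆ A} := by
      ext z
      simp only [Set.mem_inter_iff, Finset.ext_iff, Finset.mem_filter]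
      constructor
      · intro h
        exact ⟨fun a ha => by have := h a; tauto, fun a ha => ((h a).2 ha).1⟩
      · rintro ⟨h1, h2⟩ a
        constructor
        · rintro ⟨ha, hpa⟩; exact (h1 a ha).1 hpa
        · intro ha; exact ⟨h2 ha, (h1 a (h2 ha)).2 ha⟩
    rw [this]
    refine MeasurableSet.inter ?_ (MeasurableSet.const _)
    have h2 : {z | ∀ a ∈ A, (p a z ↔ a ∈ B)} = ⋂ a ∈ A, {z | p a z ↔ a ∈ B} := by
      ext z; simp
    rw [h2]
    refine A.measurableSet_biInter fun a _ => ?_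
    by_cases ha : a ∈ B
    · simpa [ha] using hp a
    · simp only [ha, iff_false]; exact (hp a).compl

theorem Disc.natSInf {S : Z → Set ℕ} (hS : ∀ r, MeasurableSet {z | r ∈ S z}) :
    Disc fun z => sInf (S z) := by
  refine Disc.of_countable fun k => ?_
  -- The second part accounts for the convention that the infimum of the empty set of natural
  -- numbers is 0.
  have : {z | sInf (S z) = k} = ({z | k ∈ S z} ∩ {z | ∀ j, j < k → j ∉ S z}) ∪
      ({z | ∀ j, j ∉ S z} ∩ {_z | k = 0}) := by
    ext z
    constructor
    · rintro rfl
      by_cases hne : (S z).Nonempty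
      · exact Or.inl ⟨Nat.sInf_mem hne, fun j hj => Nat.notMem_of_lt_sInf hj⟩
      · rw [Set.not_nonempty_iff_eq_empty] at hne
        exact Or.inr ⟨fun j => by simp [hne], by simp [hne]⟩
    · rintro (⟨h1, h2⟩ | ⟨h1, rfl⟩)
      · refine le_antisymm (Nat.sInf_le h1) ?_
        by_contra hlt
        exact h2 _ (not_le.1 hlt) (Nat.sInf_mem ⟨k, h1⟩)
      · have : S z = ∅ := Set.eq_empty_of_forall_notMem h1
        simp [this]
  rw [this]
  refine MeasurableSet.union (MeasurableSet.inter (hS k) ?_)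
    (MeasurableSet.inter ?_ (MeasurableSet.const _))
  · simp only [Set.ofPred_forall]
    exact MeasurableSet.iInter fun j => MeasurableSet.iInter fun _ => (hS j).compl
  · simp only [Set.ofPred_forall]
    exact MeasurableSet.iInter fun j => (hS j).compl

theorem Disc.rouletteList {w : α → Z → ℝ} (hw : ∀ a, Measurable (w a)) (d : α) (l : List α)
    {t : Z → ℝ} (ht : Measurable t) : Disc fun z => rouletteList (fun a => w a z) d l (t z) := by
  induction l generalizing t with
  | nil => exact Disc.const d
  | cons a l ih =>
    simp only [KGDP.rouletteList]
    exact Disc.ite (measurableSet_le ht (hw a)) (Disc.const a) (ih (ht.sub (hw a)))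

theorem Disc.roulette {w : α → Z → ℝ} (hw : ∀ a, Measurable (w a)) (d : α) (A : Finset α)
    {u : Z → ℝ} (hu : Measurable u) : Disc fun z => roulette (fun a => w a z) d A (u z) :=
  Disc.rouletteList hw d _ (hu.mul (Finset.measurable_fun_sum _ fun a _ => hw a))

theorem Disc.refill {L : ℕ} {w : α → Z → ℝ} (hw : ∀ a, Measurable (w a)) {u : Z → Fin L → ℝ}
    (hu : ∀ i, Measurable fun z => u z i) (l : List (Fin L)) (A : Finset α) (c : Fin L → α) :
    Disc fun z => refill (fun a => w a z) (u z) l A c := by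
  classical
  induction l generalizing A c with
  | nil => exact Disc.const c
  | cons i l ih =>
    have := (Disc.roulette hw (c i) A (hu i)).bind
      (F := fun v z => KGDP.refill (fun a => w a z) (u z) l (A.erase v) (Function.update c i v))
      fun v => ih _ _
    simp only [KGDP.refill]
    convert this

end Disc

namespace Config

variable {X Θ Z : Type*} [MeasurableSpace Z] {C : Config X Θ}

/-- A random history of fixed length with measurable likelihoods and squared errors. -/
structure MeasHist (C : Config X Θ) (h : Z → List (X × ℝ)) : Prop where
  length_eq : ∃ n, ∀ z, (h z).length = n
  likelihood : ∀ θ, Measurable fun z => C.likelihood (h z) θ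
  sum : ∀ θ, Measurable fun z => ((h z).map fun w => (w.2 - C.f w.1 θ) ^ 2).sum

theorem MeasHist.mse {h : Z → List (X × ℝ)} (hh : C.MeasHist h) (θ : Θ) :
    Measurable fun z => C.mse (h z) θ := by
  obtain ⟨n, hn⟩ := hh.length_eq
  unfold Config.mse
  simp_rw [hn]
  exact (hh.sum θ).const_mul _

theorem MeasHist.cons {h : Z → List (X × ℝ)} (hh : C.MeasHist h) {x : Z → X} (hx : Disc x)
    {y : Z → ℝ} (hy : Measurable y) : C.MeasHist fun z => (x z, y z) :: h z := by
  obtain ⟨n, hn⟩ := hh.length_eq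
  refine ⟨⟨n + 1, fun z => by simp [hn]⟩, fun θ => ?_, fun θ => ?_⟩
  · simp_rw [likelihood_cons]
    refine Measurable.mul ?_ (hh.likelihood θ)
    refine hx.measurable_bind (F := fun v z => C.gauss v (y z) θ) fun v => ?_
    unfold gauss; fun_prop
  · simp_rw [List.map_cons, List.sum_cons]
    refine Measurable.add ?_ (hh.sum θ)
    exact hx.measurable_bind (F := fun v z => (y z - C.f v θ) ^ 2) fun v => by fun_prop

theorem disc_smallPool {h : Z → List (X × ℝ)} (hh : C.MeasHist h) :
    Disc fun z => C.smallPool (h z) := by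
  classical
  unfold smallPool
  refine Disc.filter _ fun θ => ?_
  have := (Disc.filter C.pool (p := fun θ' z => C.mse (h z) θ' < C.mse (h z) θ)
    fun θ' => measurableSet_lt (hh.mse θ') (hh.mse θ)).measurableSet fun A => A.card < C.R
  convert this

theorem disc_removed {p : Z → Fin C.L → ℝ} (hp : ∀ i, Measurable fun z => p z i) :
    Disc fun z => C.removed (p z) := by
  classical
  have h1 : ∀ i, MeasurableSet {z | p z i ≤ C.ε} := fun i =>
    measurableSet_le (hp i) measurable_const
  unfold removed
  refine Disc.ite ?_ ?_ ?_
  · simp only [Set.ofPred_exists]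
    exact MeasurableSet.iUnion h1
  · have := Disc.filter Finset.univ (p := fun i z => p z i ≤ C.ε) h1
    convert this
  · have := Disc.filter Finset.univ (p := fun i z => (Finset.univ.filter fun j => p z j < p z i ∨
        (p z j = p z i ∧ j < i)).card < C.drop) fun i =>
      (Disc.filter Finset.univ (p := fun j z => p z j < p z i ∨ (p z j = p z i ∧ j < i))
        fun j => (measurableSet_lt (hp j) (hp i)).union
          ((measurableSet_eq_fun (hp j) (hp i)).inter (MeasurableSet.const _))).measurableSet
            fun A => A.card < C.drop
    convert this

theorem measurableSet_tooManyLow {p : Z → Fin C.L → ℝ} (hp : ∀ i, Measurable fun z => p z i) :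
    MeasurableSet {z | C.TooManyLow (p z)} := by
  classical
  have := (Disc.filter Finset.univ (p := fun i z => p z i < C.ε)
    fun i => measurableSet_lt (hp i) measurable_const).measurableSet fun A => C.L < 2 * A.card
  unfold TooManyLow
  convert this

theorem measurable_probFromHist {h : Z → List (X × ℝ)} (hh : C.MeasHist h)
    {c : Z → Fin C.L → Θ} (hc : Disc c) (i : Fin C.L) :
    Measurable fun z => C.probFromHist (h z) (c z) i := by
  refine hc.measurable_bind (F := fun v z => C.probFromHist (h z) v i) fun v => ?_
  unfold probFromHist
  exact (hh.likelihood _).div (Finset.measurable_fun_sum _ fun l _ => hh.likelihood _)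

theorem measurable_posterior {c : Z → Fin C.L → Θ} (hc : Disc c) {p : Z → Fin C.L → ℝ}
    (hp : ∀ i, Measurable fun z => p z i) {x : Z → X} (hx : Disc x) {y : Z → ℝ}
    (hy : Measurable y) (i : Fin C.L) :
    Measurable fun z => C.posterior (c z) (p z) (x z) (y z) i := by
  refine hc.measurable_bind (F := fun v z => C.posterior v (p z) (x z) (y z) i) fun v => ?_
  refine hx.measurable_bind (F := fun t z => C.posterior v (p z) t (y z) i) fun t => ?_
  unfold posterior gauss
  fun_prop

section Resample

variable {h : Z → List (X × ℝ)} {u : Z → ℕ → Fin C.L → ℝ} {c : Z → Fin C.L → Θ}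
  {p : Z → Fin C.L → ℝ}

theorem disc_rounds (hh : C.MeasHist h) (hu : ∀ r i, Measurable fun z => u z r i) (hc : Disc c)
    (hp : ∀ i, Measurable fun z => p z i) (r : ℕ) :
    Disc (fun z => (C.rounds (h z) (u z) (c z) (p z) r).1) ∧
      ∀ i, Measurable fun z => (C.rounds (h z) (u z) (c z) (p z) r).2 i := by
  induction r with
  | zero => exact ⟨hc, hp⟩
  | succ r ih =>
    have hc' : Disc fun z => (C.rounds (h z) (u z) (c z) (p z) (r + 1)).1 := by
      simp only [rounds]
      refine (disc_removed ih.2).bind (F := fun A z => refill (C.likelihood (h z)) (u z r)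
        (A.sort (· ≤ ·)) (C.smallPool (h z)) (C.rounds (h z) (u z) (c z) (p z) r).1) fun A => ?_
      refine (disc_smallPool hh).bind (F := fun B z => refill (C.likelihood (h z)) (u z r)
        (A.sort (· ≤ ·)) B (C.rounds (h z) (u z) (c z) (p z) r).1) fun B => ?_
      refine ih.1.bind (F := fun v z => refill (C.likelihood (h z)) (u z r)
        (A.sort (· ≤ ·)) B v) fun v => ?_
      exact Disc.refill (w := fun θ z => C.likelihood (h z) θ) hh.likelihood (hu r) _ _ _
    exact ⟨hc', fun i => measurable_probFromHist hh hc' i⟩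

theorem disc_resample (hh : C.MeasHist h) (hu : ∀ r i, Measurable fun z => u z r i) (hc : Disc c)
    (hp : ∀ i, Measurable fun z => p z i) :
    Disc (fun z => (C.resample (h z) (u z) (c z) (p z)).1) ∧
      ∀ i, Measurable fun z => (C.resample (h z) (u z) (c z) (p z)).2 i := by
  have hN : Disc fun z => sInf {r | 1 ≤ r ∧ ¬ C.TooManyLow (C.rounds (h z) (u z) (c z) (p z) r).2} :=
    Disc.natSInf fun r => (MeasurableSet.const (1 ≤ r)).inter
      (measurableSet_tooManyLow (disc_rounds hh hu hc hp r).2).compl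
  unfold resample
  exact ⟨hN.bind (F := fun r z => (C.rounds (h z) (u z) (c z) (p z) r).1)
      fun r => (disc_rounds hh hu hc hp r).1,
    fun i => hN.measurable_bind (F := fun r z => (C.rounds (h z) (u z) (c z) (p z) r).2 i)
      fun r => (disc_rounds hh hu hc hp r).2 i⟩

end Resample

section Score

variable {p : Z → Fin C.L → ℝ}

theorem measurable_fbar {c : Fin C.L → Θ} (hp : ∀ i, Measurable fun z => p z i) (x : X) :
    Measurable fun z => C.fbar c (p z) x := by
  unfold fbar; fun_prop

theorem measurable_posterior_prod (c : Fin C.L → Θ) (hp : ∀ i, Measurable fun z => p z i) (x : X)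
    (j i : Fin C.L) : Measurable fun q : Z × ℝ =>
      C.posterior c (p q.1) x (C.f x (c j) + q.2) i := by
  have hp' : ∀ l, Measurable fun q : Z × ℝ => p q.1 l := fun l => (hp l).comp measurable_fst
  unfold posterior gauss
  fun_prop

theorem measurable_scoreF [Fintype X] (c : Fin C.L → Θ) (hp : ∀ i, Measurable fun z => p z i) (x : X) :
    Measurable fun z => C.scoreF c (p z) x := by
  unfold scoreF
  refine Measurable.sub (Finset.measurable_fun_sum _ fun j _ => Measurable.mul ?_ (hp j))
    (Measurable.iSup fun x' => measurable_fbar hp x')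
  refine StronglyMeasurable.measurable (StronglyMeasurable.integral_prod_right
    (f := fun z w => ⨆ x', C.fbar c (C.posterior c (p z) x (C.f x (c j) + w)) x') ?_)
  refine Measurable.stronglyMeasurable (Measurable.iSup fun x' => ?_)
  exact measurable_fbar (Z := Z × ℝ)
    (p := fun q => C.posterior c (p q.1) x (C.f x (c j) + q.2))
    (fun i => measurable_posterior_prod c hp x j i) x'

theorem measurable_scoreH (c : Fin C.L → Θ) (hp : ∀ i, Measurable fun z => p z i) (x : X) :
    Measurable fun z => C.scoreH c (p z) x := by
  unfold scoreH
  refine Measurable.sub (Finset.measurable_fun_sum _ fun j _ => Measurable.mul ?_ (hp j))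
    (Finset.measurable_fun_sum _ fun i _ => (hp i).mul (Real.measurable_log.comp (hp i)))
  refine StronglyMeasurable.measurable (StronglyMeasurable.integral_prod_right
    (f := fun z w => ∑ i, C.posterior c (p z) x (C.f x (c j) + w) i *
      Real.log (C.posterior c (p z) x (C.f x (c j) + w) i)) ?_)
  refine Measurable.stronglyMeasurable (Finset.measurable_fun_sum _ fun i _ => ?_)
  have := measurable_posterior_prod c hp x j i
  exact this.mul (Real.measurable_log.comp this)

theorem disc_argmaxSet_score [Fintype X] {c : Z → Fin C.L → Θ} (hc : Disc c)
    (hp : ∀ i, Measurable fun z => p z i) :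
    Disc fun z => argmaxSet (C.score (c z) (p z)) := by
  classical
  refine hc.bind (F := fun v z => argmaxSet (C.score v (p z))) fun v => ?_
  have hs : ∀ x, Measurable fun z => C.score v (p z) x := fun x => by
    unfold score
    cases C.policy
    · exact measurable_scoreF v hp x
    · exact measurable_scoreH v hp x
  unfold argmaxSet
  have := Disc.filter (Finset.univ : Finset X)
    (p := fun x z => ∀ y, C.score v (p z) y ≤ C.score v (p z) x) fun x => by
      simp only [Set.ofPred_forall]
      exact MeasurableSet.iInter fun y => measurableSet_le (hs y) (hs x)
  convert this

end Score

/-- A random state all of whose components are measurable. -/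
structure MeasState (C : Config X Θ) (s : Z → State X Θ C.L) : Prop where
  hist : C.MeasHist fun z => (s z).hist
  cand : Disc fun z => (s z).cand
  prob : ∀ i, Measurable fun z => (s z).prob i
  age : Disc fun z => (s z).age

theorem MeasState.nextAlt [Fintype X] [Nonempty X] {s : Z → State X Θ C.L} (hs : C.MeasState s)
    {u : Z → ℝ} (hu : Measurable u) : Disc fun z => C.nextAlt (s z) (u z) := by
  unfold Config.nextAlt
  refine (disc_argmaxSet_score hs.cand hs.prob).bind
    (F := fun A z => roulette (C.tie A) (Classical.arbitrary X) A (u z)) fun A => ?_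
  exact Disc.roulette (w := fun x _ => C.tie A x) (fun _ => measurable_const) _ _ hu

/-- Resampling takes place in the iteration in which `y` is measured at `x`. -/
def Resamples (C : Config X Θ) (s : State X Θ C.L) (x : X) (y : ℝ) : Prop :=
  C.nResamp ≤ s.age + 1 ∨ C.TooManyLow (C.posterior s.cand s.prob x y)

theorem MeasState.measurableSet_resamples {s : Z → State X Θ C.L} (hs : C.MeasState s)
    {x : Z → X} (hx : Disc x) {y : Z → ℝ} (hy : Measurable y) :
    MeasurableSet {z | C.Resamples (s z) (x z) (y z)} :=
  (hs.age.measurableSet fun a => C.nResamp ≤ a + 1).union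
    (measurableSet_tooManyLow fun i => measurable_posterior hs.cand hs.prob hx hy i)

theorem update_hist (s : State X Θ C.L) (x : X) (y : ℝ) (u : ℕ → Fin C.L → ℝ) :
    (C.update s x y u).hist = (x, y) :: s.hist := by
  unfold update; simp only; split_ifs <;> rfl

theorem update_of_resamples {s : State X Θ C.L} {x : X} {y : ℝ} (h : C.Resamples s x y)
    (u : ℕ → Fin C.L → ℝ) :
    (C.update s x y u).cand =
        (C.resample ((x, y) :: s.hist) u s.cand (C.posterior s.cand s.prob x y)).1 ∧
      (C.update s x y u).prob =
        (C.resample ((x, y) :: s.hist) u s.cand (C.posterior s.cand s.prob x y)).2 ∧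
      (C.update s x y u).age = 0 := by
  unfold Resamples at h
  unfold update
  simp only
  rw [if_pos h]
  exact ⟨rfl, rfl, rfl⟩

theorem update_of_not_resamples {s : State X Θ C.L} {x : X} {y : ℝ} (h : ¬ C.Resamples s x y)
    (u : ℕ → Fin C.L → ℝ) :
    (C.update s x y u).cand = s.cand ∧
      (C.update s x y u).prob = C.posterior s.cand s.prob x y ∧
      (C.update s x y u).age = s.age + 1 := by
  unfold Resamples at h
  unfold update
  simp only
  rw [if_neg h]
  exact ⟨rfl, rfl, rfl⟩

theorem ite_eq_of {α : Type*} {p : Prop} [Decidable p] {a b c : α} (h1 : p → a = b)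
    (h2 : ¬ p → a = c) : a = if p then b else c := by
  split_ifs with h
  · exact h1 h
  · exact h2 h

open Classical in
theorem MeasState.update {s : Z → State X Θ C.L} (hs : C.MeasState s)
    {x : Z → X} (hx : Disc x) {y : Z → ℝ} (hy : Measurable y) {u : Z → ℕ → Fin C.L → ℝ}
    (hu : ∀ r i, Measurable fun z => u z r i) :
    C.MeasState fun z => C.update (s z) (x z) (y z) (u z) := by
  have hR := hs.measurableSet_resamples hx hy
  have hh := hs.hist.cons hx hy
  have hpost := measurable_posterior hs.cand hs.prob hx hy
  obtain ⟨h1, h2⟩ := disc_resample hh hu hs.cand hpost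
  refine ⟨?_, ?_, fun i => ?_, ?_⟩
  · simp_rw [update_hist]; exact hh
  · have e : (fun z => (C.update (s z) (x z) (y z) (u z)).cand) = _ :=
      funext fun z => ite_eq_of (update_of_resamples · (u z) |>.1)
        (update_of_not_resamples · (u z) |>.1)
    rw [e]; exact Disc.ite hR h1 hs.cand
  · have e : (fun z => (C.update (s z) (x z) (y z) (u z)).prob i) = _ :=
      funext fun z => ite_eq_of (fun h => congrFun (update_of_resamples h (u z)).2.1 i)
        (fun h => congrFun (update_of_not_resamples h (u z)).2.1 i)
    rw [e]; exact Measurable.ite hR (h2 i) (hpost i)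
  · have e : (fun z => (C.update (s z) (x z) (y z) (u z)).age) = _ :=
      funext fun z => ite_eq_of (update_of_resamples · (u z) |>.2.2)
        (update_of_not_resamples · (u z) |>.2.2)
    rw [e]; exact Disc.ite hR (Disc.const 0) (hs.age.comp (· + 1))

theorem MeasState.state [Fintype X] [Nonempty X] (c₀ : Fin C.L → Θ) (θs : Θ) {W : Z → ℕ → ℝ}
    (hW : ∀ n, Measurable fun z => W z n) {U : Z → Seed C.L → ℝ}
    (hU : ∀ s, Measurable fun z => U z s) (n : ℕ) :
    C.MeasState fun z => C.state c₀ θs (W z) (U z) n := by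
  induction n with
  | zero =>
    refine ⟨⟨⟨0, fun z => rfl⟩, fun θ => ?_, fun θ => ?_⟩, Disc.const _, fun i => ?_,
      Disc.const _⟩ <;> exact measurable_const
  | succ n ih =>
    simp only [Config.state]
    have hx := ih.nextAlt (hU (Seed.tie n))
    refine ih.update hx (Measurable.add ?_ (hW n)) fun r i => hU _
    exact hx.measurable_bind (F := fun v _ => C.f v θs) fun _ => measurable_const

end Config

end KGDP

/-! ### The algorithm on the product space, and the likelihood ratios. -/

namespace KGDP

namespace Config

open scoped ENNReal

section

variable {X Θ : Type*} {C : Config X Θ}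

theorem rounds_snd {h : List (X × ℝ)} (u : ℕ → Fin C.L → ℝ) (c : Fin C.L → Θ) (r : ℕ) :
    (C.rounds h u c (C.probFromHist h c) r).2 =
      C.probFromHist h (C.rounds h u c (C.probFromHist h c) r).1 := by
  cases r <;> rfl

theorem rounds_mem {h : List (X × ℝ)} (u : ℕ → Fin C.L → ℝ) {c : Fin C.L → Θ}
    (p : Fin C.L → ℝ) (hc : ∀ i, c i ∈ C.pool) (r : ℕ) (i : Fin C.L) :
    (C.rounds h u c p r).1 i ∈ C.pool := by
  induction r generalizing i with
  | zero => exact hc i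
  | succ r ih => exact refill_mem _ _ _ _ _ (C.smallPool_subset h) _ ih i

/-- This is the Hellinger affinity of two normal laws with common variance. The square root of the
ratio is the exponential of an affine function of the noise, so the Gaussian moment generating
function gives its mean. -/
theorem lintegral_sqrt_gauss_div (hσ : 0 < C.σ) (x : X) (θ θs : Θ) :
    ∫⁻ w, ENNReal.ofReal
        (√(C.gauss x (C.f x θs + w) θ / C.gauss x (C.f x θs + w) θs)) ∂C.noiseLaw =
      ENNReal.ofReal (Real.exp (-(C.f x θs - C.f x θ) ^ 2 / (8 * C.σ ^ 2))) := by
  set d := C.f x θs - C.f x θ with hd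
  have e1 : ∀ w, √(C.gauss x (C.f x θs + w) θ / C.gauss x (C.f x θs + w) θs) =
      Real.exp (-d ^ 2 / (4 * C.σ ^ 2)) * Real.exp (-d / (2 * C.σ ^ 2) * w) := fun w => by
    unfold gauss
    rw [← Real.exp_sub, ← Real.exp_half, ← Real.exp_add]
    congr 1
    have : C.f x θs = d + C.f x θ := by rw [hd]; ring
    rw [this]
    field_simp
    ring
  simp_rw [e1]
  rw [← ofReal_integral_eq_lintegral_ofReal, integral_const_mul]
  · have := congrFun (mgf_fun_id_gaussianReal (μ := 0) (v := Real.toNNReal (C.σ ^ 2)))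
      (-d / (2 * C.σ ^ 2))
    unfold mgf at this
    unfold noiseLaw
    rw [this, ← Real.exp_add, Real.coe_toNNReal _ (by positivity)]
    congr 2
    field_simp
    ring
  · exact (integrable_exp_mul_gaussianReal _).const_mul _
  · exact ae_of_all _ fun w => by positivity

end

variable {X Θ : Type*} [Fintype X] [Nonempty X] (C : Config X Θ) (c₀ : Fin C.L → Θ) (θs : Θ)

/-- The laws of the noise variables and of the seeds. -/
noncomputable def law : ℕ ⊕ Seed C.L → Measure ℝ :=
  Sum.elim (fun _ => C.noiseLaw) (fun _ => unif)

instance (i : ℕ ⊕ Seed C.L) : IsProbabilityMeasure (C.law i) := by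
  rcases i with i | i
  · exact inferInstanceAs (IsProbabilityMeasure C.noiseLaw)
  · exact inferInstanceAs (IsProbabilityMeasure unif)

/-- The joint law of the noise variables and the seeds. -/
noncomputable abbrev jointLaw : Measure (ℕ ⊕ Seed C.L → ℝ) := Measure.infinitePi C.law

/-- The iteration in which a noise variable or a seed is used. -/
def time {L : ℕ} : ℕ ⊕ Seed L → ℕ
  | Sum.inl n => n
  | Sum.inr (Seed.tie n) => n
  | Sum.inr (Seed.draw n _ _) => n

/-- The state after `n` iterations, as a function of the noise variables and the seeds. -/
noncomputable def run (z : ℕ ⊕ Seed C.L → ℝ) (n : ℕ) : State X Θ C.L :=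
  C.state c₀ θs (fun n => z (Sum.inl n)) (fun s => z (Sum.inr s)) n

/-- The alternative measured in iteration `n`. -/
noncomputable def alt (z : ℕ ⊕ Seed C.L → ℝ) (n : ℕ) : X :=
  C.nextAlt (C.run c₀ θs z n) (z (Sum.inr (Seed.tie n)))

/-- The value measured in iteration `n`. -/
noncomputable def obs (z : ℕ ⊕ Seed C.L → ℝ) (n : ℕ) : ℝ :=
  C.f (C.alt c₀ θs z n) θs + z (Sum.inl n)

theorem run_succ (z : ℕ ⊕ Seed C.L → ℝ) (n : ℕ) :
    C.run c₀ θs z (n + 1) = C.update (C.run c₀ θs z n) (C.alt c₀ θs z n) (C.obs c₀ θs z n)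
      fun r i => z (Sum.inr (Seed.draw n r i)) := rfl

theorem measState_run (n : ℕ) : C.MeasState fun z => C.run c₀ θs z n :=
  MeasState.state c₀ θs (fun _ => measurable_pi_apply _) (fun _ => measurable_pi_apply _) n

theorem disc_alt (n : ℕ) : Disc fun z => C.alt c₀ θs z n :=
  (C.measState_run c₀ θs n).nextAlt (measurable_pi_apply _)

theorem measurable_obs (n : ℕ) : Measurable fun z => C.obs c₀ θs z n :=
  Measurable.add ((C.disc_alt c₀ θs n).measurable_bind (F := fun v _ => C.f v θs)
    fun _ => measurable_const) (measurable_pi_apply _)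

/-- Adaptedness: replacing variables of iteration `n` or later leaves the state at time `n`
unchanged. This takes the place of a filtration. -/
theorem run_congr {z z' : ℕ ⊕ Seed C.L → ℝ} {n : ℕ} (h : ∀ i, time i < n → z i = z' i) :
    C.run c₀ θs z n = C.run c₀ θs z' n := by
  induction n with
  | zero => rfl
  | succ n ih =>
    have h1 := ih fun i hi => h i (by omega)
    have h2 : C.alt c₀ θs z n = C.alt c₀ θs z' n := by
      unfold alt
      rw [h1, h (Sum.inr (Seed.tie n)) (by simp [time])]
    have h3 : C.obs c₀ θs z n = C.obs c₀ θs z' n := by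
      unfold obs
      rw [h2, h (Sum.inl n) (by simp [time])]
    rw [run_succ, run_succ, h1, h2, h3]
    congr 1
    funext r i
    exact h _ (by simp [time])

theorem alt_congr {z z' : ℕ ⊕ Seed C.L → ℝ} {n : ℕ} (h : ∀ i, time i < n → z i = z' i)
    (h' : z (Sum.inr (Seed.tie n)) = z' (Sum.inr (Seed.tie n))) :
    C.alt c₀ θs z n = C.alt c₀ θs z' n := by
  unfold alt
  rw [C.run_congr c₀ θs h, h']

variable {C c₀ θs}

/-- The initial value `1 / L` is the case of the empty history, Bayes' rule preserves the form, and
every resampling restores it. -/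
theorem Admissible.run_prob (hC : C.Admissible) (z : ℕ ⊕ Seed C.L → ℝ) (n : ℕ) :
    (C.run c₀ θs z n).prob =
      C.probFromHist (C.run c₀ θs z n).hist (C.run c₀ θs z n).cand := by
  induction n with
  | zero =>
    funext i
    simp [run, state, probFromHist, likelihood]
  | succ n ih =>
    rw [run_succ, update_hist]
    by_cases hres : C.Resamples (C.run c₀ θs z n) (C.alt c₀ θs z n) (C.obs c₀ θs z n)
    · rw [(update_of_resamples hres _).1, (update_of_resamples hres _).2.1, ih,
        posterior_probFromHist hC]
      exact rounds_snd _ _ _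
    · rw [(update_of_not_resamples hres _).1, (update_of_not_resamples hres _).2.1, ih,
        posterior_probFromHist hC]

theorem run_cand_mem (hc₀ : ∀ i, c₀ i ∈ C.pool) (z : ℕ ⊕ Seed C.L → ℝ) (n : ℕ) (i : Fin C.L) :
    (C.run c₀ θs z n).cand i ∈ C.pool := by
  induction n generalizing i with
  | zero => exact hc₀ i
  | succ n ih =>
    rw [run_succ]
    by_cases hres : C.Resamples (C.run c₀ θs z n) (C.alt c₀ θs z n) (C.obs c₀ θs z n)
    · rw [(update_of_resamples hres _).1]
      exact rounds_mem _ _ ih _ _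
    · rw [(update_of_not_resamples hres _).1]; exact ih i

section LikelihoodRatio

/-- The square root of the likelihood ratio of `θ` and the true parameter. -/
noncomputable def sqrtRatio (C : Config X Θ) (c₀ : Fin C.L → Θ) (θs θ : Θ) (n : ℕ)
    (z : ℕ ⊕ Seed C.L → ℝ) : ℝ≥0∞ :=
  ENNReal.ofReal (√(C.likelihood (C.run c₀ θs z n).hist θ / C.likelihood (C.run c₀ θs z n).hist θs))

theorem sqrtRatio_succ (θ : Θ) (n : ℕ) (z : ℕ ⊕ Seed C.L → ℝ) :
    C.sqrtRatio c₀ θs θ (n + 1) z = C.sqrtRatio c₀ θs θ n z *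
      ENNReal.ofReal (√(C.gauss (C.alt c₀ θs z n) (C.obs c₀ θs z n) θ /
        C.gauss (C.alt c₀ θs z n) (C.obs c₀ θs z n) θs)) := by
  unfold sqrtRatio
  rw [run_succ, update_hist, likelihood_cons, likelihood_cons, mul_div_mul_comm,
    Real.sqrt_mul (div_nonneg (C.gauss_pos _ _ _).le (C.gauss_pos _ _ _).le), mul_comm,
    ENNReal.ofReal_mul (Real.sqrt_nonneg _)]

/-- The iterations in which an alternative is measured that separates `θ` from the truth. -/
def separating (C : Config X Θ) (c₀ : Fin C.L → Θ) (θs θ : Θ) (n : ℕ) :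
    Set (ℕ ⊕ Seed C.L → ℝ) :=
  {z | C.f (C.alt c₀ θs z n) θ ≠ C.f (C.alt c₀ θs z n) θs}

/-- Given the past, the square root of the ratio shrinks on average by a factor at most 1, and by a
factor bounded away from 1 at separating alternatives. The ratio itself would have conditional mean
factor 1 and show no loss. -/
theorem ae_tendsto_sqrtRatio (hσ : 0 < C.σ) (θ : Θ) :
    ∀ᵐ z ∂C.jointLaw, Tendsto (fun n => (separating C c₀ θs θ n).indicator
      (C.sqrtRatio c₀ θs θ n) z) atTop (𝓝 0) := by
  have hYm : ∀ n, Measurable (C.sqrtRatio c₀ θs θ n) := fun n => by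
    have hh := (C.measState_run c₀ θs n).hist.likelihood
    exact ((hh θ).div (hh θs)).sqrt.ennreal_ofReal
  -- The loss is uniform because there are finitely many alternatives.
  obtain ⟨b, hb0, hb1, hb⟩ : ∃ b : ℝ, 0 < b ∧ b ≤ 1 ∧ ∀ x, C.f x θ ≠ C.f x θs →
      Real.exp (-(C.f x θs - C.f x θ) ^ 2 / (8 * C.σ ^ 2)) ≤ 1 - b := by
    have h : ∀ x, ∃ b : ℝ, 0 < b ∧ b ≤ 1 ∧ (C.f x θ ≠ C.f x θs →
        Real.exp (-(C.f x θs - C.f x θ) ^ 2 / (8 * C.σ ^ 2)) ≤ 1 - b) := fun x => by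
      by_cases hx : C.f x θ = C.f x θs
      · exact ⟨1, one_pos, le_rfl, fun h => absurd hx h⟩
      · refine ⟨1 - Real.exp (-(C.f x θs - C.f x θ) ^ 2 / (8 * C.σ ^ 2)), ?_, ?_, fun _ => ?_⟩
        · have : 0 < (C.f x θs - C.f x θ) ^ 2 := by
            have := sub_ne_zero.2 (Ne.symm hx); positivity
          rw [sub_pos, Real.exp_lt_one_iff, neg_div, neg_lt_zero]
          positivity
        · have := Real.exp_pos (-(C.f x θs - C.f x θ) ^ 2 / (8 * C.σ ^ 2))
          linarith
        · linarith
    choose b hb0 hb1 hb using h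
    obtain ⟨x₀, hx₀⟩ := Finite.exists_min b
    exact ⟨b x₀, hb0 _, hb1 _, fun x hx => (hb x hx).trans (by linarith [hx₀ x])⟩
  have hNm : ∀ n, MeasurableSet (separating C c₀ θs θ n) := fun n =>
    (C.disc_alt c₀ θs n).measurableSet fun x => C.f x θ ≠ C.f x θs
  refine ae_tendsto_indicator_of_supermartingale _ _ (ENNReal.ofReal b)
    (by rwa [Ne, ENNReal.ofReal_eq_zero, not_le]) hYm hNm ?_ fun n => ?_
  · have : ∀ z, C.sqrtRatio c₀ θs θ 0 z = 1 := fun z => by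
      simp [sqrtRatio, run, state, likelihood]
    simp [this]
  -- Integrate over the noise of iteration `n` alone: the history and the chosen alternative do not
  -- depend on it.
  · rw [lintegral_subst C.law {Sum.inl n} (hYm (n + 1)),
      ← lintegral_const_mul _ ((hYm n).indicator (hNm n)),
      ← lintegral_add_right _ (((hYm n).indicator (hNm n)).const_mul _)]
    refine lintegral_mono fun z => ?_
    have e1 : ∀ z', C.sqrtRatio c₀ θs θ (n + 1) (subst {Sum.inl n} z z') =
        C.sqrtRatio c₀ θs θ n z * ENNReal.ofReal
          (√(C.gauss (C.alt c₀ θs z n) (C.f (C.alt c₀ θs z n) θs + z' (Sum.inl n)) θ /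
            C.gauss (C.alt c₀ θs z n) (C.f (C.alt c₀ θs z n) θs + z' (Sum.inl n)) θs)) := by
      intro z'
      have hag : ∀ i, time i < n → subst {Sum.inl n} z z' i = z i := fun i hi =>
        subst_of_notMem (by rintro rfl; simp [time] at hi) _ _
      have h1 := C.alt_congr c₀ θs hag (subst_of_notMem (by simp) _ _)
      have h2 := C.run_congr c₀ θs hag
      rw [sqrtRatio_succ]
      unfold obs sqrtRatio
      rw [h1, h2, subst_of_mem (by simp)]
    simp_rw [e1]
    have hgm : Measurable fun w => ENNReal.ofReal
        (√(C.gauss (C.alt c₀ θs z n) (C.f (C.alt c₀ θs z n) θs + w) θ /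
            C.gauss (C.alt c₀ θs z n) (C.f (C.alt c₀ θs z n) θs + w) θs)) := by
      unfold gauss; fun_prop
    have hev : Measurable fun z' : ℕ ⊕ Seed C.L → ℝ => z' (Sum.inl n) := measurable_pi_apply _
    have hmap : C.jointLaw.map (fun z' => z' (Sum.inl n)) = C.noiseLaw :=
      Measure.infinitePi_map_eval C.law (Sum.inl n)
    have e2 := lintegral_sqrt_gauss_div hσ (C.alt c₀ θs z n) θ θs
    rw [← hmap, lintegral_map hgm hev] at e2
    have hgm' := hgm.comp hev
    simp only [Function.comp_def] at hgm'
    rw [lintegral_const_mul _ hgm', e2]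
    by_cases hz : z ∈ separating C c₀ θs θ n
    · rw [Set.indicator_of_mem hz, mul_comm (ENNReal.ofReal b), ← mul_add,
        ← ENNReal.ofReal_add (Real.exp_pos _).le hb0.le]
      refine mul_le_of_le_one_right' ?_
      rw [ENNReal.ofReal_le_one]
      linarith [hb _ hz]
    · rw [Set.indicator_of_notMem hz, mul_zero, add_zero]
      refine mul_le_of_le_one_right' ?_
      rw [ENNReal.ofReal_le_one, Real.exp_le_one_iff]
      exact div_nonpos_of_nonpos_of_nonneg (neg_nonpos.2 (sq_nonneg _)) (by positivity)

theorem sqrtRatio_succ_of_notMem {θ : Θ} {n : ℕ} {z : ℕ ⊕ Seed C.L → ℝ}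
    (hz : z ∉ separating C c₀ θs θ n) :
    C.sqrtRatio c₀ θs θ (n + 1) z = C.sqrtRatio c₀ θs θ n z := by
  have h : C.f (C.alt c₀ θs z n) θ = C.f (C.alt c₀ θs z n) θs := not_not.1 hz
  rw [sqrtRatio_succ]
  unfold gauss
  rw [h, div_self (Real.exp_pos _).ne', Real.sqrt_one, ENNReal.ofReal_one, mul_one]

/-- The ratio does not change before the next separating iteration, so smallness along those
iterations gives smallness at all late times. -/
theorem eventually_likelihood_lt {θ : Θ} {z : ℕ ⊕ Seed C.L → ℝ}
    (hz : Tendsto (fun n => (separating C c₀ θs θ n).indicator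
      (C.sqrtRatio c₀ θs θ n) z) atTop (𝓝 0))
    (hfreq : ∃ᶠ n in atTop, z ∈ separating C c₀ θs θ n) {e : ℝ} (he : 0 < e) :
    ∀ᶠ n in atTop, C.likelihood (C.run c₀ θs z n).hist θ <
      e * C.likelihood (C.run c₀ θs z n).hist θs := by
  have hev := hz.eventually_lt_const (show (0 : ℝ≥0∞) < ENNReal.ofReal (√e) by
    rw [ENNReal.ofReal_pos]; positivity)
  rw [eventually_atTop] at hev
  obtain ⟨n₀, hn₀⟩ := hev
  filter_upwards [eventually_ge_atTop n₀] with n hn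
  classical
  have hex : ∃ j, z ∈ separating C c₀ θs θ (n + j) := by
    obtain ⟨m, hm, hzm⟩ := frequently_atTop.1 hfreq n
    exact ⟨m - n, by rwa [Nat.add_sub_cancel' hm]⟩
  have hconst : ∀ j ≤ Nat.find hex,
      C.sqrtRatio c₀ θs θ (n + j) z = C.sqrtRatio c₀ θs θ n z := by
    intro j
    induction j with
    | zero => intro _; rfl
    | succ j ih =>
      intro hj
      rw [← ih (by omega), ← add_assoc]
      exact sqrtRatio_succ_of_notMem (Nat.find_min hex (by omega))
  have h1 := hn₀ (n + Nat.find hex) (by omega)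
  rw [Set.indicator_of_mem (Nat.find_spec hex), hconst _ le_rfl] at h1
  unfold sqrtRatio at h1
  rw [ENNReal.ofReal_lt_ofReal_iff (by positivity), Real.sqrt_lt_sqrt_iff
    (div_nonneg (C.likelihood_pos _ _).le (C.likelihood_pos _ _).le),
    div_lt_iff₀ (C.likelihood_pos _ _)] at h1
  exact h1

/-- After the last separating iteration both likelihoods are multiplied by the same factors. -/
theorem exists_eventually_likelihood_eq {θ : Θ} {z : ℕ ⊕ Seed C.L → ℝ}
    (hev : ∀ᶠ n in atTop, z ∉ separating C c₀ θs θ n) :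
    ∃ r : ℝ, 0 < r ∧ ∀ᶠ n in atTop, C.likelihood (C.run c₀ θs z n).hist θ =
      r * C.likelihood (C.run c₀ θs z n).hist θs := by
  obtain ⟨n₀, hn₀⟩ := eventually_atTop.1 hev
  refine ⟨C.likelihood (C.run c₀ θs z n₀).hist θ / C.likelihood (C.run c₀ θs z n₀).hist θs,
    div_pos (C.likelihood_pos _ _) (C.likelihood_pos _ _), ?_⟩
  filter_upwards [eventually_ge_atTop n₀] with n hn
  induction n, hn using Nat.le_induction with
  | base => rw [div_mul_cancel₀ _ (C.likelihood_pos _ _).ne']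
  | succ n hn ih =>
    have h : C.f (C.alt c₀ θs z n) θ = C.f (C.alt c₀ θs z n) θs := not_not.1 (hn₀ n hn)
    have hg : C.gauss (C.alt c₀ θs z n) (C.obs c₀ θs z n) θ =
        C.gauss (C.alt c₀ θs z n) (C.obs c₀ θs z n) θs := by unfold gauss; rw [h]
    rw [run_succ, update_hist, likelihood_cons, likelihood_cons, ih, hg]
    ring

end LikelihoodRatio

end Config

end KGDP

/-! ### Favorable resamplings succeed, and random ties select every maximizer, infinitely often. -/

namespace KGDP

namespace Config

open scoped ENNReal

theorem measurableSet_regime {X Θ Z : Type*} {C : Config X Θ} [MeasurableSpace Z] {h : Z → List (X × ℝ)}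
    (hh : C.MeasHist h) (E : Finset Θ) (M T : Θ) (κ : ℝ) :
    MeasurableSet {z | C.Regime (h z) E M T κ} := by
  have : {z | C.Regime (h z) E M T κ} =
      (⋂ θ ∈ C.pool, {z | C.likelihood (h z) θ ≤ C.likelihood (h z) M}) ∩
      ((⋂ θ ∈ C.pool, ⋂ (_ : θ ≠ M), {z | C.likelihood (h z) θ ≤ C.likelihood (h z) T}) ∩
      ({z | κ * C.likelihood (h z) M ≤ C.likelihood (h z) T} ∩
      (⋂ θ ∈ C.pool, ⋂ (_ : θ ∉ E),
        {z | C.likelihood (h z) θ < C.ε * C.likelihood (h z) M}))) := by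
    ext z
    simp only [Set.mem_inter_iff, Set.mem_iInter]
    exact ⟨fun ⟨h1, h2, h3, h4⟩ => ⟨h1, h2, h3, h4⟩, fun ⟨h1, h2, h3, h4⟩ => ⟨h1, h2, h3, h4⟩⟩
  rw [this]
  have hl := hh.likelihood
  refine MeasurableSet.inter ?_ (MeasurableSet.inter ?_ (MeasurableSet.inter ?_ ?_))
  · exact C.pool.measurableSet_biInter fun θ _ => measurableSet_le (hl θ) (hl M)
  · exact C.pool.measurableSet_biInter fun θ _ => MeasurableSet.iInter fun _ =>
      measurableSet_le (hl θ) (hl T)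
  · exact measurableSet_le ((hl M).const_mul _) (hl T)
  · exact C.pool.measurableSet_biInter fun θ _ => MeasurableSet.iInter fun _ =>
      measurableSet_lt (hl θ) ((hl M).const_mul _)

variable {X Θ : Type*} [Fintype X] [Nonempty X] {C : Config X Θ} {c₀ : Fin C.L → Θ} {θs : Θ}

/-- Resampling takes place in iteration `n`. -/
def resampling (C : Config X Θ) (c₀ : Fin C.L → Θ) (θs : Θ) (n : ℕ) :
    Set (ℕ ⊕ Seed C.L → ℝ) :=
  {z | C.Resamples (C.run c₀ θs z n) (C.alt c₀ θs z n) (C.obs c₀ θs z n)}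

/-- The situation from which the resampling in iteration `n` makes progress towards a mixed
list with positive probability. -/
def favorable (C : Config X Θ) (c₀ : Fin C.L → Θ) (θs : Θ) (E : Finset Θ) (M T : Θ) (κ : ℝ)
    (j n : ℕ) : Set (ℕ ⊕ Seed C.L → ℝ) :=
  {z | z ∈ resampling C c₀ θs n ∧
    C.Regime ((C.alt c₀ θs z n, C.obs c₀ θs z n) :: (C.run c₀ θs z n).hist) E M T κ ∧
    (¬ IsMixed E (C.run c₀ θs z n).cand ∧
      (T ≠ M ∨ ∀ i, (C.run c₀ θs z n).cand i ≠ M) ∧ j ≤ level M (C.run c₀ θs z n).cand)}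

/-- The list after iteration `n` is mixed or has a high level. -/
def progress (C : Config X Θ) (c₀ : Fin C.L → Θ) (θs : Θ) (E : Finset Θ) (M : Θ)
    (j n : ℕ) : Set (ℕ ⊕ Seed C.L → ℝ) :=
  {z | IsMixed E (C.run c₀ θs z (n + 1)).cand ∨ j + 1 ≤ level M (C.run c₀ θs z (n + 1)).cand}

/-- The seeds used for the resampling in iteration `n`. -/
def drawBlock (L n : ℕ) : Set (ℕ ⊕ Seed L) := {i | ∃ r j, i = Sum.inr (Seed.draw n r j)}

/-- The favorable situation is fixed before the draws of iteration `n`. The box of good seeds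
depends on that situation, but its probability is bounded below by a constant depending only on `κ`,
the pool size and `L`. -/
theorem ae_frequently_progress (hC : C.Admissible) (hc₀ : ∀ i, c₀ i ∈ C.pool) {E : Finset Θ}
    {M T : Θ} (hM : M ∈ C.pool) (hT : T ∈ C.pool) (hME : M ∈ E) (hTE : T ∈ E) {κ : ℝ} (hκ0 : 0 < κ)
    (hκ1 : κ ≤ 1) (j : ℕ) :
    ∀ᵐ z ∂C.jointLaw, (∃ᶠ n in atTop, z ∈ favorable C c₀ θs E M T κ j n) →
      ∃ᶠ n in atTop, z ∈ favorable C c₀ θs E M T κ j n ∩ progress C c₀ θs E M j n := by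
  have hK : 0 < (C.pool.card : ℝ) := by exact_mod_cast Finset.card_pos.2 ⟨M, hM⟩
  have hag : ∀ (n : ℕ) z z' i, time i < n → subst (drawBlock C.L n) z z' i = z i := by
    intro n z z' i hi
    refine subst_of_notMem ?_ _ _
    rintro ⟨r, j, rfl⟩
    simp [time] at hi
  have hrun : ∀ (n : ℕ) z z', ∀ k ≤ n,
      C.run c₀ θs (subst (drawBlock C.L n) z z') k = C.run c₀ θs z k := fun n z z' k hk =>
    C.run_congr c₀ θs fun i hi => hag n z z' i (by omega)
  have halt : ∀ (n : ℕ) z z', ∀ k ≤ n,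
      C.alt c₀ θs (subst (drawBlock C.L n) z z') k = C.alt c₀ θs z k := fun n z z' k hk =>
    C.alt_congr c₀ θs (fun i hi => hag n z z' i (by omega))
      (subst_of_notMem (by rintro ⟨r, j, h⟩; simp at h) _ _)
  have hobs : ∀ (n : ℕ) z z', ∀ k ≤ n,
      C.obs c₀ θs (subst (drawBlock C.L n) z z') k = C.obs c₀ θs z k := fun n z z' k hk => by
    unfold obs
    rw [halt n z z' k hk, subst_of_notMem (by rintro ⟨r, j, h⟩; simp at h)]
  -- Only the seeds of the first `L + 2` rounds matter, which gives the exponent `(L + 2) * L`.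
  let s : ℕ → Finset (ℕ ⊕ Seed C.L) := fun n =>
    (Finset.range (C.L + 2) ×ˢ (Finset.univ : Finset (Fin C.L))).map
      ⟨fun q => Sum.inr (Seed.draw n q.1 q.2), fun q q' h => by
        simp only [Sum.inr.injEq, Seed.draw.injEq, true_and] at h
        exact Prod.ext h.1 h.2⟩
  have hs : ∀ n, (s n).card = (C.L + 2) * C.L := fun n => by simp [s]
  refine ae_frequently_of_subst C.law (drawBlock C.L) _ _
    (ENNReal.ofReal (κ / C.pool.card) ^ ((C.L + 2) * C.L)) ?_ (fun n => ?_) (fun n => ?_)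
    (fun n k hk z z' => ?_) (fun n k hk z z' => ?_) (fun n z hz => ?_)
  · refine pow_ne_zero _ ?_
    rw [Ne, ENNReal.ofReal_eq_zero, not_le]; positivity
  · have hst := C.measState_run c₀ θs n
    refine (hst.measurableSet_resamples (C.disc_alt c₀ θs n) (C.measurable_obs c₀ θs n)).inter
      ((measurableSet_regime (hst.hist.cons (C.disc_alt c₀ θs n) (C.measurable_obs c₀ θs n))
        E M T κ).inter ?_)
    exact hst.cand.measurableSet fun c => ¬ IsMixed E c ∧ (T ≠ M ∨ ∀ i, c i ≠ M) ∧ j ≤ level M c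
  · exact (C.measState_run c₀ θs (n + 1)).cand.measurableSet fun c =>
      IsMixed E c ∨ j + 1 ≤ level M c
  · simp only [favorable, resampling, Set.mem_ofPred_eq]
    rw [hrun n z z' k hk, halt n z z' k hk, hobs n z z' k hk]
  · simp only [progress, Set.mem_ofPred_eq]
    rw [hrun n z z' (k + 1) hk]
  · obtain ⟨hres, hreg, hmix, hTM, hj⟩ := hz
    obtain ⟨I, hI, hu⟩ := hC.exists_box_resample hreg hM hT hκ0.le hκ1
      (run_cand_mem hc₀ z n) (hTM.imp (fun h => ⟨hTE, hME, h⟩) id) hmix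
    let t : ℕ ⊕ Seed C.L → Set ℝ := fun i => match i with
      | Sum.inr (Seed.draw _ r i) => I r i
      | _ => Set.univ
    have hbox := le_infinitePi_box C.law (s n) t (fun i hi => by
        obtain ⟨q, -, rfl⟩ := Finset.mem_map.1 hi; exact (hI q.1 q.2).1)
      (ENNReal.ofReal (κ / C.pool.card)) (fun i hi => by
        obtain ⟨q, -, rfl⟩ := Finset.mem_map.1 hi; exact (hI q.1 q.2).2)
    rw [hs] at hbox
    refine hbox.trans (measure_mono fun z' hz' => ?_)
    have hz'' : ∀ r < C.L + 2, ∀ i, z' (Sum.inr (Seed.draw n r i)) ∈ I r i := fun r hr i =>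
      hz' (Sum.inr (Seed.draw n r i)) (Finset.mem_map.2 ⟨(r, i), by simp [hr], rfl⟩)
    have := hu _ hz''
    simp only [progress, Set.mem_ofPred_eq]
    rw [run_succ, hrun n z z' n le_rfl, halt n z z' n le_rfl, hobs n z z' n le_rfl,
      (update_of_resamples hres _).1, hC.run_prob, posterior_probFromHist hC]
    have e : (fun r i => subst (drawBlock C.L n) z z' (Sum.inr (Seed.draw n r i))) =
        fun r i => z' (Sum.inr (Seed.draw n r i)) := by
      funext r i
      exact subst_of_mem (B := drawBlock C.L n) ⟨r, i, rfl⟩ _ _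
    rw [e]
    exact this.imp id fun h => by omega

theorem ae_frequently_alt_eq (htie : ∀ A : Finset X, ∀ x ∈ A, 0 < C.tie A x) (x : X) :
    ∀ᵐ z ∂C.jointLaw,
      (∃ᶠ n in atTop, x ∈ argmaxSet (C.score (C.run c₀ θs z n).cand (C.run c₀ θs z n).prob)) →
      ∃ᶠ n in atTop, C.alt c₀ θs z n = x := by
  classical
  have hsum : ∀ A : Finset X, x ∈ A → 0 < ∑ y ∈ A, C.tie A y := fun A hA =>
    Finset.sum_pos (fun y hy => htie A y hy) ⟨x, hA⟩
  -- The smallest share of `x` over the finitely many possible sets of maximizers.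
  obtain ⟨δ, hδ0, hδ⟩ : ∃ δ : ℝ, 0 < δ ∧ ∀ A : Finset X, x ∈ A →
      δ * ∑ y ∈ A, C.tie A y ≤ C.tie A x := by
    have h : ∀ A : Finset X, ∃ δ : ℝ, 0 < δ ∧ (x ∈ A →
        δ * ∑ y ∈ A, C.tie A y ≤ C.tie A x) := fun A => by
      by_cases hA : x ∈ A
      · exact ⟨C.tie A x / ∑ y ∈ A, C.tie A y, div_pos (htie A x hA) (hsum A hA), fun _ => by
          rw [div_mul_cancel₀ _ (hsum A hA).ne']⟩
      · exact ⟨1, one_pos, fun h => absurd h hA⟩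
    choose δ hδ0 hδ using h
    obtain ⟨A₀, hA₀⟩ := Finite.exists_min δ
    refine ⟨δ A₀, hδ0 _, fun A hA => le_trans ?_ (hδ A hA)⟩
    have := (hsum A hA).le
    gcongr
    exact hA₀ A
  have hag : ∀ (n : ℕ) (z z' : ℕ ⊕ Seed C.L → ℝ) i, i ≠ Sum.inr (Seed.tie n) →
      subst {Sum.inr (Seed.tie n)} z z' i = z i := fun n z z' i hi =>
    subst_of_notMem (by simpa using hi) _ _
  have hrun : ∀ (n : ℕ) z z', ∀ k ≤ n,
      C.run c₀ θs (subst {Sum.inr (Seed.tie n)} z z') k = C.run c₀ θs z k := fun n z z' k hk =>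
    C.run_congr c₀ θs fun i hi => hag n z z' i (by rintro rfl; simp [time] at hi; omega)
  have key := ae_frequently_of_subst C.law (fun n => {Sum.inr (Seed.tie n)})
    (fun n => {z | x ∈ argmaxSet (C.score (C.run c₀ θs z n).cand (C.run c₀ θs z n).prob)})
    (fun n => {z | C.alt c₀ θs z n = x}) (ENNReal.ofReal δ)
    (by rwa [Ne, ENNReal.ofReal_eq_zero, not_le]) (fun n => ?_)
    (fun n => (C.disc_alt c₀ θs n).measurableSet fun y => y = x)
    (fun n k hk z z' => ?_) (fun n k hk z z' => ?_) (fun n z hz => ?_)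
  · filter_upwards [key] with z hz hfreq
    exact (hz hfreq).mono fun n hn => hn.2
  · have hst := C.measState_run c₀ θs n
    exact (disc_argmaxSet_score hst.cand hst.prob).measurableSet fun A => x ∈ A
  · simp only [Set.mem_ofPred_eq]
    rw [hrun n z z' k hk]
  · simp only [Set.mem_ofPred_eq]
    rw [C.alt_congr c₀ θs (z := subst {Sum.inr (Seed.tie n)} z z') (z' := z)]
    · exact fun i hi => hag n z z' i (by rintro rfl; simp [time] at hi; omega)
    · exact hag n z z' _ (by simp; omega)
  · set A := argmaxSet (C.score (C.run c₀ θs z n).cand (C.run c₀ θs z n).prob) with hA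
    obtain ⟨I, hIm, hI, hIr⟩ := exists_roulette_eq (C.tie A) (Classical.arbitrary X) A
      (fun y hy => (htie A y hy).le) (hsum A hz) x hz δ (hδ A hz)
    have hbox := le_infinitePi_box C.law {Sum.inr (Seed.tie n)} (fun _ => I) (fun _ _ => hIm)
      (ENNReal.ofReal δ) (fun i hi => by rw [Finset.mem_singleton] at hi; rw [hi]; exact hI)
    rw [Finset.card_singleton, pow_one] at hbox
    refine hbox.trans (measure_mono fun z' hz' => ?_)
    simp only [Set.mem_ofPred_eq]
    unfold alt nextAlt
    rw [hrun n z z' n le_rfl, subst_of_mem (by simp), ← hA]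
    exact hIr _ (hz' _ (by simp))

theorem argmaxSet_nonempty {α : Type*} [Fintype α] [Nonempty α] (g : α → ℝ) :
    (argmaxSet g).Nonempty := by
  classical
  obtain ⟨x, hx⟩ := Finite.exists_max g
  exact ⟨x, by unfold argmaxSet; rw [Finset.mem_filter]; exact ⟨Finset.mem_univ _, hx⟩⟩

theorem mem_argmaxSet {α : Type*} [Fintype α] {g : α → ℝ} {x : α} :
    x ∈ argmaxSet g ↔ ∀ y, g y ≤ g x := by
  classical
  unfold argmaxSet
  rw [Finset.mem_filter]
  simp

theorem ae_alt_mem_argmaxSet (htie : ∀ A : Finset X, ∀ x ∈ A, 0 ≤ C.tie A x) :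
    ∀ᵐ z ∂C.jointLaw, ∀ n, C.alt c₀ θs z n ∈
      argmaxSet (C.score (C.run c₀ θs z n).cand (C.run c₀ θs z n).prob) := by
  rw [ae_all_iff]
  intro n
  have hev : Measurable fun z : ℕ ⊕ Seed C.L → ℝ => z (Sum.inr (Seed.tie n)) :=
    measurable_pi_apply _
  have hmap : C.jointLaw.map (fun z => z (Sum.inr (Seed.tie n))) = unif :=
    Measure.infinitePi_map_eval C.law (Sum.inr (Seed.tie n))
  have hle : ∀ᵐ u ∂unif, u ≤ 1 :=
    (ae_restrict_mem measurableSet_Icc).mono fun u hu => hu.2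
  rw [← hmap] at hle
  filter_upwards [ae_of_ae_map hev.aemeasurable hle] with z hz
  exact roulette_mem _ _ _ (argmaxSet_nonempty _) (htie _) _ hz

end Config

end KGDP

/-! ### The argument along a typical path. -/

namespace KGDP

namespace Config

open scoped ENNReal

section Path

variable {X Θ : Type*} [Fintype X] [Nonempty X] {C : Config X Θ} {c₀ : Fin C.L → Θ} {θs : Θ}
  {z : ℕ ⊕ Seed C.L → ℝ}

theorem run_succ_of_notMem_resampling {n : ℕ} (hn : z ∉ resampling C c₀ θs n) :
    (C.run c₀ θs z (n + 1)).cand = (C.run c₀ θs z n).cand ∧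
      (C.run c₀ θs z (n + 1)).age = (C.run c₀ θs z n).age + 1 := by
  rw [run_succ]
  exact ⟨(update_of_not_resamples hn _).1, (update_of_not_resamples hn _).2.2⟩

theorem exists_resampling (n : ℕ) : ∃ j, z ∈ resampling C c₀ θs (n + j) := by
  by_contra! hn
  have hage : ∀ j, (C.run c₀ θs z (n + j)).age = (C.run c₀ θs z n).age + j := fun j => by
    induction j with
    | zero => rfl
    | succ j ih =>
      rw [← add_assoc, (run_succ_of_notMem_resampling (hn j)).2, ih, add_assoc]
  refine hn C.nResamp (Or.inl ?_)
  rw [hage]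
  omega

/-- The list stays the same until the next resampling, which comes because the age reaches
`nResamp`. A property that lists have infinitely often thus holds infinitely often just before a
resampling. -/
theorem exists_resampling_cand_eq (n : ℕ) : ∃ m ≥ n, z ∈ resampling C c₀ θs m ∧
    (C.run c₀ θs z m).cand = (C.run c₀ θs z n).cand := by
  classical
  have hex := exists_resampling (C := C) (c₀ := c₀) (θs := θs) (z := z) n
  have h : ∀ j ≤ Nat.find hex, (C.run c₀ θs z (n + j)).cand = (C.run c₀ θs z n).cand := by
    intro j
    induction j with
    | zero => intro _; rfl
    | succ j ih =>
      intro hj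
      rw [← add_assoc, (run_succ_of_notMem_resampling (Nat.find_min hex (by omega))).1,
        ih (by omega)]
  exact ⟨n + Nat.find hex, by omega, Nat.find_spec hex, h _ le_rfl⟩

theorem frequently_resampling_of_frequently {p : (Fin C.L → Θ) → Prop}
    (hp : ∃ᶠ n in atTop, p (C.run c₀ θs z n).cand) :
    ∃ᶠ n in atTop, z ∈ resampling C c₀ θs n ∧ p (C.run c₀ θs z n).cand := by
  rw [frequently_atTop] at hp ⊢
  intro a
  obtain ⟨n, hn, hpn⟩ := hp a
  obtain ⟨m, hm, hres, hcand⟩ := exists_resampling_cand_eq (z := z) (c₀ := c₀) (θs := θs) n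
  exact ⟨m, by omega, hres, by rwa [hcand]⟩

theorem Regime.eventually_cons {E : Finset Θ} {M T : Θ} {κ : ℝ}
    (hR : ∀ᶠ n in atTop, C.Regime (C.run c₀ θs z n).hist E M T κ) :
    ∀ᶠ n in atTop,
      C.Regime ((C.alt c₀ θs z n, C.obs c₀ θs z n) :: (C.run c₀ θs z n).hist) E M T κ := by
  filter_upwards [(tendsto_add_atTop_nat 1).eventually hR] with n hn
  rwa [run_succ, update_hist] at hn

/-- If lists were eventually unmixed, infinitely frequent success would raise the level reached
infinitely often by one at a time, beyond the bound `L`. -/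
theorem frequently_isMixed {E : Finset Θ} {M T : Θ} {κ : ℝ} (hTM : T ≠ M)
    (hR : ∀ᶠ n in atTop, C.Regime (C.run c₀ θs z n).hist E M T κ)
    (hprog : ∀ j, (∃ᶠ n in atTop, z ∈ favorable C c₀ θs E M T κ j n) →
      ∃ᶠ n in atTop, z ∈ favorable C c₀ θs E M T κ j n ∩ progress C c₀ θs E M j n) :
    ∃ᶠ n in atTop, IsMixed E (C.run c₀ θs z n).cand := by
  by_contra hn
  rw [not_frequently] at hn
  have key : ∀ j, ∃ᶠ n in atTop, j ≤ level M (C.run c₀ θs z n).cand := by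
    intro j
    induction j with
    | zero => exact Frequently.of_forall fun n => Nat.zero_le _
    | succ j ih =>
      have h1 := frequently_resampling_of_frequently (p := fun c => j ≤ level M c) ih
      have h2 := hprog j ((h1.and_eventually ((Regime.eventually_cons hR).and hn)).mono
        fun n h => ⟨h.1.1, h.2.1, h.2.2, Or.inl hTM, h.1.2⟩)
      have h3 := (tendsto_add_atTop_nat 1).eventually hn
      have h4 := (h2.and_eventually h3).mono fun n h => h.1.2.resolve_left h.2
      exact (tendsto_add_atTop_nat 1).frequently h4
  obtain ⟨n, hn⟩ := (key (C.L + 1)).exists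
  have h1 : level M (C.run c₀ θs z n).cand ≤ slotCount M (C.run c₀ θs z n).cand := by
    unfold level; split_ifs <;> omega
  have := slotCount_le M (C.run c₀ θs z n).cand
  omega

/-- With `E = {M}` no list is mixed, so progress can only mean that `M` appears. Once only `M` is
likely, resampling cannot remove it. -/
theorem eventually_exists_cand_eq (hC : C.Admissible) (hc₀ : ∀ i, c₀ i ∈ C.pool) {M : Θ} {κ : ℝ}
    (hR : ∀ᶠ n in atTop, C.Regime (C.run c₀ θs z n).hist {M} M M κ)
    (hprog : (∃ᶠ n in atTop, z ∈ favorable C c₀ θs {M} M M κ 0 n) →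
      ∃ᶠ n in atTop, z ∈ favorable C c₀ θs {M} M M κ 0 n ∩ progress C c₀ θs {M} M 0 n) :
    ∀ᶠ n in atTop, ∃ i, (C.run c₀ θs z n).cand i = M := by
  have hmix : ∀ c : Fin C.L → Θ, ¬ IsMixed {M} c := by
    rintro c ⟨h1, i, j, hij⟩
    simp only [Finset.mem_singleton] at h1
    exact hij ((h1 i).trans (h1 j).symm)
  have hfreq : ∃ᶠ n in atTop, ∃ i, (C.run c₀ θs z n).cand i = M := by
    by_contra hn
    rw [not_frequently] at hn
    have h1 := frequently_resampling_of_frequently (p := fun c => ∀ i, c i ≠ M)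
      (hn.mono fun n h => by push Not at h; exact h).frequently
    have h2 := hprog ((h1.and_eventually (Regime.eventually_cons hR)).mono
      fun n h => ⟨h.1.1, h.2, hmix _, Or.inr h.1.2, Nat.zero_le _⟩)
    have h3 := (tendsto_add_atTop_nat 1).eventually hn
    obtain ⟨n, hn1, hn2⟩ := (h2.and_eventually h3).exists
    have h4 := hn1.2.resolve_left (hmix _)
    have h5 : level M (C.run c₀ θs z (n + 1)).cand ≤ slotCount M (C.run c₀ θs z (n + 1)).cand := by
      unfold level; split_ifs <;> omega
    exact hn2 ((slotCount_pos_iff M _).1 (by omega))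
  obtain ⟨N, hN⟩ := eventually_atTop.1 (Regime.eventually_cons hR)
  obtain ⟨n₀, hn₀, hM⟩ := frequently_atTop.1 hfreq N
  filter_upwards [eventually_ge_atTop n₀] with n hn
  induction n, hn using Nat.le_induction with
  | base => exact hM
  | succ n hn ih =>
    by_cases hres : z ∈ resampling C c₀ θs n
    · rw [run_succ, (update_of_resamples hres _).1, hC.run_prob, posterior_probFromHist hC]
      exact (hC.exists_eq_rounds (hN n (hn₀.trans hn)) _ (run_cand_mem hc₀ z n) ih _).2.2
    · rw [(run_succ_of_notMem_resampling hres).1]; exact ih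

open Classical in
/-- The parameters that agree with the truth at all alternatives measured infinitely often. -/
noncomputable def indistinguishable (C : Config X Θ) (c₀ : Fin C.L → Θ) (θs : Θ)
    (z : ℕ ⊕ Seed C.L → ℝ) : Finset Θ :=
  C.pool.filter fun θ => ∀ᶠ n in atTop, z ∉ separating C c₀ θs θ n

theorem mem_indistinguishable {θ : Θ} : θ ∈ indistinguishable C c₀ θs z ↔
    θ ∈ C.pool ∧ ∀ᶠ n in atTop, z ∉ separating C c₀ θs θ n := by
  classical
  unfold indistinguishable
  rw [Finset.mem_filter]

theorem truth_mem_indistinguishable (hθs : θs ∈ C.pool) :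
    θs ∈ indistinguishable C c₀ θs z :=
  mem_indistinguishable.2 ⟨hθs, Eventually.of_forall fun _ h => h rfl⟩

theorem eventually_likelihood_lt_of_notMem
    (hz : ∀ θ ∈ C.pool, Tendsto (fun n => (separating C c₀ θs θ n).indicator
      (C.sqrtRatio c₀ θs θ n) z) atTop (𝓝 0)) {e : ℝ} (he : 0 < e) :
    ∀ᶠ n in atTop, ∀ θ ∈ C.pool, θ ∉ indistinguishable C c₀ θs z →
      C.likelihood (C.run c₀ θs z n).hist θ < e * C.likelihood (C.run c₀ θs z n).hist θs := by
  rw [Finset.eventually_all]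
  intro θ hθ
  by_cases hE : θ ∈ indistinguishable C c₀ θs z
  · exact Eventually.of_forall fun n h => absurd hE h
  · refine (eventually_likelihood_lt (hz θ hθ) ?_ he).mono fun n h _ => h
    by_contra hn
    exact hE (mem_indistinguishable.2 ⟨hθ, not_frequently.1 hn⟩)

/-- On `E` the likelihoods are eventually constant multiples of that of the truth. `M` and `T` carry
the largest and second largest multiple; everything outside `E` is negligible against both. -/
theorem exists_regime (hε : 0 < C.ε) (hθs : θs ∈ C.pool)
    (hz : ∀ θ ∈ C.pool, Tendsto (fun n => (separating C c₀ θs θ n).indicator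
      (C.sqrtRatio c₀ θs θ n) z) atTop (𝓝 0))
    {θ' : Θ} (hθ' : θ' ∈ indistinguishable C c₀ θs z) (hne : θ' ≠ θs) :
    ∃ M ∈ indistinguishable C c₀ θs z, ∃ T ∈ indistinguishable C c₀ θs z, T ≠ M ∧ ∃ m : ℕ,
      ∀ᶠ n in atTop, C.Regime (C.run c₀ θs z n).hist (indistinguishable C c₀ θs z) M T
        (1 / ((m : ℝ) + 1)) := by
  classical
  set E := indistinguishable C c₀ θs z with hE
  have hr : ∀ θ, ∃ r : ℝ, 0 < r ∧ (θ ∈ E → ∀ᶠ n in atTop,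
      C.likelihood (C.run c₀ θs z n).hist θ = r * C.likelihood (C.run c₀ θs z n).hist θs) := by
    intro θ
    by_cases hθ : θ ∈ E
    · obtain ⟨r, hr, h⟩ := exists_eventually_likelihood_eq (mem_indistinguishable.1 hθ).2
      exact ⟨r, hr, fun _ => h⟩
    · exact ⟨1, one_pos, fun h => absurd h hθ⟩
  choose r hr0 hr using hr
  have hsE : θs ∈ E := truth_mem_indistinguishable hθs
  obtain ⟨M, hM, hMmax⟩ := E.exists_max_image r ⟨θs, hsE⟩
  have hne' : (E.erase M).Nonempty := by
    by_cases h : M = θs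
    · exact ⟨θ', Finset.mem_erase.2 ⟨by rwa [h], hθ'⟩⟩
    · exact ⟨θs, Finset.mem_erase.2 ⟨Ne.symm h, hsE⟩⟩
  obtain ⟨T, hT, hTmax⟩ := (E.erase M).exists_max_image r hne'
  obtain ⟨hTM, hTE⟩ := Finset.mem_erase.1 hT
  -- The constant depends on the path. The form `1 / (m + 1)` leaves countably many cases, so that
  -- one null set serves all of them.
  obtain ⟨m, hm⟩ := exists_nat_one_div_lt (div_pos (hr0 T) (hr0 M))
  refine ⟨M, hM, T, hTE, hTM, m, ?_⟩
  have hev1 : ∀ᶠ n in atTop, ∀ θ ∈ E, C.likelihood (C.run c₀ θs z n).hist θ =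
      r θ * C.likelihood (C.run c₀ θs z n).hist θs := by
    rw [Finset.eventually_all]; exact fun θ hθ => hr θ hθ
  filter_upwards [hev1, eventually_likelihood_lt_of_notMem hz (hr0 T),
    eventually_likelihood_lt_of_notMem hz (mul_pos hε (hr0 M))] with n h1 h2 h3
  have hpos := C.likelihood_pos (C.run c₀ θs z n).hist θs
  have hTleM : r T ≤ r M := hMmax T hTE
  refine ⟨fun θ hθ => ?_, fun θ hθ hθM => ?_, ?_, fun θ hθ hθE => ?_⟩
  · rw [h1 M hM]
    by_cases hθE : θ ∈ E
    · rw [h1 θ hθE]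
      have := hMmax θ hθE
      gcongr
    · exact (h2 θ hθ hθE).le.trans (by gcongr)
  · rw [h1 T hTE]
    by_cases hθE : θ ∈ E
    · rw [h1 θ hθE]
      have := hTmax θ (Finset.mem_erase.2 ⟨hθM, hθE⟩)
      gcongr
    · exact (h2 θ hθ hθE).le
  · rw [h1 M hM, h1 T hTE, ← mul_assoc]
    rw [lt_div_iff₀ (hr0 M)] at hm
    gcongr
  · rw [h1 M hM, ← mul_assoc]
    exact h3 θ hθ hθE

/-- Almost every path satisfies the following conditions. -/
structure Typical (C : Config X Θ) (c₀ : Fin C.L → Θ) (θs : Θ) (z : ℕ ⊕ Seed C.L → ℝ) :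
    Prop where
  ratio : ∀ θ ∈ C.pool, Tendsto (fun n => (separating C c₀ θs θ n).indicator
      (C.sqrtRatio c₀ θs θ n) z) atTop (𝓝 0)
  progress : ∀ E ∈ C.pool.powerset, ∀ M ∈ C.pool, ∀ T ∈ C.pool, ∀ m j : ℕ, M ∈ E → T ∈ E →
    (∃ᶠ n in atTop, z ∈ favorable C c₀ θs E M T (1 / ((m : ℝ) + 1)) j n) →
      ∃ᶠ n in atTop, z ∈ favorable C c₀ θs E M T (1 / ((m : ℝ) + 1)) j n ∩
        progress C c₀ θs E M j n
  tie : C.policy = Policy.KGf → ∀ x,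
    (∃ᶠ n in atTop, x ∈ argmaxSet (C.score (C.run c₀ θs z n).cand (C.run c₀ θs z n).prob)) →
      ∃ᶠ n in atTop, C.alt c₀ θs z n = x
  alt_mem : ∀ n, C.alt c₀ θs z n ∈
      argmaxSet (C.score (C.run c₀ θs z n).cand (C.run c₀ θs z n).prob)

theorem ae_typical (hC : C.Admissible) (hc₀ : ∀ i, c₀ i ∈ C.pool)
    (htie : ∀ A : Finset X, ∀ x ∈ A, 0 ≤ C.tie A x)
    (htief : C.policy = Policy.KGf → ∀ A : Finset X, ∀ x ∈ A, 0 < C.tie A x) :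
    ∀ᵐ z ∂C.jointLaw, Typical C c₀ θs z := by
  have h1 : ∀ᵐ z ∂C.jointLaw, ∀ θ ∈ C.pool, Tendsto (fun n =>
      (separating C c₀ θs θ n).indicator (C.sqrtRatio c₀ θs θ n) z) atTop (𝓝 0) := by
    rw [Finset.eventually_all]
    exact fun θ _ => ae_tendsto_sqrtRatio hC.σ_pos θ
  have h2 : ∀ᵐ z ∂C.jointLaw, ∀ E ∈ C.pool.powerset, ∀ M ∈ C.pool, ∀ T ∈ C.pool, ∀ m j : ℕ,
      M ∈ E → T ∈ E → (∃ᶠ n in atTop, z ∈ favorable C c₀ θs E M T (1 / ((m : ℝ) + 1)) j n) →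
      ∃ᶠ n in atTop, z ∈ favorable C c₀ θs E M T (1 / ((m : ℝ) + 1)) j n ∩
        Config.progress C c₀ θs E M j n := by
    simp only [Finset.eventually_all, ae_all_iff, eventually_imp_distrib_left]
    intro E _ M hM T hT m j hME hTE
    have hm : (1 : ℝ) ≤ (m : ℝ) + 1 := by simp
    have := ae_frequently_progress (c₀ := c₀) (θs := θs) hC hc₀ hM hT hME hTE
      (κ := 1 / ((m : ℝ) + 1)) (by positivity) ((div_le_one (by positivity)).2 hm) j
    exact this
  have h3 : ∀ᵐ z ∂C.jointLaw, C.policy = Policy.KGf → ∀ x,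
      (∃ᶠ n in atTop, x ∈ argmaxSet (C.score (C.run c₀ θs z n).cand (C.run c₀ θs z n).prob)) →
      ∃ᶠ n in atTop, C.alt c₀ θs z n = x := by
    rw [eventually_imp_distrib_left]
    intro hpol
    rw [eventually_all]
    exact fun x => ae_frequently_alt_eq (htief hpol) x
  filter_upwards [h1, h2, h3, ae_alt_mem_argmaxSet (c₀ := c₀) (θs := θs) htie] with z h1 h2 h3 h4
  exact ⟨h1, h2, h3, h4⟩

/-- At a late mixed list all candidates agree with the truth at the measured alternative. Measuring
it yields no information, so the maximal score is 0. Each policy contradicts this in its own way. -/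
theorem Typical.indistinguishable_eq (hz : Typical C c₀ θs z) (hC : C.Admissible)
    (hc₀ : ∀ i, c₀ i ∈ C.pool) (hθs : θs ∈ C.pool)
    (hinj : ∀ θ ∈ C.pool, ∀ θ' ∈ C.pool, θ ≠ θ' → ∃ x, C.f x θ ≠ C.f x θ') :
    indistinguishable C c₀ θs z = {θs} := by
  classical
  refine Finset.eq_singleton_iff_unique_mem.2 ⟨truth_mem_indistinguishable hθs, ?_⟩
  by_contra! hex
  obtain ⟨θ', hθ', hne⟩ := hex
  obtain ⟨M, hM, T, hT, hTM, m, hR⟩ := exists_regime hC.ε_pos hθs hz.ratio hθ' hne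
  set E := indistinguishable C c₀ θs z with hE
  have hEpool : ∀ θ ∈ E, θ ∈ C.pool := fun θ hθ => (mem_indistinguishable.1 hθ).1
  have hmixed := frequently_isMixed hTM hR fun j =>
    hz.progress E (Finset.mem_powerset.2 hEpool) M (hEpool M hM) T (hEpool T hT) m j hM hT
  have hagree : ∀ᶠ n in atTop, ∀ θ ∈ E, C.f (C.alt c₀ θs z n) θ = C.f (C.alt c₀ θs z n) θs := by
    rw [Finset.eventually_all]
    exact fun θ hθ => (mem_indistinguishable.1 hθ).2.mono fun n h => not_not.1 h
  have hL : 0 < C.L := by have := hC.two_le; omega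
  have hp0 : ∀ n i, 0 < (C.run c₀ θs z n).prob i := fun n i => by
    rw [hC.run_prob]; exact hC.probFromHist_pos _ _ _
  have hp1 : ∀ n, ∑ i, (C.run c₀ θs z n).prob i = 1 := fun n => by
    rw [hC.run_prob]; exact hC.sum_probFromHist _ _
  have hconst : ∀ n, (∀ θ ∈ E, C.f (C.alt c₀ θs z n) θ = C.f (C.alt c₀ θs z n) θs) →
      IsMixed E (C.run c₀ θs z n).cand → ∀ i j,
        C.f (C.alt c₀ θs z n) ((C.run c₀ θs z n).cand i) =
          C.f (C.alt c₀ θs z n) ((C.run c₀ θs z n).cand j) := fun n h1 h2 i j => by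
    rw [h1 _ (h2.1 i), h1 _ (h2.1 j)]
  rcases hpol : C.policy with _ | _
  -- KGDP-f: scores are nonnegative with maximum 0, so every alternative is a maximizer. The tie
  -- rule then measures one separating `θ'` from the truth infinitely often, although `θ' ∈ E`.
  · obtain ⟨x, hx⟩ := hinj θ' (hEpool θ' hθ') θs hθs hne
    have hfreq := hz.tie hpol x ((hmixed.and_eventually hagree).mono fun n h => by
      have hscore : C.score (C.run c₀ θs z n).cand (C.run c₀ θs z n).prob =
          C.scoreF (C.run c₀ θs z n).cand (C.run c₀ θs z n).prob := by
        unfold score; rw [hpol]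
      have hmem := hz.alt_mem n
      rw [hscore, mem_argmaxSet, scoreF_of_const (hp1 n) (hconst n h.2 h.1)] at hmem
      rw [hscore, mem_argmaxSet]
      exact fun y => (hmem y).trans (scoreF_nonneg hC.σ_pos hL (hp0 n) (hp1 n)))
    obtain ⟨n, hn1, hn2⟩ := (hfreq.and_eventually hagree).exists
    have := hn2 θ' hθ'
    rw [hn1] at this
    exact hx this
  -- KGDP-H: an alternative that separates two distinct candidates has a positive score, above the
  -- maximum 0. No randomness in the ties is needed.
  · obtain ⟨n, hn1, hn2⟩ := (hmixed.and_eventually hagree).exists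
    obtain ⟨-, i, j, hij⟩ := id hn1
    obtain ⟨x, hx⟩ := hinj _ (run_cand_mem hc₀ z n i) _ (run_cand_mem hc₀ z n j) hij
    have hscore : C.score (C.run c₀ θs z n).cand (C.run c₀ θs z n).prob =
        C.scoreH (C.run c₀ θs z n).cand (C.run c₀ θs z n).prob := by
      unfold score; rw [hpol]
    have hmem := hz.alt_mem n
    rw [hscore, mem_argmaxSet, scoreH_of_const (hp1 n) (hconst n hn2 hn1)] at hmem
    exact absurd (scoreH_pos hC.σ_pos hL (hp0 n) (hp1 n) hx) (not_lt.2 (hmem x))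

theorem Typical.conclusion (hz : Typical C c₀ θs z) (hC : C.Admissible)
    (hc₀ : ∀ i, c₀ i ∈ C.pool) (hθs : θs ∈ C.pool)
    (hinj : ∀ θ ∈ C.pool, ∀ θ' ∈ C.pool, θ ≠ θ' → ∃ x, C.f x θ ≠ C.f x θ') :
    (∀ᶠ n in atTop, ∃ i, (C.run c₀ θs z n).cand i = θs) ∧
    Tendsto (fun n => C.probOf (C.run c₀ θs z n) θs) atTop (𝓝 1) ∧
    (∀ x, Tendsto (fun n => C.fbar (C.run c₀ θs z n).cand (C.run c₀ θs z n).prob x) atTop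
      (𝓝 (C.f x θs))) ∧
    (∀ᶠ n in atTop, ∀ x,
      x ∈ argmaxSet (C.fbar (C.run c₀ θs z n).cand (C.run c₀ θs z n).prob) →
      ∀ x', C.f x' θs ≤ C.f x θs) ∧
    (∀ᶠ n in atTop, ∀ θ ∈ C.pool, θ ≠ θs →
      C.mse (C.run c₀ θs z n).hist θs < C.mse (C.run c₀ θs z n).hist θ) := by
  classical
  have hE := hz.indistinguishable_eq hC hc₀ hθs hinj
  have hlow : ∀ e : ℝ, 0 < e → ∀ᶠ n in atTop, ∀ θ ∈ C.pool, θ ≠ θs →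
      C.likelihood (C.run c₀ θs z n).hist θ <
        e * C.likelihood (C.run c₀ θs z n).hist θs := fun e he => by
    refine (eventually_likelihood_lt_of_notMem hz.ratio he).mono fun n h θ hθ hne => h θ hθ ?_
    rwa [hE, Finset.mem_singleton]
  -- The degenerate regime in which `E`, `M` and `T` all reduce to the truth and the constant is 1;
  -- it is the member `m = 0` of the countable family in `Typical`.
  have hR : ∀ᶠ n in atTop,
      C.Regime (C.run c₀ θs z n).hist {θs} θs θs (1 / (((0 : ℕ) : ℝ) + 1)) := by
    filter_upwards [hlow 1 one_pos, hlow _ hC.ε_pos] with n h1 h2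
    have hle : ∀ θ ∈ C.pool, C.likelihood (C.run c₀ θs z n).hist θ ≤
        C.likelihood (C.run c₀ θs z n).hist θs := fun θ hθ => by
      rcases eq_or_ne θ θs with rfl | hne
      · exact le_rfl
      · exact (h1 θ hθ hne).le.trans (one_mul _).le
    exact ⟨hle, fun θ hθ _ => hle θ hθ, by simp, fun θ hθ hne => h2 θ hθ (by simpa using hne)⟩
  have hcand := eventually_exists_cand_eq hC hc₀ hR
    (hz.progress {θs} (by simpa using hθs) θs hθs θs hθs 0 0 (by simp) (by simp))
  have hsum : ∀ n, ∑ i, (C.run c₀ θs z n).prob i = 1 := fun n => by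
    rw [hC.run_prob]; exact hC.sum_probFromHist _ _
  have hpos : ∀ n i, 0 < (C.run c₀ θs z n).prob i := fun n i => by
    rw [hC.run_prob]; exact hC.probFromHist_pos _ _ _
  -- The mass of the wrong slots. Since the truth is in the list, each wrong slot is bounded by its
  -- likelihood ratio against the truth.
  have hrest : Tendsto (fun n => ∑ i, if (C.run c₀ θs z n).cand i = θs then 0
      else (C.run c₀ θs z n).prob i) atTop (𝓝 0) := by
    have hL := hC.L_pos
    rw [Metric.tendsto_nhds]
    intro e he
    filter_upwards [hcand, hlow (e / (2 * C.L)) (by positivity)] with n hn1 hn2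
    have h0 : ∀ i, 0 ≤ (if (C.run c₀ θs z n).cand i = θs then 0
        else (C.run c₀ θs z n).prob i) := fun i => by
      split_ifs
      · exact le_rfl
      · exact (hpos n i).le
    rw [Real.dist_eq, sub_zero, abs_of_nonneg (Finset.sum_nonneg fun i _ => h0 i)]
    calc _ ≤ ∑ _i : Fin C.L, e / (2 * C.L) := Finset.sum_le_sum fun i _ => by
          split_ifs with hi
          · positivity
          · obtain ⟨j, hj⟩ := hn1
            rw [hC.run_prob]
            refine (hC.probFromHist_lt _ _ i j (by positivity) ?_).le
            rw [hj]
            exact hn2 _ (run_cand_mem hc₀ z n i) hi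
      _ = e / 2 := by
          rw [Finset.sum_const, Finset.card_univ, Fintype.card_fin, nsmul_eq_mul]
          field_simp
      _ < e := by linarith
  have hprob : Tendsto (fun n => C.probOf (C.run c₀ θs z n) θs) atTop (𝓝 1) := by
    have e : ∀ n, C.probOf (C.run c₀ θs z n) θs = 1 - ∑ i,
        if (C.run c₀ θs z n).cand i = θs then 0 else (C.run c₀ θs z n).prob i := fun n => by
      rw [← hsum n, ← Finset.sum_sub_distrib]
      unfold probOf
      refine Finset.sum_congr rfl fun i _ => ?_
      split_ifs <;> simp
    simp_rw [e]
    simpa using hrest.const_sub 1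
  have hfbar : ∀ x, Tendsto (fun n => C.fbar (C.run c₀ θs z n).cand (C.run c₀ θs z n).prob x)
      atTop (𝓝 (C.f x θs)) := by
    intro x
    rw [tendsto_iff_norm_sub_tendsto_zero]
    have hB := hrest.const_mul (∑ θ ∈ C.pool, |C.f x θ - C.f x θs|)
    rw [mul_zero] at hB
    refine squeeze_zero (fun n => norm_nonneg _) (fun n => ?_) hB
    have e : C.fbar (C.run c₀ θs z n).cand (C.run c₀ θs z n).prob x - C.f x θs =
        ∑ i, (C.f x ((C.run c₀ θs z n).cand i) - C.f x θs) * (C.run c₀ θs z n).prob i := by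
      unfold fbar
      simp_rw [sub_mul]
      rw [Finset.sum_sub_distrib, ← Finset.mul_sum, hsum, mul_one]
    rw [e, Real.norm_eq_abs, Finset.mul_sum]
    refine (Finset.abs_sum_le_sum_abs _ _).trans (Finset.sum_le_sum fun i _ => ?_)
    rw [abs_mul, abs_of_pos (hpos n i)]
    split_ifs with hi
    · simp [hi]
    · have := hpos n i
      gcongr
      exact Finset.single_le_sum (f := fun θ => |C.f x θ - C.f x θs|)
        (fun _ _ => abs_nonneg _) (run_cand_mem hc₀ z n i)
  refine ⟨hcand, hprob, hfbar, ?_, ?_⟩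
  -- With finitely many alternatives, all strict inequalities of the true function eventually hold
  -- for the estimate simultaneously.
  · have hev : ∀ᶠ n in atTop, ∀ x x', C.f x θs < C.f x' θs →
        C.fbar (C.run c₀ θs z n).cand (C.run c₀ θs z n).prob x <
          C.fbar (C.run c₀ θs z n).cand (C.run c₀ θs z n).prob x' := by
      rw [eventually_all]; intro x
      rw [eventually_all]; intro x'
      rw [eventually_imp_distrib_left]
      exact fun h => (hfbar x).eventually_lt (hfbar x') h
    filter_upwards [hev] with n hn x hx x'
    by_contra hlt
    exact absurd (mem_argmaxSet.1 hx x') (not_le.2 (hn x x' (not_le.1 hlt)))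
  · filter_upwards [hlow 1 one_pos] with n hn θ hθ hne
    refine hC.mse_lt_of_likelihood_lt ?_
    simpa using hn θ hθ hne

end Path

end Config

end KGDP

/-! ### Transfer from the product law of noise and seeds to the two given probability spaces. -/

theorem mainTheorem2 {X Θ : Type*} [Fintype X] [Nonempty X]
    (C : KGDP.Config X Θ) (θs : Θ) (c₀ : Fin C.L → Θ)
    (hσ : 0 < C.σ)
    (hθs : θs ∈ C.pool)
    (hinj : ∀ θ ∈ C.pool, ∀ θ' ∈ C.pool, θ ≠ θ' → ∃ x, C.f x θ ≠ C.f x θ')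
    (hc₀ : ∀ i, c₀ i ∈ C.pool)
    (hLR : C.L ≤ C.R) (hRK : C.R ≤ C.pool.card)
    (hdrop : 1 ≤ C.drop) (hdropL : C.drop < C.L)
    (hres : 1 ≤ C.nResamp)
    (hε : 0 < C.ε) (hεL : C.ε < 1 / (C.L : ℝ))
    (htie : ∀ A : Finset X, A.Nonempty → (∀ x ∈ A, 0 ≤ C.tie A x) ∧ ∃ x ∈ A, 0 < C.tie A x)
    (htief : C.policy = KGDP.Policy.KGf → ∀ A : Finset X, ∀ x ∈ A, 0 < C.tie A x)
    {Ω Ωθ : Type*} [MeasurableSpace Ω] [MeasurableSpace Ωθ]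
    (P : Measure Ω) [IsProbabilityMeasure P] (Pθ : Measure Ωθ) [IsProbabilityMeasure Pθ]
    (W : ℕ → Ω → ℝ) (hWm : ∀ n, Measurable (W n)) (hWi : iIndepFun W P)
    (hWlaw : ∀ n, P.map (W n) = C.noiseLaw)
    (U : KGDP.Seed C.L → Ωθ → ℝ) (hUm : ∀ s, Measurable (U s)) (hUi : iIndepFun U Pθ)
    (hUlaw : ∀ s, Pθ.map (U s) = volume.restrict (Set.Icc (0 : ℝ) 1)) :
    ∀ᵐ ω ∂(P.prod Pθ),
      let S : ℕ → KGDP.State X Θ C.L :=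
        C.state c₀ θs (fun n => W n ω.1) (fun s => U s ω.2)
      (∀ᶠ n in atTop, ∃ i, (S n).cand i = θs) ∧
      Tendsto (fun n => C.probOf (S n) θs) atTop (𝓝 1) ∧
      (∀ x, Tendsto (fun n => C.fbar (S n).cand (S n).prob x) atTop (𝓝 (C.f x θs))) ∧
      (∀ᶠ n in atTop, ∀ x, x ∈ KGDP.argmaxSet (C.fbar (S n).cand (S n).prob) →
        ∀ x', C.f x' θs ≤ C.f x θs) ∧
      (∀ᶠ n in atTop, ∀ θ ∈ C.pool, θ ≠ θs →
        C.mse (S n).hist θs < C.mse (S n).hist θ) := by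
  have hC : C.Admissible := ⟨hσ, hLR, hRK, hdrop, hdropL, hres, hε, hεL⟩
  have hmeas : Measurable fun ω : Ω × Ωθ =>
      (Sum.elim (fun n => W n ω.1) (fun s => U s ω.2) : ℕ ⊕ KGDP.Seed C.L → ℝ) := by
    refine measurable_pi_lambda _ fun i => ?_
    rcases i with i | i
    · exact (hWm i).comp measurable_fst
    · exact (hUm i).comp measurable_snd
  have hmap := KGDP.map_sumElim_prod C.law W hWm hWi hWlaw U hUm hUi hUlaw
  have hae := KGDP.Config.ae_typical (c₀ := c₀) (θs := θs) hC hc₀ (fun A x hx =>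
    (htie A ⟨x, hx⟩).1 x hx) htief
  rw [KGDP.Config.jointLaw, ← hmap] at hae
  filter_upwards [ae_of_ae_map hmeas.aemeasurable hae] with ω hω
  exact hω.conclusion hC hc₀ hθs hinj
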